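/- Let $d\ge 1$, let $\mathcal D=\{[j2^k,(j+1)2^k): j,k\in\mathbb Z\}$ be the dyadic intervals of $\mathbb R$, and let $\mathcal R=\mathcal D^d$ be the dyadic rectangles $R=R_{(1)}\times\cdots\times R_{(d)}$ in $\mathbb R^d$. Write $c(I)$ for the center and $|I|$ for the length of an interval $I$. For $K\in\mathbb R$ and $N\in\mathbb N$, a differentiable function $\psi:\mathbb R\to\mathbb C$ is *$(K,N)$-adapted* to $I\in\mathcal D$ if $\|\psi\|_2\le 1$ and $$|D^n\psi(x)|\le K|I|^{-n-\frac12}\Bigl(1+\tfrac{|x-c(I)|}{|I|}\Bigr)^{-N},\qquad x\in\mathbb R,\ n=0,1.$$ A function $\varphi:\mathbb R^d\to\mathbb C$ is $(K,N)$-adapted to $R\in\mathcal R$ if $\varphi(x)=\prod_{j=1}^d\varphi_j(x_j)$ with each $\varphi_j$ being $(K,N)$-adapted to $R_{(j)}$. It *has zeros in the $j$th coordinate* if $\int_{\mathbb R}\varphi(x_1,\dots,x_d)\,dx_j=0$ for all values of $x_k$, $k\ne j$. Given functions $\{\varphi_R: R\in\mathcal R\}$, a choice for each coordinate $j\in\{1,\dots,d\}$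 of $T_j$ to be either the square function $S$ (put $\sigma(j)=2$) or the maximal function $M$ (put $\sigma(j)=\infty$), and a permutation $\pi$ of $\{1,\dots,d\}$, the governing operator $T=T_{\pi(1)}\cdots T_{\pi(d)}$ is defined by $$Tf(x)=\Bigl\|\cdots\Bigl\|\Bigl\{\frac{|\langle f,\varphi_R\rangle|}{\sqrt{|R|}}\mathbf 1_R(x): R\in\mathcal R\Bigr\}\Bigr\|_{\ell^{\sigma(\pi(d))}(R_{(\pi(d))})}\cdots\Bigr\|_{\ell^{\sigma(\pi(1))}(R_{(\pi(1))})},$$ the norm in the side $R_{(\pi(d))}\in\mathcal D$ being taken first and the norm in the side $R_{(\pi(1))}\in\mathcal D$ last. Here $\langle f,\varphi\rangle=\int_{\mathbb R^d} f\overline{\varphi}\,dx$. **Proposition.** For each $d$ there is $N_0$ such that for all $N\ge N_0$, all $K$ and all $1<p<\infty$ there is a finite constant $C=C(d,N,K,p)$ with the following property. Let $T$ be any governing operator formed over functions $\{\varphi_R: R\in\mathcal R\}$ such that each $\varphi_R$ is $(K,N)$-adapted to $R$ and such that, for every coordinate $j$ in which $T_j$ is the square function, all $\varphi_R$ have zeros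 in the $j$th coordinate. Then $T$ maps $L^p(\mathbb R^d)$ into itself, and $$\|Tf\|_{L^p(\mathbb R^d)}\le C\,\|f\|_{L^p(\mathbb R^d)}\qquad\text{for all } f\in L^p(\mathbb R^d).$$ -/

import Mathlib

open MeasureTheory
open scoped ENNReal NNReal ComplexConjugate

noncomputable section

namespace MultiParaproduct

/-- The dyadic interval `[j 2^k, (j+1) 2^k)`, recorded by its scale `k` and its position `j`.
Different pairs `(k, j)` give different intervals, so sums and suprema over this type are
sums and suprema over the collection of all dyadic intervals. -/
structure DyadicInterval where
  scale : ℤ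
  pos : ℤ

namespace DyadicInterval

/-- The length `|I| = 2^k`. -/
def length (I : DyadicInterval) : ℝ := (2 : ℝ) ^ I.scale

/-- The interval as a subset of the line. -/
def toSet (I : DyadicInterval) : Set ℝ :=
  Set.Ico ((I.pos : ℝ) * 2 ^ I.scale) (((I.pos : ℝ) + 1) * 2 ^ I.scale)

/-- The center `c(I)`. -/
def center (I : DyadicInterval) : ℝ := ((I.pos : ℝ) + 1 / 2) * 2 ^ I.scale

end DyadicInterval

/-- `ψ : ℝ → ℂ` is adapted to `I` with constant `K` and decay exponent `N`: its `L²` norm is at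
most one and `|Dⁿ ψ(x)| ≤ K |I|^{-n-1/2} (1 + |x - c(I)| / |I|)^{-N}` for `n = 0, 1`. -/
structure IsAdapted (K : ℝ) (N : ℕ) (I : DyadicInterval) (ψ : ℝ → ℂ) : Prop where
  differentiable : Differentiable ℝ ψ
  eLpNorm_le_one : eLpNorm ψ 2 volume ≤ 1
  norm_iteratedDeriv_le : ∀ n : ℕ, n ≤ 1 → ∀ x : ℝ,
    ‖iteratedDeriv n ψ x‖ ≤
      K * I.length ^ (-(n : ℝ) - 1 / 2) * (1 + |x - I.center| / I.length) ^ (-(N : ℤ))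

/-- Dyadic rectangles in `ℝ^d`: one dyadic interval for each coordinate. -/
abbrev DyadicRectangle (d : ℕ) : Type := Fin d → DyadicInterval

namespace DyadicRectangle

/-- The rectangle as a subset of `ℝ^d`. -/
def toSet {d : ℕ} (R : DyadicRectangle d) : Set (Fin d → ℝ) :=
  {x | ∀ j, x j ∈ (R j).toSet}

/-- The volume `|R|`. -/
def vol {d : ℕ} (R : DyadicRectangle d) : ℝ := ∏ j, (R j).length

end DyadicRectangle

/-- `φ` is adapted to the rectangle `R`: it is a product of functions of one variable, the `j`-th
of which is adapted to the `j`-th side of `R`. -/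
def IsAdaptedRect {d : ℕ} (K : ℝ) (N : ℕ) (R : DyadicRectangle d)
    (φ : (Fin d → ℝ) → ℂ) : Prop :=
  ∃ ψ : Fin d → ℝ → ℂ, (∀ j, IsAdapted K N (R j) (ψ j)) ∧ ∀ x, φ x = ∏ j, ψ j (x j)

/-- The function `φ` has zeros in the `j`-th coordinate: `∫ φ(x₁, …, x_d) dx_j = 0` for all values
of the other variables. -/
def HasZeros {d : ℕ} (j : Fin d) (φ : (Fin d → ℝ) → ℂ) : Prop :=
  ∀ x : Fin d → ℝ, ∫ t : ℝ, φ (Function.update x j t) = 0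

/-- The type of the operator acting in one coordinate: square function `S` or maximal
function `M`. -/
inductive OpKind where
  | square
  | maximal

/-- The norm belonging to the type of operator: `ℓ²` for `S`, `ℓ^∞` for `M`. -/
def OpKind.seqNorm : OpKind → (DyadicInterval → ℝ≥0∞) → ℝ≥0∞
  | .square, a => (∑' I, a I ^ 2) ^ (1 / 2 : ℝ)
  | .maximal, a => ⨆ I, a I

/-- Take the norm of type `κ` of the array `a = (a_R)` in the `j`-th side of `R` alone. The result
no longer depends on that side. -/
def coordNorm {d : ℕ} (κ : OpKind) (j : Fin d) (a : DyadicRectangle d → ℝ≥0∞) :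
    DyadicRectangle d → ℝ≥0∞ :=
  fun R => κ.seqNorm fun I => a (Function.update R j I)

/-- The array `|⟨f, φ_R⟩| |R|^{-1/2} 1_R(x)`, indexed by the dyadic rectangles `R`. -/
def coeff {d : ℕ} (φ : DyadicRectangle d → (Fin d → ℝ) → ℂ) (f : (Fin d → ℝ) → ℂ)
    (x : Fin d → ℝ) (R : DyadicRectangle d) : ℝ≥0∞ :=
  R.toSet.indicator
    (fun _ => ENNReal.ofReal (‖∫ y, f y * conj (φ R y)‖ / Real.sqrt R.vol)) x

/-- The governing operator `T = T_{π(1)} ⋯ T_{π(d)}`, where `T_j` is of type `σ j`: the norm in the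
side `R_{π(d)}` is taken first (innermost) and the norm in the side `R_{π(1)}` last (outermost).
As each coordinate is used once, the final array is constant, and it is evaluated at an arbitrary
rectangle. -/
def governingOp {d : ℕ} (σ : Fin d → OpKind) (π : Equiv.Perm (Fin d))
    (φ : DyadicRectangle d → (Fin d → ℝ) → ℂ) (f : (Fin d → ℝ) → ℂ) (x : Fin d → ℝ) : ℝ≥0∞ :=
  (List.ofFn π).foldr (fun j a => coordNorm (σ j) j a) (coeff φ f x) (fun _ => ⟨0, 0⟩)

end MultiParaproduct

end

namespace MultiParaproduct

/-! By Rubio de Francia extrapolation it is enough to bound `T` on `L²(w)`, uniformly over weights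
`w` on `ℝ^d` that are `A₂` with a fixed constant on all lines parallel to the axes (`IsLineA2`). In
`L²(w)` sums of squares and integrals can be interchanged freely, and this is what tames mixed
compositions of square and maximal functions.

The order of the norms is removed pointwise. Each coefficient is dominated by `majorant`, built one
coordinate at a time (`enorm_integral_mul_prod_le`). In a coordinate of a square function the mean
zero bump is expanded in Haar functions; its Haar coefficients are almost diagonal, through
smoothness on finer intervals and through cancellation on coarser ones (`IsBump.haarSize_fine_le`,
`IsBump.haarSize_coarse_le`). In a coordinate of a maximal function the integral against the bump is
at most a multiple of the one-dimensional maximal function, a bound that does not see the interval.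
Hence the suprema cost nothing, and in whatever order the norms are taken, `(Tf)²` is at most a
constant times a single sum of squares, the `energy` (`sq_governingOp_le`).

The weighted bound for the energy follows by induction on the dimension and Fubini
(`exists_lintegral_energy_mul_le`) from three facts about an `A₂` weight on the line. The maximal
function is bounded on `L²(w)`, by comparison with maximal functions relative to the measures `w`
and `w⁻¹` (`exists_lintegral_maxFn_sq_mul_le`). The almost diagonal operator is bounded on `ℓ²`
weighted by the masses `w(I)`, by a Schur test that uses the doubling of these masses and their
geometric decrease under halving (`exists_tsum_mass_mul_sq_almostDiag_le`). The Haar square function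
is bounded on `L²(w)`, by a Bellman function (`tsum_mass_mul_haarDiff_le`).

For the extrapolation, `Tf` is paired with a dual function, and the weight is `H₂ / H₁`, where `H₁`
dominates `|f|`, `H₂` dominates the dual function, and neither is essentially smaller than its
maximal functions in the coordinate directions (`exists_lintegral_rpow_le_of_weighted`). All of this
is done for bounded `f` of compact support; Fatou's lemma gives the rest. -/

/-! ### The maximal function over intervals with rational endpoints -/

/-- A finite family of intervals has a subfamily with the same union in which no point is covered
more than twice. -/
theorem exists_subfamily_overlap_le_two {ι : Type*} (a b : ι → ℝ) (s : Finset ι) :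
    ∃ t ⊆ s, (⋃ i ∈ s, Set.Ico (a i) (b i)) ⊆ (⋃ i ∈ t, Set.Ico (a i) (b i)) ∧
      ∀ x : ℝ, (t.filter fun i => x ∈ Set.Ico (a i) (b i)).card ≤ 2 := by
  classical
  induction s using Finset.strongInduction with
  | H s ih =>
    by_cases h : ∀ x : ℝ, (s.filter fun i => x ∈ Set.Ico (a i) (b i)).card ≤ 2
    · exact ⟨s, subset_rfl, subset_rfl, h⟩
    · push Not at h
      obtain ⟨x, hx⟩ := h
      set u := s.filter fun i => x ∈ Set.Ico (a i) (b i) with hu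
      have hne : u.Nonempty := Finset.card_pos.1 (by omega)
      -- Among the intervals through `x`, one that reaches farthest left and one that reaches
      -- farthest right cover the union of all. At least three intervals pass through `x`, so a
      -- further one, `k`, is redundant and can be erased.
      obtain ⟨i, hi, hia⟩ := u.exists_min_image a hne
      obtain ⟨j, hj, hjb⟩ := u.exists_max_image b hne
      have hlt : ({i, j} : Finset ι).card < u.card :=
        lt_of_le_of_lt Finset.card_le_two hx
      obtain ⟨k, hk, hkn⟩ := Finset.exists_mem_notMem_of_card_lt_card hlt
      have hki : i ≠ k := by rintro rfl; simp at hkn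
      have hkj : j ≠ k := by rintro rfl; simp at hkn
      simp only [hu, Finset.mem_filter, Set.mem_Ico] at hi hj hk
      have hiak := hia k (by simp [hu, hk])
      have hjbk := hjb k (by simp [hu, hk])
      obtain ⟨t, hts, hcov, hov⟩ := ih (s.erase k) (Finset.erase_ssubset hk.1)
      refine ⟨t, hts.trans (Finset.erase_subset _ _), ?_, hov⟩
      refine Set.Subset.trans ?_ hcov
      intro y hy
      simp only [Set.mem_iUnion, Set.mem_Ico, exists_prop, Finset.mem_erase] at hy ⊢
      obtain ⟨l, hl, hyl⟩ := hy
      by_cases hlk : l = k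
      · subst hlk
        by_cases hyx : y ≤ x
        · exact ⟨i, ⟨hki, hi.1⟩, by linarith, by linarith⟩
        · exact ⟨j, ⟨hkj, hj.1⟩, by linarith, by linarith⟩
      · exact ⟨l, ⟨hlk, hl⟩, hyl⟩

/-- Passing to a subfamily with the same union and overlap at most two costs only the factor 2. No
interval is enlarged, so `μ` need not be doubling. -/
theorem mul_measure_finset_iUnion_le {ι : Type*} (μ : Measure ℝ) {f : ℝ → ℝ≥0∞}
    (hf : Measurable f) (c : ℝ≥0∞) (a b : ι → ℝ) (s : Finset ι)
    (h : ∀ i ∈ s, c * μ (Set.Ico (a i) (b i)) ≤ ∫⁻ x in Set.Ico (a i) (b i), f x ∂μ) :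
    c * μ (⋃ i ∈ s, Set.Ico (a i) (b i)) ≤ 2 * ∫⁻ x in ⋃ i ∈ s, Set.Ico (a i) (b i), f x ∂μ := by
  classical
  obtain ⟨t, hts, hcov, hov⟩ := exists_subfamily_overlap_le_two a b s
  have hU : MeasurableSet (⋃ i ∈ s, Set.Ico (a i) (b i)) :=
    Finset.measurableSet_biUnion _ fun _ _ => measurableSet_Ico
  calc c * μ (⋃ i ∈ s, Set.Ico (a i) (b i))
      ≤ c * ∑ i ∈ t, μ (Set.Ico (a i) (b i)) := by
        gcongr
        exact (measure_mono hcov).trans (measure_biUnion_finset_le _ _)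
    _ ≤ ∑ i ∈ t, ∫⁻ x in Set.Ico (a i) (b i), f x ∂μ := by
        rw [Finset.mul_sum]
        exact Finset.sum_le_sum fun i hi => h i (hts hi)
    _ = ∫⁻ x, ∑ i ∈ t, (Set.Ico (a i) (b i)).indicator f x ∂μ := by
        rw [lintegral_finsetSum _ fun i _ => hf.indicator measurableSet_Ico]
        simp_rw [lintegral_indicator measurableSet_Ico]
    _ ≤ ∫⁻ x, 2 * (⋃ i ∈ s, Set.Ico (a i) (b i)).indicator f x ∂μ := by
        refine lintegral_mono fun x => ?_
        by_cases hx : x ∈ ⋃ i ∈ s, Set.Ico (a i) (b i)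
        · simp only [Set.indicator_of_mem hx, Set.indicator_apply]
          rw [← Finset.sum_filter, Finset.sum_const, nsmul_eq_mul]
          gcongr
          exact_mod_cast hov x
        · rw [Finset.sum_eq_zero]
          · simp
          · intro i hi
            refine Set.indicator_of_notMem (fun hxi => hx ?_) _
            exact Set.mem_biUnion (hts hi) hxi
    _ = _ := by
        rw [lintegral_const_mul _ (hf.indicator hU), lintegral_indicator hU]

theorem mul_measure_iUnion_le {ι : Type*} [Countable ι] (μ : Measure ℝ) {f : ℝ → ℝ≥0∞}
    (hf : Measurable f) (c : ℝ≥0∞) (a b : ι → ℝ)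
    (h : ∀ i, c * μ (Set.Ico (a i) (b i)) ≤ ∫⁻ x in Set.Ico (a i) (b i), f x ∂μ) :
    c * μ (⋃ i, Set.Ico (a i) (b i)) ≤ 2 * ∫⁻ x in ⋃ i, Set.Ico (a i) (b i), f x ∂μ := by
  classical
  rw [Set.iUnion_eq_iUnion_finset, Directed.measure_iUnion, ENNReal.mul_iSup]
  · refine iSup_le fun s => (mul_measure_finset_iUnion_le μ hf c a b s fun i _ => h i).trans ?_
    gcongr
    exact Set.subset_iUnion (fun s : Finset ι => ⋃ i ∈ s, Set.Ico (a i) (b i)) s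
  · intro s t
    exact ⟨s ∪ t, Set.biUnion_subset_biUnion_left fun x => Finset.mem_union_left _,
      Set.biUnion_subset_biUnion_left fun x => Finset.mem_union_right _⟩

/-- The uncentered maximal function with respect to `μ`, over intervals `[a, b)` with rational
endpoints. -/
noncomputable def maxFn (μ : Measure ℝ) (f : ℝ → ℝ≥0∞) (x : ℝ) : ℝ≥0∞ :=
  ⨆ q : ℚ × ℚ, (Set.Ico (q.1 : ℝ) q.2).indicator
    (fun _ => (∫⁻ t in Set.Ico (q.1 : ℝ) q.2, f t ∂μ) / μ (Set.Ico (q.1 : ℝ) q.2)) x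

/-- With rational endpoints the supremum is countable, so nothing has to be assumed about `f`. -/
theorem measurable_maxFn (μ : Measure ℝ) (f : ℝ → ℝ≥0∞) : Measurable (maxFn μ f) :=
  Measurable.iSup fun _ => measurable_const.indicator measurableSet_Ico

theorem average_le_maxFn (μ : Measure ℝ) (f : ℝ → ℝ≥0∞) {a b : ℚ} {x : ℝ}
    (hx : x ∈ Set.Ico (a : ℝ) b) :
    (∫⁻ t in Set.Ico (a : ℝ) b, f t ∂μ) / μ (Set.Ico (a : ℝ) b) ≤ maxFn μ f x := by
  refine le_trans ?_ (le_iSup _ ((a, b) : ℚ × ℚ))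
  rw [Set.indicator_of_mem hx]

theorem maxFn_le {μ : Measure ℝ} {f : ℝ → ℝ≥0∞} {x : ℝ} {c : ℝ≥0∞}
    (h : ∀ a b : ℚ, x ∈ Set.Ico (a : ℝ) b →
      (∫⁻ t in Set.Ico (a : ℝ) b, f t ∂μ) / μ (Set.Ico (a : ℝ) b) ≤ c) :
    maxFn μ f x ≤ c :=
  iSup_le fun q => by
    by_cases hx : x ∈ Set.Ico (q.1 : ℝ) q.2
    · rw [Set.indicator_of_mem hx]; exact h _ _ hx
    · rw [Set.indicator_of_notMem hx]; exact zero_le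

theorem maxFn_mono {μ : Measure ℝ} {f g : ℝ → ℝ≥0∞} (h : ∀ x, f x ≤ g x) (x : ℝ) :
    maxFn μ f x ≤ maxFn μ g x :=
  maxFn_le fun _ _ hx =>
    (ENNReal.div_le_div_right (lintegral_mono fun t => h t) _).trans (average_le_maxFn μ g hx)

/-- The weak type bound for the maximal function. -/
theorem mul_measure_maxFn_le (μ : Measure ℝ) {f : ℝ → ℝ≥0∞} (hf : Measurable f) (c : ℝ≥0∞) :
    c * μ {x | c < maxFn μ f x} ≤ 2 * ∫⁻ x, f x ∂μ := by
  let ι := {q : ℚ × ℚ // c < (∫⁻ t in Set.Ico (q.1 : ℝ) q.2, f t ∂μ) / μ (Set.Ico (q.1 : ℝ) q.2)}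
  have hsub : {x | c < maxFn μ f x} ⊆ ⋃ i : ι, Set.Ico (i.1.1 : ℝ) i.1.2 := by
    intro x hx
    obtain ⟨q, hq⟩ := lt_iSup_iff.1 (show c < maxFn μ f x from hx)
    by_cases hxq : x ∈ Set.Ico (q.1 : ℝ) q.2
    · rw [Set.indicator_of_mem hxq] at hq
      exact Set.mem_iUnion.2 ⟨⟨q, hq⟩, hxq⟩
    · rw [Set.indicator_of_notMem hxq] at hq
      exact absurd hq not_lt_zero
  refine (mul_le_mul_right (measure_mono hsub) c).trans ?_
  refine (mul_measure_iUnion_le μ hf c _ _ fun i => ?_).trans ?_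
  · exact ENNReal.mul_le_of_le_div i.2.le
  · gcongr
    exact Measure.restrict_le_self

/-- The part of `f` below height `c` adds at most `c` to any average, so a maximal function above
`2c` must owe more than `c` to the part above `c`. In this form the weak type bound can be
integrated over all heights. -/
theorem mul_measure_maxFn_le_setLIntegral (μ : Measure ℝ) {f : ℝ → ℝ≥0∞} (hf : Measurable f)
    (c : ℝ≥0∞) (hc : c ≠ ∞) :
    c * μ {x | 2 * c < maxFn μ f x} ≤ 2 * ∫⁻ x in {x | c < f x}, f x ∂μ := by
  have hm : MeasurableSet {x | c < f x} := measurableSet_lt measurable_const hf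
  have key : ∀ x, maxFn μ f x ≤ maxFn μ ({x | c < f x}.indicator f) x + c := by
    intro x
    refine maxFn_le fun a b hx => ?_
    refine le_trans ?_ (add_le_add_left (average_le_maxFn μ _ hx) c)
    -- On intervals of mass zero or infinity the quotient is `0` by the conventions for division.
    by_cases h0 : μ (Set.Ico (a : ℝ) b) = 0
    · rw [setLIntegral_measure_zero _ _ h0]; simp
    by_cases ht : μ (Set.Ico (a : ℝ) b) = ∞
    · simp [ht]
    refine ENNReal.div_le_of_le_mul ?_
    rw [add_mul, ENNReal.div_mul_cancel h0 ht, ← setLIntegral_const,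
      ← lintegral_add_right _ measurable_const]
    refine lintegral_mono fun y => ?_
    by_cases hy : c < f y
    · simp [Set.indicator, hy]
    · simp only [Set.indicator, Set.mem_ofPred_eq, hy, if_false, zero_add]
      exact not_lt.1 hy
  refine le_trans ?_ ((mul_measure_maxFn_le μ (hf.indicator hm) c).trans ?_)
  · refine mul_le_mul_right (measure_mono fun x hx => ?_) c
    have h1 := lt_of_lt_of_le hx (key _)
    rw [two_mul] at h1
    exact (ENNReal.add_lt_add_iff_right hc).1 h1
  · rw [lintegral_indicator hm]

theorem tsum_int_le_of_forall_gt {g : ℤ → ℝ≥0∞} (m : ℤ) (h : ∀ k, m < k → g k = 0) :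
    ∑' k, g k = ∑' i : ℕ, g (m - i) := by
  refine (Function.Injective.tsum_eq (f := g) (g := fun i : ℕ => m - i) ?_ ?_).symm
  · intro i j hij; simp only at hij; omega
  · intro k hk
    have : ¬ m < k := fun h' => hk (h k h')
    exact ⟨(m - k).toNat, by simp only; omega⟩

/-- A dyadic layer cake upper bound for powers. -/
theorem rpow_le_tsum_zpow {p : ℝ} (hp : 1 < p) (y : ℝ≥0∞) :
    y ^ p ≤ ∑' k : ℤ, (2 ^ (k + 2) : ℝ≥0∞) ^ p * (if 2 * 2 ^ k < y then 1 else 0) := by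
  have hp0 : 0 < p := by linarith
  by_cases h0 : y = 0
  · simp [h0, hp0]
  by_cases ht : y = ∞
  · have h2 : (∞ : ℝ≥0∞) ≤ ∑' k : ℤ, (2 ^ (k + 2) : ℝ≥0∞) ^ p * (if 2 * 2 ^ k < y then 1 else 0) := by
      calc (∞ : ℝ≥0∞) = ∑' _ : ℕ, (1 : ℝ≥0∞) := (ENNReal.tsum_const_eq_top_of_ne_zero one_ne_zero).symm
        _ ≤ ∑' n : ℕ, (2 ^ ((n : ℤ) + 2) : ℝ≥0∞) ^ p * (if 2 * 2 ^ (n : ℤ) < y then 1 else 0) := by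
          refine ENNReal.tsum_le_tsum fun n => ?_
          have h3 : (2 * 2 ^ (n : ℤ) : ℝ≥0∞) < y := by
            rw [ht, zpow_natCast, ← pow_succ']
            exact ENNReal.pow_lt_top (by simp)
          rw [if_pos h3, mul_one]
          refine ENNReal.one_le_rpow ?_ hp0
          have : ((n : ℤ) + 2) = ((n + 2 : ℕ) : ℤ) := by push_cast; ring
          rw [this, zpow_natCast]
          exact one_le_pow₀ (by norm_num)
        _ ≤ _ := ENNReal.tsum_comp_le_tsum_of_injective (f := fun n : ℕ => (n : ℤ))
            Nat.cast_injective _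
    exact le_trans le_top h2
  obtain ⟨n, hn⟩ := ENNReal.exists_mem_Ioc_zpow h0 ht (y := 2) (by norm_num) (by simp)
  -- Since `2 ^ n < y ≤ 2 ^ (n + 1)`, the single term `k = n - 1` suffices.
  refine le_trans ?_ (ENNReal.le_tsum (n - 1))
  have h4 : (2 * 2 ^ (n - 1) : ℝ≥0∞) = 2 ^ n := by
    rw [ENNReal.zpow_sub (by norm_num) (by simp), zpow_one,
      mul_left_comm, ENNReal.mul_inv_cancel (by norm_num) (by simp), mul_one]
  rw [h4, if_pos hn.1, mul_one]
  have : n - 1 + 2 = n + 1 := by ring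
  rw [this]
  exact ENNReal.rpow_le_rpow hn.2 hp0.le

/-- The terms are `4 ^ p * 2 ^ (k (p - 1))` for `2 ^ k < y`. As `p > 1` this is a geometric sum
governed by its largest term. -/
theorem exists_tsum_zpow_le {p : ℝ} (hp : 1 < p) :
    ∃ C : ℝ≥0∞, C ≠ ∞ ∧ ∀ y : ℝ≥0∞,
      ∑' k : ℤ, (2 ^ (k + 2) : ℝ≥0∞) ^ p / 2 ^ k * (if 2 ^ k < y then 1 else 0)
        ≤ C * y ^ (p - 1) := by
  have hp0 : 0 < p - 1 := by linarith
  set r : ℝ≥0∞ := (2 : ℝ≥0∞)⁻¹ ^ (p - 1) with hr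
  have hr1 : r < 1 := ENNReal.rpow_lt_one (by norm_num) hp0
  have hA : (4 : ℝ≥0∞) ^ p ≠ ∞ := ENNReal.rpow_ne_top_of_nonneg (by linarith) (by simp)
  have hB : (1 - r)⁻¹ ≠ ∞ := by
    simp only [ne_eq, ENNReal.inv_eq_top, tsub_eq_zero_iff_le, not_le]; exact hr1
  -- The summand `1` keeps the constant away from zero, so that the right side is infinite when `y =
  -- ∞`.
  refine ⟨4 ^ p * (1 - r)⁻¹ + 1, by finiteness, fun y => ?_⟩
  have hz0 : ∀ k : ℤ, (2 ^ k : ℝ≥0∞) ≠ 0 := fun k => (ENNReal.zpow_pos (by norm_num) (by simp) k).ne'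
  have hzt : ∀ k : ℤ, (2 ^ k : ℝ≥0∞) ≠ ∞ := fun k => ENNReal.zpow_ne_top (by norm_num) (by simp) k
  by_cases h0 : y = 0
  · simp [h0]
  by_cases ht : y = ∞
  · rw [ht, ENNReal.top_rpow_of_pos hp0, ENNReal.mul_top (by simp)]; exact le_top
  obtain ⟨m, hm⟩ := ENNReal.exists_mem_Ioc_zpow h0 ht (y := 2) (by norm_num) (by simp)
  have hterm : ∀ k : ℤ, (2 ^ (k + 2) : ℝ≥0∞) ^ p / 2 ^ k = 4 ^ p * (2 ^ k) ^ (p - 1) := by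
    intro k
    rw [ENNReal.rpow_sub _ _ (hz0 k) (hzt k), ENNReal.rpow_one, ← mul_div_assoc,
      ← ENNReal.mul_rpow_of_nonneg _ _ (by linarith), ENNReal.zpow_add (by norm_num) (by simp)]
    congr 2
    rw [mul_comm]; norm_num
  rw [tsum_int_le_of_forall_gt m]
  · calc ∑' i : ℕ, (2 ^ (m - i + 2) : ℝ≥0∞) ^ p / 2 ^ (m - i) * (if 2 ^ (m - i) < y then 1 else 0)
        ≤ ∑' i : ℕ, 4 ^ p * y ^ (p - 1) * r ^ i := by
          refine ENNReal.tsum_le_tsum fun i => ?_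
          rw [hterm]
          have : (2 ^ (m - i) : ℝ≥0∞) = 2 ^ m * (2⁻¹) ^ i := by
            rw [sub_eq_add_neg, ENNReal.zpow_add (by norm_num) (by simp), ENNReal.zpow_neg,
              zpow_natCast, ENNReal.inv_pow]
          rw [this, ENNReal.mul_rpow_of_nonneg _ _ hp0.le, hr, ← ENNReal.rpow_natCast,
            ← ENNReal.rpow_natCast, ← ENNReal.rpow_mul, ← ENNReal.rpow_mul, mul_comm (i : ℝ),
            ← mul_assoc]
          refine (mul_le_mul_right (b := _) (c := 1) (by split_ifs <;> simp) _).trans ?_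
          rw [mul_one]
          gcongr
          exact hm.1.le
      _ = 4 ^ p * (1 - r)⁻¹ * y ^ (p - 1) := by
          rw [ENNReal.tsum_mul_left, ENNReal.tsum_geometric]; ring
      _ ≤ _ := by gcongr; exact le_self_add
  · intro k hk
    rw [if_neg, mul_zero]
    rw [not_lt]
    refine hm.2.trans ?_
    exact ENNReal.zpow_le_of_le (by norm_num) (by omega)

/-- The maximal function with respect to any measure on the line is bounded on `L^p`. -/
theorem exists_lintegral_maxFn_rpow_le {p : ℝ} (hp : 1 < p) :
    ∃ C : ℝ≥0∞, C ≠ ∞ ∧ ∀ (μ : Measure ℝ) (f : ℝ → ℝ≥0∞), Measurable f →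
      ∫⁻ x, maxFn μ f x ^ p ∂μ ≤ C * ∫⁻ x, f x ^ p ∂μ := by
  obtain ⟨C, hC, hCy⟩ := exists_tsum_zpow_le hp
  refine ⟨2 * C, by finiteness, fun μ f hf => ?_⟩
  have hM := measurable_maxFn μ f
  have hz0 : ∀ k : ℤ, (2 ^ k : ℝ≥0∞) ≠ 0 := fun k => (ENNReal.zpow_pos (by norm_num) (by simp) k).ne'
  have hzt : ∀ k : ℤ, (2 ^ k : ℝ≥0∞) ≠ ∞ := fun k => ENNReal.zpow_ne_top (by norm_num) (by simp) k
  have hmk : ∀ (c : ℝ≥0∞) {g : ℝ → ℝ≥0∞}, Measurable g →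
      Measurable fun x => if c < g x then (1 : ℝ≥0∞) else 0 := fun c g hg =>
    Measurable.ite (measurableSet_lt measurable_const hg) measurable_const measurable_const
  have hI : ∀ (c : ℝ≥0∞) {g h : ℝ → ℝ≥0∞}, Measurable g → Measurable h →
      ∫⁻ x, h x * (if c < g x then (1 : ℝ≥0∞) else 0) ∂μ = ∫⁻ x in {x | c < g x}, h x ∂μ := by
    intro c g h hg hh
    rw [← lintegral_indicator (measurableSet_lt measurable_const hg)]
    congr 1; ext x
    by_cases hx : c < g x <;> simp [Set.indicator, hx]
  calc ∫⁻ x, maxFn μ f x ^ p ∂μ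
      ≤ ∫⁻ x, ∑' k : ℤ, (2 ^ (k + 2) : ℝ≥0∞) ^ p * (if 2 * 2 ^ k < maxFn μ f x then 1 else 0) ∂μ :=
        lintegral_mono fun x => rpow_le_tsum_zpow hp _
    _ = ∑' k : ℤ, (2 ^ (k + 2) : ℝ≥0∞) ^ p * μ {x | 2 * 2 ^ k < maxFn μ f x} := by
        rw [lintegral_tsum fun k => ((hmk _ hM).const_mul _).aemeasurable]
        refine tsum_congr fun k => ?_
        rw [hI _ hM measurable_const, setLIntegral_const]
    _ ≤ ∑' k : ℤ, 2 * ∫⁻ x, (f x * ((2 ^ (k + 2) : ℝ≥0∞) ^ p / 2 ^ k *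
          (if 2 ^ k < f x then 1 else 0))) ∂μ := by
        refine ENNReal.tsum_le_tsum fun k => ?_
        have h1 := mul_measure_maxFn_le_setLIntegral μ hf (2 ^ k) (hzt k)
        have h2 : ∀ x, f x * ((2 ^ (k + 2) : ℝ≥0∞) ^ p / 2 ^ k * (if 2 ^ k < f x then 1 else 0)) =
          ((2 ^ (k + 2) : ℝ≥0∞) ^ p / 2 ^ k) * (f x * (if 2 ^ k < f x then 1 else 0)) := by
          intro x; ring
        simp_rw [h2]
        have h3 : Measurable fun x => f x * (if 2 ^ k < f x then (1 : ℝ≥0∞) else 0) :=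
          hf.mul (hmk _ hf)
        rw [lintegral_const_mul _ h3, hI _ hf hf]
        calc (2 ^ (k + 2) : ℝ≥0∞) ^ p * μ {x | 2 * 2 ^ k < maxFn μ f x}
            = (2 ^ (k + 2) : ℝ≥0∞) ^ p / 2 ^ k * (2 ^ k * μ {x | 2 * 2 ^ k < maxFn μ f x}) := by
              rw [← mul_assoc, ENNReal.div_mul_cancel (hz0 k) (hzt k)]
          _ ≤ _ := by
              rw [mul_left_comm 2]; gcongr
    _ = 2 * ∫⁻ x, f x * ∑' k : ℤ, ((2 ^ (k + 2) : ℝ≥0∞) ^ p / 2 ^ k *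
          (if 2 ^ k < f x then 1 else 0)) ∂μ := by
        have h3 : ∀ k : ℤ, AEMeasurable (fun x => f x * ((2 ^ (k + 2) : ℝ≥0∞) ^ p / 2 ^ k *
            (if 2 ^ k < f x then 1 else 0))) μ := fun k =>
          (hf.mul ((hmk _ hf).const_mul _)).aemeasurable
        rw [ENNReal.tsum_mul_left, ← lintegral_tsum h3]
        simp_rw [ENNReal.tsum_mul_left]
    _ ≤ 2 * ∫⁻ x, C * f x ^ p ∂μ := by
        refine mul_le_mul_right (lintegral_mono fun x => ?_) 2
        calc f x * ∑' k : ℤ, ((2 ^ (k + 2) : ℝ≥0∞) ^ p / 2 ^ k * (if 2 ^ k < f x then 1 else 0))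
            ≤ f x * (C * f x ^ (p - 1)) := by gcongr; exact hCy _
          _ = C * (f x ^ (1 : ℝ) * f x ^ (p - 1)) := by rw [ENNReal.rpow_one]; ring
          _ = C * f x ^ p := by
              rw [← ENNReal.rpow_add_of_nonneg _ _ zero_le_one (by linarith)]; congr 2; ring
    _ = _ := by rw [lintegral_const_mul _ (hf.pow_const p), mul_assoc]

/-! ### Muckenhoupt weights on the line -/

theorem sq_lintegral_mul_le {α : Type*} [MeasurableSpace α] (μ : Measure α) {f g : α → ℝ≥0∞}
    (hf : AEMeasurable f μ) (hg : AEMeasurable g μ) :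
    (∫⁻ x, f x * g x ∂μ) ^ 2 ≤ (∫⁻ x, f x ^ 2 ∂μ) * ∫⁻ x, g x ^ 2 ∂μ := by
  have h := ENNReal.lintegral_mul_le_Lp_mul_Lq μ Real.HolderConjugate.two_two hf hg
  calc (∫⁻ x, f x * g x ∂μ) ^ 2
      ≤ ((∫⁻ x, f x ^ (2 : ℝ) ∂μ) ^ (1 / 2 : ℝ) * (∫⁻ x, g x ^ (2 : ℝ) ∂μ) ^ (1 / 2 : ℝ)) ^ 2 := by
        gcongr; exact h
    _ = _ := by
        rw [mul_pow, ← ENNReal.rpow_natCast, ← ENNReal.rpow_mul, ← ENNReal.rpow_natCast,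
          ← ENNReal.rpow_mul]
        simp

theorem sq_tsum_mul_le {ι : Type*} [Countable ι] (f g : ι → ℝ≥0∞) :
    (∑' i, f i * g i) ^ 2 ≤ (∑' i, f i ^ 2) * ∑' i, g i ^ 2 := by
  let _ : MeasurableSpace ι := ⊤
  have h := sq_lintegral_mul_le (Measure.count : Measure ι) (f := f) (g := g)
    (measurable_of_countable f).aemeasurable (measurable_of_countable g).aemeasurable
  simpa only [lintegral_count] using h

theorem lintegral_withDensity_fun {w g : ℝ → ℝ≥0∞} (hw : Measurable w) (hg : Measurable g) :
    ∫⁻ x, g x ∂(volume.withDensity fun x => w x) = ∫⁻ x, w x * g x :=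
  lintegral_withDensity_eq_lintegral_mul _ hw hg

theorem setLIntegral_withDensity_fun {w g : ℝ → ℝ≥0∞} (hw : Measurable w) (hg : Measurable g)
    {s : Set ℝ} (hs : MeasurableSet s) :
    ∫⁻ x in s, g x ∂(volume.withDensity fun x => w x) = ∫⁻ x in s, w x * g x :=
  setLIntegral_withDensity_eq_setLIntegral_mul _ hw hg hs

/-- Weights on the line that are finite and positive and satisfy the Muckenhoupt `A₂` condition
with constant `Q`. -/
structure IsA2 (Q : ℝ≥0∞) (w : ℝ → ℝ≥0∞) : Prop where
  measurable : Measurable w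
  ne_zero : ∀ x, w x ≠ 0
  ne_top : ∀ x, w x ≠ ∞
  lintegral_ne_top : ∀ a b : ℝ, ∫⁻ t in Set.Ico a b, w t ≠ ∞
  lintegral_inv_ne_top : ∀ a b : ℝ, ∫⁻ t in Set.Ico a b, (w t)⁻¹ ≠ ∞
  mul_le : ∀ a b : ℝ, (∫⁻ t in Set.Ico a b, w t) * (∫⁻ t in Set.Ico a b, (w t)⁻¹) ≤
    Q * ENNReal.ofReal (b - a) ^ 2

theorem setLIntegral_Ico_ne_zero {w : ℝ → ℝ≥0∞} (hw : Measurable w) (h0 : ∀ x, w x ≠ 0)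
    {a b : ℝ} (hab : a < b) : ∫⁻ t in Set.Ico a b, w t ≠ 0 := by
  rw [← pos_iff_ne_zero, setLIntegral_pos_iff hw]
  have : Function.support w ∩ Set.Ico a b = Set.Ico a b :=
    Set.inter_eq_right.2 fun x _ => h0 x
  rw [this, Real.volume_Ico]
  simpa using hab

/-- Cauchy–Schwarz for `1 = w^{1/2} w^{-1/2}`: the reverse of the `A₂` inequality, with constant
one. -/
theorem sq_ofReal_le_mul {w : ℝ → ℝ≥0∞} (hw : Measurable w) (h0 : ∀ x, w x ≠ 0)
    (ht : ∀ x, w x ≠ ∞) (a b : ℝ) :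
    ENNReal.ofReal (b - a) ^ 2 ≤ (∫⁻ t in Set.Ico a b, w t) * ∫⁻ t in Set.Ico a b, (w t)⁻¹ := by
  have h := sq_lintegral_mul_le (volume.restrict (Set.Ico a b)) (f := fun t => w t ^ (1 / 2 : ℝ))
    (g := fun t => (w t)⁻¹ ^ (1 / 2 : ℝ)) (hw.pow_const _).aemeasurable
    (hw.inv.pow_const _).aemeasurable
  have h1 : ∀ t, w t ^ (1 / 2 : ℝ) * (w t)⁻¹ ^ (1 / 2 : ℝ) = 1 := fun t => by
    rw [← ENNReal.mul_rpow_of_nonneg _ _ (by norm_num), ENNReal.mul_inv_cancel (h0 t) (ht t),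
      ENNReal.one_rpow]
  have h2 : ∀ y : ℝ≥0∞, (y ^ (1 / 2 : ℝ)) ^ 2 = y := fun y => by
    rw [← ENNReal.rpow_natCast, ← ENNReal.rpow_mul]; simp
  simpa only [h1, h2, setLIntegral_one, Real.volume_Ico] using h

namespace IsA2

variable {Q : ℝ≥0∞} {w : ℝ → ℝ≥0∞}

/-- This is the doubling property. Cauchy–Schwarz on the inner interval bounds its squared length by
the masses of `w` and `w⁻¹`; the mass of `w⁻¹` is enlarged to the outer interval, where the `A₂`
condition pairs it with the mass of `w`. -/
theorem sq_mul_lintegral_le (hw : IsA2 Q w) {a b a' b' : ℝ} (ha : a ≤ a') (hb : b' ≤ b) :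
    ENNReal.ofReal (b' - a') ^ 2 * (∫⁻ t in Set.Ico a b, w t) ≤
      Q * ENNReal.ofReal (b - a) ^ 2 * ∫⁻ t in Set.Ico a' b', w t := by
  calc ENNReal.ofReal (b' - a') ^ 2 * (∫⁻ t in Set.Ico a b, w t)
      ≤ ((∫⁻ t in Set.Ico a' b', w t) * ∫⁻ t in Set.Ico a b, (w t)⁻¹) *
          (∫⁻ t in Set.Ico a b, w t) := by
        gcongr
        refine (sq_ofReal_le_mul hw.measurable hw.ne_zero hw.ne_top a' b').trans ?_
        gcongr
    _ = ((∫⁻ t in Set.Ico a b, w t) * ∫⁻ t in Set.Ico a b, (w t)⁻¹) *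
          ∫⁻ t in Set.Ico a' b', w t := by ring
    _ ≤ _ := mul_le_mul_left (hw.mul_le a b) _

theorem lintegral_le_sq_mul (hw : IsA2 Q w) {a b a' b' r : ℝ} (hr : 0 ≤ r) (ha : a ≤ a')
    (hb : b' ≤ b) (hab : a' < b') (h : b - a ≤ r * (b' - a')) :
    (∫⁻ t in Set.Ico a b, w t) ≤ Q * ENNReal.ofReal r ^ 2 * ∫⁻ t in Set.Ico a' b', w t := by
  have h0 : ENNReal.ofReal (b' - a') ^ 2 ≠ 0 := by
    simpa using hab
  have ht : ENNReal.ofReal (b' - a') ^ 2 ≠ ∞ := by finiteness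
  rw [← ENNReal.mul_le_mul_iff_right h0 ht]
  refine (hw.sq_mul_lintegral_le ha hb).trans ?_
  calc Q * ENNReal.ofReal (b - a) ^ 2 * ∫⁻ t in Set.Ico a' b', w t
      ≤ Q * (ENNReal.ofReal (r * (b' - a'))) ^ 2 * ∫⁻ t in Set.Ico a' b', w t := by
        gcongr
    _ = _ := by rw [ENNReal.ofReal_mul hr]; ring

/-- With `σ = w⁻¹`, the average of `f` over `J` equals `w(J) σ(J) / |J|²` times `|J| / w(J)` times
`σ(J)⁻¹ ∫_J f`. The first factor is at most `Q`. The last is an average of `f w` with respect to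
`σ`, hence at most `g` at every point of `J`; with the factor `|J| / w(J)` it is at most the
`w`-average of `g w⁻¹` over `J`. Only maximal functions that are bounded for every measure remain.
-/
theorem maxFn_le_mul_maxFn_maxFn (hw : IsA2 Q w) {f : ℝ → ℝ≥0∞} (hf : Measurable f) (x : ℝ) :
    maxFn volume f x ≤ Q * maxFn (volume.withDensity w)
      (fun y => maxFn (volume.withDensity fun t => (w t)⁻¹) (fun t => f t * w t) y * (w y)⁻¹) x := by
  refine maxFn_le fun a b hx => ?_
  have hab : (a : ℝ) < b := hx.1.trans_lt hx.2
  set J := Set.Ico (a : ℝ) b with hJ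
  set g := maxFn (volume.withDensity fun t => (w t)⁻¹) (fun t => f t * w t) with hg
  have hgm : Measurable g := measurable_maxFn _ _
  have hs0 : (∫⁻ t in J, (w t)⁻¹) ≠ 0 := setLIntegral_Ico_ne_zero hw.measurable.inv
    (fun x => ENNReal.inv_ne_zero.2 (hw.ne_top x)) hab
  have hst := hw.lintegral_inv_ne_top a b
  have hw0 : (∫⁻ t in J, w t) ≠ 0 := setLIntegral_Ico_ne_zero hw.measurable hw.ne_zero hab
  have hwt := hw.lintegral_ne_top a b
  have h1 : ∀ y ∈ J, (∫⁻ t in J, f t) / (∫⁻ t in J, (w t)⁻¹) ≤ g y := by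
    intro y hy
    refine le_trans (le_of_eq ?_) (average_le_maxFn _ _ hy)
    have hm : Measurable fun t => f t * w t := hf.mul hw.measurable
    have hm' : Measurable fun t => (w t)⁻¹ := hw.measurable.inv
    rw [withDensity_apply _ measurableSet_Ico,
      setLIntegral_withDensity_fun hm' hm measurableSet_Ico]
    congr 2
    ext t
    rw [mul_comm, mul_assoc, ENNReal.mul_inv_cancel (hw.ne_zero t) (hw.ne_top t), mul_one]
  have h2 : (∫⁻ t in J, f t) / (∫⁻ t in J, (w t)⁻¹) * ENNReal.ofReal (b - a) ≤ ∫⁻ t in J, g t := by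
    calc (∫⁻ t in J, f t) / (∫⁻ t in J, (w t)⁻¹) * ENNReal.ofReal (b - a)
        = ∫⁻ _ in J, (∫⁻ t in J, f t) / (∫⁻ t in J, (w t)⁻¹) := by
          rw [setLIntegral_const, hJ, Real.volume_Ico]
      _ ≤ _ := setLIntegral_mono hgm h1
  have h3 : (∫⁻ t in J, g t) / (∫⁻ t in J, w t) ≤
      maxFn (volume.withDensity w) (fun y => g y * (w y)⁻¹) x := by
    refine le_trans (le_of_eq ?_) (average_le_maxFn _ _ hx)
    have hm : Measurable fun t => g t * (w t)⁻¹ := hgm.mul hw.measurable.inv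
    rw [withDensity_apply _ measurableSet_Ico,
      setLIntegral_withDensity_fun hw.measurable hm measurableSet_Ico]
    congr 2
    ext t
    rw [mul_left_comm, ENNReal.mul_inv_cancel (hw.ne_zero t) (hw.ne_top t), mul_one]
  refine le_trans ?_ (mul_le_mul_right h3 Q)
  refine le_trans ?_ (mul_le_mul_right (ENNReal.div_le_div_right h2 _) Q)
  rw [hJ, Real.volume_Ico, ← hJ]
  set F := ∫⁻ t in J, f t
  set S := ∫⁻ t in J, (w t)⁻¹
  set W := ∫⁻ t in J, w t
  have hL0 : ENNReal.ofReal ((b : ℝ) - a) ≠ 0 := by simpa using hab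
  have hLt : ENNReal.ofReal ((b : ℝ) - a) ≠ ∞ := by simp
  set l := ENNReal.ofReal ((b : ℝ) - a)
  have hA : W * S ≤ Q * l ^ 2 := hw.mul_le a b
  refine ENNReal.div_le_of_le_mul ?_
  calc F = F * (W * S) * W⁻¹ * S⁻¹ := by
        rw [mul_assoc, mul_assoc, show W * S * (W⁻¹ * S⁻¹) = (W * W⁻¹) * (S * S⁻¹) by ring,
          ENNReal.mul_inv_cancel hw0 hwt, ENNReal.mul_inv_cancel hs0 hst, mul_one, mul_one]
    _ ≤ F * (Q * l ^ 2) * W⁻¹ * S⁻¹ := by gcongr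
    _ = _ := by rw [div_eq_mul_inv, div_eq_mul_inv]; ring

end IsA2

/-- The maximal function is bounded on `L²(w)` for `A₂` weights `w`. -/
theorem exists_lintegral_maxFn_sq_mul_le {Q : ℝ≥0∞} (hQ : Q ≠ ∞) :
    ∃ C : ℝ≥0∞, C ≠ ∞ ∧ ∀ w : ℝ → ℝ≥0∞, IsA2 Q w → ∀ f : ℝ → ℝ≥0∞, Measurable f →
      ∫⁻ x, maxFn volume f x ^ 2 * w x ≤ C * ∫⁻ x, f x ^ 2 * w x := by
  obtain ⟨C, hC, hM⟩ := exists_lintegral_maxFn_rpow_le (p := 2) (by norm_num)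
  simp only [ENNReal.rpow_two] at hM
  refine ⟨Q ^ 2 * (C * C), by finiteness, fun w hw f hf => ?_⟩
  set g := maxFn (volume.withDensity fun t => (w t)⁻¹) (fun t => f t * w t) with hg
  have hgm : Measurable g := measurable_maxFn _ _
  have hmul : ∀ y : ℝ≥0∞, ∀ x, w x * (y * (w x)⁻¹) ^ 2 = (w x)⁻¹ * y ^ 2 := by
    intro y x
    rw [show w x * (y * (w x)⁻¹) ^ 2 = (w x * (w x)⁻¹) * ((w x)⁻¹ * y ^ 2) by ring,
      ENNReal.mul_inv_cancel (hw.ne_zero x) (hw.ne_top x), one_mul]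
  have hm : Measurable fun t => g t * (w t)⁻¹ := hgm.mul hw.measurable.inv
  have hm2 : Measurable fun t => (g t * (w t)⁻¹) ^ 2 := hm.pow_const 2
  have hi : Measurable fun t => (w t)⁻¹ := hw.measurable.inv
  have hfw : Measurable fun t => f t * w t := hf.mul hw.measurable
  have hfw2 : Measurable fun t => (f t * w t) ^ 2 := hfw.pow_const 2
  have hMg : Measurable fun x => maxFn (volume.withDensity w) (fun y => g y * (w y)⁻¹) x ^ 2 :=
    (measurable_maxFn _ _).pow_const 2
  have hwMg : Measurable fun x =>
      w x * maxFn (volume.withDensity w) (fun y => g y * (w y)⁻¹) x ^ 2 := hw.measurable.mul hMg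
  calc ∫⁻ x, maxFn volume f x ^ 2 * w x
      ≤ ∫⁻ x, Q ^ 2 * (w x * maxFn (volume.withDensity w) (fun y => g y * (w y)⁻¹) x ^ 2) := by
        refine lintegral_mono fun x => ?_
        calc maxFn volume f x ^ 2 * w x
            ≤ (Q * maxFn (volume.withDensity w) (fun y => g y * (w y)⁻¹) x) ^ 2 * w x := by
              gcongr; exact hw.maxFn_le_mul_maxFn_maxFn hf x
          _ = _ := by ring
    _ = Q ^ 2 * ∫⁻ x, maxFn (volume.withDensity w) (fun y => g y * (w y)⁻¹) x ^ 2
          ∂(volume.withDensity w) := by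
        rw [lintegral_const_mul _ hwMg, lintegral_withDensity_fun hw.measurable hMg]
    _ ≤ Q ^ 2 * (C * ∫⁻ x, (g x * (w x)⁻¹) ^ 2 ∂(volume.withDensity w)) := by
        gcongr; exact hM _ _ (hgm.mul hw.measurable.inv)
    _ = Q ^ 2 * (C * ∫⁻ x, g x ^ 2 ∂(volume.withDensity fun t => (w t)⁻¹)) := by
        rw [lintegral_withDensity_fun hw.measurable hm2,
          lintegral_withDensity_fun hi (hgm.pow_const 2)]
        simp only [hmul]
    _ ≤ Q ^ 2 * (C * (C * ∫⁻ x, (f x * w x) ^ 2 ∂(volume.withDensity fun t => (w t)⁻¹))) := by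
        gcongr; exact hM _ _ (hf.mul hw.measurable)
    _ = _ := by
        rw [lintegral_withDensity_fun hi hfw2, ← mul_assoc, ← mul_assoc, mul_assoc (Q ^ 2)]
        congr 1
        refine lintegral_congr fun x => ?_
        rw [show (w x)⁻¹ * (f x * w x) ^ 2 = (w x * (w x)⁻¹) * (f x ^ 2 * w x) by ring,
          ENNReal.mul_inv_cancel (hw.ne_zero x) (hw.ne_top x), one_mul]

/-! ### Masses of dyadic intervals with respect to a weight -/

/-- The mass `w(I)` of a dyadic interval. -/
noncomputable def mass (w : ℝ → ℝ≥0∞) (I : DyadicInterval) : ℝ≥0∞ := ∫⁻ t in I.toSet, w t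

theorem DyadicInterval.measurableSet_toSet (I : DyadicInterval) : MeasurableSet I.toSet :=
  measurableSet_Ico

theorem zpow_two_pos (s : ℤ) : (0 : ℝ) < 2 ^ s := by positivity

theorem zpow_two_add_nat (s : ℤ) (m : ℕ) : (2 : ℝ) ^ (s + m) = 2 ^ m * 2 ^ s := by
  rw [zpow_add₀ (by norm_num), zpow_natCast, mul_comm]

theorem ediv_two_pow_mul_le (i : ℤ) (m : ℕ) : ((i / 2 ^ m : ℤ) : ℝ) * 2 ^ m ≤ i := by
  have := Int.ediv_mul_le i (b := 2 ^ m) (by positivity)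
  exact_mod_cast this

theorem add_one_le_ediv_two_pow_mul (i : ℤ) (m : ℕ) :
    (i : ℝ) + 1 ≤ ((i / 2 ^ m : ℤ) + 1 : ℝ) * 2 ^ m := by
  have h := Int.lt_ediv_add_one_mul_self i (b := 2 ^ m) (by positivity)
  have : i + 1 ≤ (i / 2 ^ m + 1) * 2 ^ m := h
  exact_mod_cast this

theorem toSet_subset_toSet_ancestor (s i : ℤ) (m : ℕ) :
    DyadicInterval.toSet ⟨s, i⟩ ⊆ DyadicInterval.toSet ⟨s + m, i / 2 ^ m⟩ := by
  have h0 := zpow_two_pos s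
  refine Set.Ico_subset_Ico ?_ ?_
  · simp only [zpow_two_add_nat, ← mul_assoc]
    exact mul_le_mul_of_nonneg_right (ediv_two_pow_mul_le i m) h0.le
  · simp only [zpow_two_add_nat, ← mul_assoc]
    exact mul_le_mul_of_nonneg_right (add_one_le_ediv_two_pow_mul i m) h0.le

theorem toSet_eq_union_children (s j : ℤ) :
    DyadicInterval.toSet ⟨s + 1, j⟩ =
      DyadicInterval.toSet ⟨s, 2 * j⟩ ∪ DyadicInterval.toSet ⟨s, 2 * j + 1⟩ := by
  have h0 := zpow_two_pos s
  simp only [DyadicInterval.toSet]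
  rw [zpow_add_one₀ (by norm_num)]
  push_cast
  rw [Set.Ico_union_Ico_eq_Ico (by nlinarith) (by nlinarith)]
  congr 1 <;> ring

theorem disjoint_children (s j : ℤ) :
    Disjoint (DyadicInterval.toSet ⟨s, 2 * j⟩) (DyadicInterval.toSet ⟨s, 2 * j + 1⟩) := by
  simp only [DyadicInterval.toSet, Set.disjoint_left, Set.mem_Ico, not_and, not_lt]
  push_cast
  intro x hx h; linarith [hx.2]

theorem mass_eq_add_children (w : ℝ → ℝ≥0∞) (s j : ℤ) :
    mass w ⟨s + 1, j⟩ = mass w ⟨s, 2 * j⟩ + mass w ⟨s, 2 * j + 1⟩ := by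
  simp only [mass]
  rw [toSet_eq_union_children, lintegral_union (DyadicInterval.measurableSet_toSet _)
    (disjoint_children s j)]

namespace IsA2

variable {Q : ℝ≥0∞} {w : ℝ → ℝ≥0∞}

theorem mass_ne_top (hw : IsA2 Q w) (I : DyadicInterval) : mass w I ≠ ∞ := hw.lintegral_ne_top _ _

theorem mass_translate_le (hw : IsA2 Q w) (s i i' : ℤ) :
    mass w ⟨s, i⟩ ≤ Q * (1 + (i - i').natAbs) ^ 2 * mass w ⟨s, i'⟩ := by
  have h0 := zpow_two_pos s
  have h : mass w ⟨s, i⟩ ≤ ∫⁻ t in Set.Ico ((min i i' : ℤ) * (2 : ℝ) ^ s)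
      (((max i i' : ℤ) + 1) * (2 : ℝ) ^ s), w t := by
    refine lintegral_mono_set (Set.Ico_subset_Ico ?_ ?_) <;> simp only [] <;> gcongr
    · exact min_le_left _ _
    · exact le_max_left _ _
  refine h.trans ?_
  have h2 := hw.lintegral_le_sq_mul (r := 1 + (i - i').natAbs)
    (a := (min i i' : ℤ) * (2 : ℝ) ^ s) (b := ((max i i' : ℤ) + 1) * (2 : ℝ) ^ s)
    (a' := i' * 2 ^ s) (b' := (i' + 1) * 2 ^ s) (by positivity)
    (by gcongr; exact min_le_right _ _) (by gcongr; exact le_max_right _ _) (by nlinarith) (by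
      have : ((max i i' : ℤ) : ℝ) - (min i i' : ℤ) = (i - i').natAbs := by
        rw [Nat.cast_natAbs]
        have : max i i' - min i i' = |i - i'| := max_sub_min_eq_abs' i i'
        exact_mod_cast this
      rw [← sub_mul, ← sub_mul]
      refine le_of_eq ?_
      rw [← this]; ring)
  refine h2.trans (le_of_eq ?_)
  rw [ENNReal.ofReal_add (by norm_num) (by positivity), ENNReal.ofReal_natCast,
    ENNReal.ofReal_one]
  rfl

theorem mass_ancestor_le (hw : IsA2 Q w) (s i : ℤ) (m : ℕ) :
    mass w ⟨s + m, i / 2 ^ m⟩ ≤ Q * 4 ^ m * mass w ⟨s, i⟩ := by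
  have h0 := zpow_two_pos s
  have hm : (0 : ℝ) < 2 ^ m := by positivity
  have h2 := hw.lintegral_le_sq_mul (r := 2 ^ m)
    (a := ((i / 2 ^ m : ℤ) : ℝ) * (2 : ℝ) ^ (s + m))
    (b := (((i / 2 ^ m : ℤ) : ℝ) + 1) * (2 : ℝ) ^ (s + m))
    (a' := i * 2 ^ s) (b' := (i + 1) * 2 ^ s) (by positivity)
    (by
      rw [zpow_two_add_nat, ← mul_assoc]
      exact mul_le_mul_of_nonneg_right (ediv_two_pow_mul_le i m) h0.le)
    (by
      rw [zpow_two_add_nat, ← mul_assoc]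
      exact mul_le_mul_of_nonneg_right (add_one_le_ediv_two_pow_mul i m) h0.le)
    (by nlinarith) (by rw [zpow_two_add_nat]; refine le_of_eq ?_; ring)
  refine h2.trans (le_of_eq ?_)
  have : ENNReal.ofReal (2 ^ m) ^ 2 = 4 ^ m := by
    rw [ENNReal.ofReal_pow (by norm_num), ← pow_mul, mul_comm, pow_mul]
    norm_num
  rw [this]; rfl

/-- The factor by which the mass decreases from a dyadic interval to either of its halves. -/
theorem mass_child_le (hw : IsA2 Q w) (s i : ℤ) :
    mass w ⟨s, i⟩ ≤ (1 - (4 * Q)⁻¹) * mass w ⟨s + 1, i / 2⟩ := by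
  have hmt := hw.mass_ne_top
  have key : ∀ i' : ℤ, i' / 2 = i / 2 → mass w ⟨s + 1, i / 2⟩ = mass w ⟨s, i⟩ + mass w ⟨s, i'⟩ →
      mass w ⟨s, i⟩ ≤ (1 - (4 * Q)⁻¹) * mass w ⟨s + 1, i / 2⟩ := by
    intro i' hi' hsum
    -- Here `i'` is the sibling of `i`. By doubling it carries at least the fraction `(4Q)⁻¹` of the
    -- mass of the parent, and only the rest is left for `i`.
    have h1 : (4 * Q)⁻¹ * mass w ⟨s + 1, i / 2⟩ ≤ mass w ⟨s, i'⟩ := by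
      have h2 := hw.mass_ancestor_le s i' 1
      simp only [pow_one, Nat.cast_one] at h2
      rw [hi', mul_comm Q] at h2
      rw [mul_comm, ← div_eq_mul_inv]
      exact ENNReal.div_le_of_le_mul (by rw [mul_comm]; exact h2)
    rw [ENNReal.sub_mul (fun _ _ => hmt _), one_mul]
    refine ENNReal.le_sub_of_add_le_left (ne_top_of_le_ne_top (hmt _) h1) ?_
    rw [hsum, add_comm]
    rw [hsum] at h1
    gcongr
  rcases Int.even_or_odd' i with ⟨c, hc | hc⟩
  · refine key (2 * c + 1) (by omega) ?_
    have : i / 2 = c := by omega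
    rw [this, mass_eq_add_children, hc]
  · refine key (2 * c) (by omega) ?_
    have : i / 2 = c := by omega
    rw [this, mass_eq_add_children, hc, add_comm]

theorem mass_descendant_le (hw : IsA2 Q w) (s i : ℤ) (m : ℕ) :
    mass w ⟨s, i⟩ ≤ (1 - (4 * Q)⁻¹) ^ m * mass w ⟨s + m, i / 2 ^ m⟩ := by
  induction m with
  | zero => simp
  | succ m ih =>
    refine ih.trans ?_
    rw [pow_succ, mul_assoc]
    gcongr
    refine (hw.mass_child_le _ _).trans (le_of_eq ?_)
    rw [Int.ediv_ediv_of_nonneg (by positivity), ← pow_succ]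
    push_cast
    rw [add_assoc]

end IsA2

/-! ### An almost diagonal operator -/

/-- The lattice weight `(1 + |n|)^{-a}`. -/
noncomputable def decay (a : ℕ) (n : ℤ) : ℝ≥0∞ := ((1 + (n.natAbs : ℝ≥0∞)) ^ a)⁻¹

theorem decay_anti {a b : ℕ} (h : a ≤ b) (n : ℤ) : decay b n ≤ decay a n := by
  unfold decay
  gcongr
  exact le_self_add

theorem decay_add_mul (a b : ℕ) (n : ℤ) :
    decay (a + b) n * (1 + (n.natAbs : ℝ≥0∞)) ^ b = decay a n := by
  unfold decay
  have h0 : (1 + (n.natAbs : ℝ≥0∞)) ^ b ≠ 0 := by positivity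
  have ht : (1 + (n.natAbs : ℝ≥0∞)) ^ b ≠ ∞ := by finiteness
  rw [pow_add, ENNReal.mul_inv (Or.inr ht) (Or.inr h0), mul_assoc, ENNReal.inv_mul_cancel h0 ht,
    mul_one]

theorem tsum_int_sub_right (g : ℤ → ℝ≥0∞) (e : ℤ) : ∑' i, g (i - e) = ∑' n, g n :=
  (Equiv.subRight e).tsum_eq g

theorem tsum_int_sub_left (g : ℤ → ℝ≥0∞) (e : ℤ) : ∑' i, g (e - i) = ∑' n, g n :=
  (Equiv.subLeft e).tsum_eq g

theorem tsum_decay_two_ne_top : ∑' n : ℤ, decay 2 n ≠ ∞ := by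
  have hs : Summable fun n : ℕ => ((1 + (n : ℝ)) ^ 2)⁻¹ := by
    have := (summable_nat_add_iff 1).2 (Real.summable_nat_pow_inv.2 (by norm_num : 1 < 2))
    refine this.congr fun n => ?_
    push_cast; rw [add_comm]
  have hnat : ∑' n : ℕ, decay 2 (n : ℤ) ≠ ∞ := by
    have : ∀ n : ℕ, decay 2 (n : ℤ) = ENNReal.ofReal ((1 + (n : ℝ)) ^ 2)⁻¹ := by
      intro n
      rw [decay, ENNReal.ofReal_inv_of_pos (by positivity), ENNReal.ofReal_pow (by positivity),
        ENNReal.ofReal_add (by norm_num) (by positivity)]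
      simp
    simp_rw [this]
    exact hs.tsum_ofReal_ne_top
  have h : ∑' n : ℤ, decay 2 n = ∑' n : ℕ, decay 2 (n : ℤ) + ∑' n : ℕ, decay 2 (-((n : ℤ) + 1)) :=
    tsum_of_nat_of_neg_add_one ENNReal.summable ENNReal.summable
  rw [h]
  refine ENNReal.add_ne_top.2 ⟨hnat, ne_top_of_le_ne_top hnat (ENNReal.tsum_le_tsum fun n => ?_)⟩
  unfold decay
  gcongr
  simp only [Int.natAbs_neg]
  omega

/-- The action on nonnegative arrays over the dyadic intervals of the kernel that dominates the
Haar coefficients of bump functions. -/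
noncomputable def almostDiag (u : DyadicInterval → ℝ≥0∞) (I : DyadicInterval) : ℝ≥0∞ :=
  (∑' m : ℕ, ∑' j : ℤ, (4 ^ m)⁻¹ * decay 4 (I.pos - j / 2 ^ m) * u ⟨I.scale - m, j⟩) +
    ∑ q ∈ Finset.range 3, ∑' m : ℕ, ∑' j : ℤ,
      decay 4 (I.pos - (2 * j + q) * 2 ^ m) * u ⟨I.scale + m + 1, j⟩

/-- A translation by `n` steps increases the mass at most by the factor `Q (1 + |n|)²`. Of the four
powers of decay two absorb this growth and two make the sum converge. -/
theorem tsum_decay_mul_mass_le {Q : ℝ≥0∞} {w : ℝ → ℝ≥0∞} (hw : IsA2 Q w) (s e : ℤ) :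
    ∑' i : ℤ, decay 4 (i - e) * mass w ⟨s, i⟩ ≤ Q * (∑' n, decay 2 n) * mass w ⟨s, e⟩ := by
  calc ∑' i : ℤ, decay 4 (i - e) * mass w ⟨s, i⟩
      ≤ ∑' i : ℤ, decay 2 (i - e) * (Q * mass w ⟨s, e⟩) := by
        refine ENNReal.tsum_le_tsum fun i => ?_
        rw [← decay_add_mul 2 2]
        calc decay 4 (i - e) * mass w ⟨s, i⟩
            ≤ decay 4 (i - e) * (Q * (1 + (i - e).natAbs) ^ 2 * mass w ⟨s, e⟩) := by
              gcongr; exact hw.mass_translate_le s i e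
          _ = _ := by ring
    _ = _ := by
        rw [ENNReal.tsum_mul_right, tsum_int_sub_right (decay 2)]; ring

/-- The Schur test for a single row and column structure. -/
theorem tsum_mul_sq_tsum_le {ι κ : Type*} [Countable ι] [Countable κ] (k : ι → κ → ℝ≥0∞)
    (W : ι → ℝ≥0∞) (W' : κ → ℝ≥0∞) (u : κ → ℝ≥0∞) (A B : ℝ≥0∞)
    (hk : ∀ i, ∑' j, k i j ≤ A) (hW : ∀ j, ∑' i, k i j * W i ≤ B * W' j) :
    ∑' i, W i * (∑' j, k i j * u j) ^ 2 ≤ A * B * ∑' j, W' j * u j ^ 2 := by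
  have hsq : ∀ y : ℝ≥0∞, (y ^ (1 / 2 : ℝ)) ^ 2 = y := fun y => by
    rw [← ENNReal.rpow_natCast, ← ENNReal.rpow_mul]; simp
  have h1 : ∀ i, (∑' j, k i j * u j) ^ 2 ≤ A * ∑' j, k i j * u j ^ 2 := by
    intro i
    have h := sq_tsum_mul_le (fun j => k i j ^ (1 / 2 : ℝ)) (fun j => k i j ^ (1 / 2 : ℝ) * u j)
    simp only [mul_pow, hsq, ← mul_assoc, ← pow_two] at h
    exact h.trans (by gcongr; exact hk i)
  calc ∑' i, W i * (∑' j, k i j * u j) ^ 2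
      ≤ ∑' i, W i * (A * ∑' j, k i j * u j ^ 2) := by
        refine ENNReal.tsum_le_tsum fun i => ?_
        gcongr; exact h1 i
    _ = A * ∑' j, (∑' i, k i j * W i) * u j ^ 2 := by
        simp_rw [← ENNReal.tsum_mul_right, ← ENNReal.tsum_mul_left]
        rw [ENNReal.tsum_comm]
        refine tsum_congr fun j => tsum_congr fun i => ?_
        ring
    _ ≤ A * ∑' j, (B * W' j) * u j ^ 2 := by
        gcongr with j; exact hW j
    _ = _ := by
        simp_rw [mul_assoc, ENNReal.tsum_mul_left]

theorem tsum_ediv_two_pow (g : ℤ → ℝ≥0∞) (m : ℕ) :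
    ∑' j : ℤ, g (j / 2 ^ m) = 2 ^ m * ∑' n, g n := by
  have : NeZero (2 ^ m) := ⟨by positivity⟩
  rw [← (Int.divModEquiv (2 ^ m)).symm.tsum_eq, ENNReal.tsum_prod']
  have h : ∀ (a : ℤ) (b : Fin (2 ^ m)), (Int.divModEquiv (2 ^ m)).symm (a, b) / 2 ^ m = a := by
    intro a b
    have := congrArg Prod.fst ((Int.divModEquiv (2 ^ m)).apply_symm_apply (a, b))
    simpa [Int.divModEquiv] using this
  simp_rw [h, ← ENNReal.tsum_mul_left]
  refine tsum_congr fun a => ?_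
  simp

/-- Schur test at a fixed scale difference `m`. Each coarse interval has `2 ^ m` descendants, so the
row sums are of size `4⁻ᵐ 2ᵐ`. In the columns the loss `4 ^ m` from doubling just cancels the factor
`4⁻ᵐ`. The net gain is `2⁻ᵐ`. -/
theorem tsum_mass_mul_sq_fine_le {Q : ℝ≥0∞} {w : ℝ → ℝ≥0∞} (hw : IsA2 Q w) (s : ℤ) (m : ℕ)
    (u : ℤ → ℝ≥0∞) :
    ∑' i : ℤ, mass w ⟨s, i⟩ * (∑' j : ℤ, (4 ^ m)⁻¹ * decay 4 (i - j / 2 ^ m) * u j) ^ 2 ≤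
      (∑' n, decay 2 n) ^ 2 * Q ^ 2 * 2⁻¹ ^ m * ∑' j : ℤ, mass w ⟨s - m, j⟩ * u j ^ 2 := by
  set L := ∑' n, decay 2 n with hL
  have h := tsum_mul_sq_tsum_le (fun i j : ℤ => (4 ^ m)⁻¹ * decay 4 (i - j / 2 ^ m))
    (fun i => mass w ⟨s, i⟩) (fun j => mass w ⟨s - m, j⟩) u ((4 ^ m)⁻¹ * (2 ^ m * L)) (L * Q ^ 2)
    (fun i => ?_) (fun j => ?_)
  · refine h.trans (le_of_eq ?_)
    have : ((4 ^ m)⁻¹ * 2 ^ m : ℝ≥0∞) = 2⁻¹ ^ m := by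
      rw [ENNReal.inv_pow, ← mul_pow]
      congr 1
      rw [show (4 : ℝ≥0∞) = 2 * 2 by norm_num, ENNReal.mul_inv (by simp) (by simp), mul_assoc,
        ENNReal.inv_mul_cancel (by simp) (by simp), mul_one]
    rw [← mul_assoc (4 ^ m)⁻¹, this]; ring
  · rw [ENNReal.tsum_mul_left, tsum_ediv_two_pow (fun n => decay 4 (i - n))]
    gcongr
    rw [tsum_int_sub_left (decay 4)]
    exact ENNReal.tsum_le_tsum fun n => decay_anti (by norm_num) n
  · simp_rw [mul_assoc]
    rw [ENNReal.tsum_mul_left]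
    have h4 := hw.mass_ancestor_le (s - m) j m
    rw [sub_add_cancel] at h4
    calc (4 ^ m)⁻¹ * ∑' i : ℤ, decay 4 (i - j / 2 ^ m) * mass w ⟨s, i⟩
        ≤ (4 ^ m)⁻¹ * (Q * L * (Q * 4 ^ m * mass w ⟨s - m, j⟩)) := by
          gcongr
          refine (tsum_decay_mul_mass_le hw s _).trans ?_
          gcongr
      _ = ((4 ^ m)⁻¹ * 4 ^ m) * (L * (Q ^ 2 * mass w ⟨s - m, j⟩)) := by ring
      _ = _ := by rw [ENNReal.inv_mul_cancel (by simp) (by simp), one_mul]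

/-- Here the rows give no gain. The columns do: the mass near a point of the lattice, at scale `s`,
is at most the fraction `θ ^ m` of the mass of an ancestor `m` scales up. For `q = 2` this ancestor
is the right neighbour of the larger interval; reaching it by translation costs at most `(1 + 2)² =
9`. -/
theorem tsum_mass_mul_sq_coarse_le {Q : ℝ≥0∞} {w : ℝ → ℝ≥0∞} (hw : IsA2 Q w)
    (s : ℤ) (m : ℕ) (q : ℕ) (hq : q ≤ 2) (u : ℤ → ℝ≥0∞) :
    ∑' i : ℤ, mass w ⟨s, i⟩ * (∑' j : ℤ, decay 4 (i - (2 * j + q) * 2 ^ m) * u j) ^ 2 ≤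
      (∑' n, decay 2 n) ^ 2 * (9 * Q ^ 2) * (1 - (4 * Q)⁻¹) ^ m *
        ∑' j : ℤ, mass w ⟨s + m + 1, j⟩ * u j ^ 2 := by
  set L := ∑' n, decay 2 n with hL
  set θ := 1 - (4 * Q)⁻¹ with hθ
  have h := tsum_mul_sq_tsum_le (fun i j : ℤ => decay 4 (i - (2 * j + q) * 2 ^ m))
    (fun i => mass w ⟨s, i⟩) (fun j => mass w ⟨s + m + 1, j⟩) u L (L * (9 * Q ^ 2) * θ ^ m)
    (fun i => ?_) (fun j => ?_)
  · exact h.trans (le_of_eq (by ring))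
  · refine (ENNReal.tsum_comp_le_tsum_of_injective (f := fun j : ℤ => i - (2 * j + q) * 2 ^ m)
      (g := decay 4) ?_).trans (ENNReal.tsum_le_tsum fun n => decay_anti (by norm_num) n)
    intro j j' hjj
    have h2 : (2 : ℤ) ^ m ≠ 0 := by positivity
    have h3 : (2 * j + q) * (2 : ℤ) ^ m = (2 * j' + q) * 2 ^ m := by simp only at hjj; linarith
    have h4 := mul_right_cancel₀ h2 h3
    omega
  · have h1 : mass w ⟨s + m, 2 * j + q⟩ ≤ Q * 9 * mass w ⟨s + m + 1, j⟩ := by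
      refine (hw.mass_translate_le (s + m) (2 * j + q) (2 * j)).trans ?_
      gcongr
      · have : (2 * j + q - 2 * j).natAbs = q := by omega
        rw [this]
        calc ((1 : ℝ≥0∞) + q) ^ 2 ≤ (1 + 2) ^ 2 := by gcongr; exact_mod_cast hq
          _ = 9 := by norm_num
      · rw [mass_eq_add_children]; exact le_self_add
    have h2 := hw.mass_descendant_le s ((2 * j + q) * 2 ^ m) m
    rw [Int.mul_ediv_cancel _ (by positivity)] at h2
    calc ∑' i : ℤ, decay 4 (i - (2 * j + q) * 2 ^ m) * mass w ⟨s, i⟩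
        ≤ Q * L * (θ ^ m * (Q * 9 * mass w ⟨s + m + 1, j⟩)) := by
          refine (tsum_decay_mul_mass_le hw s _).trans ?_
          gcongr
          exact h2.trans (by gcongr)
      _ = _ := by ring

theorem tsum_dyadic (g : DyadicInterval → ℝ≥0∞) : ∑' I, g I = ∑' (s : ℤ) (i : ℤ), g ⟨s, i⟩ := by
  let e : ℤ × ℤ ≃ DyadicInterval :=
    ⟨fun p => ⟨p.1, p.2⟩, fun I => (I.scale, I.pos), fun _ => rfl, fun _ => rfl⟩
  rw [← e.tsum_eq, ENNReal.tsum_prod']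
  rfl

instance : Countable DyadicInterval := by
  have : Function.Injective fun I : DyadicInterval => (I.scale, I.pos) := by
    rintro ⟨a, b⟩ ⟨c, d⟩ h; simpa using h
  exact this.countable

/-- Cauchy–Schwarz with geometric weights replaces the triangle inequality in `ℓ²`. It spends `ρ ^
(2m)` of the decay in `m`, which is why a rate `ρ ^ (4m)` is asked for below. -/
theorem sq_tsum_nat_le {ρ : ℝ≥0∞} (h0 : ρ ≠ 0) (h1 : ρ < 1) (A : ℕ → ℝ≥0∞) :
    (∑' m, A m) ^ 2 ≤ (1 - ρ)⁻¹ * ∑' m, (ρ ^ m)⁻¹ ^ 2 * A m ^ 2 := by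
  have ht : ρ ≠ ∞ := h1.ne_top
  have h := sq_tsum_mul_le (fun m => ρ ^ m) (fun m => (ρ ^ m)⁻¹ * A m)
  have h2 : ∀ m, ρ ^ m * ((ρ ^ m)⁻¹ * A m) = A m := fun m => by
    rw [← mul_assoc, ENNReal.mul_inv_cancel (pow_ne_zero _ h0) (by finiteness), one_mul]
  simp only [h2, mul_pow] at h
  refine h.trans ?_
  gcongr
  rw [← ENNReal.tsum_geometric]
  refine ENNReal.tsum_le_tsum fun m => ?_
  rw [← pow_mul]
  exact pow_le_pow_of_le_one zero_le h1.le (by omega)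

theorem tsum_mul_sq_tsum_nat_le {ι : Type*} (W : ι → ℝ≥0∞) (A : ℕ → ι → ℝ≥0∞) {ρ C X : ℝ≥0∞}
    (h0 : ρ ≠ 0) (h1 : ρ < 1) (h : ∀ m, ∑' i, W i * A m i ^ 2 ≤ C * (ρ ^ 4) ^ m * X) :
    ∑' i, W i * (∑' m, A m i) ^ 2 ≤ (1 - ρ)⁻¹ ^ 2 * C * X := by
  have ht : ρ ≠ ∞ := h1.ne_top
  calc ∑' i, W i * (∑' m, A m i) ^ 2
      ≤ ∑' i, W i * ((1 - ρ)⁻¹ * ∑' m, (ρ ^ m)⁻¹ ^ 2 * A m i ^ 2) := by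
        refine ENNReal.tsum_le_tsum fun i => ?_
        gcongr; exact sq_tsum_nat_le h0 h1 _
    _ = (1 - ρ)⁻¹ * ∑' m, (ρ ^ m)⁻¹ ^ 2 * ∑' i, W i * A m i ^ 2 := by
        simp_rw [← ENNReal.tsum_mul_left]
        rw [ENNReal.tsum_comm]
        refine tsum_congr fun j => tsum_congr fun i => ?_
        ring
    _ ≤ (1 - ρ)⁻¹ * ∑' m, (ρ ^ m * C * X) := by
        refine mul_le_mul_right (ENNReal.tsum_le_tsum fun m => ?_) _
        calc (ρ ^ m)⁻¹ ^ 2 * ∑' i, W i * A m i ^ 2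
            ≤ (ρ ^ m)⁻¹ ^ 2 * (C * (ρ ^ 4) ^ m * X) := by gcongr; exact h m
          _ = (ρ ^ m * (ρ ^ m)⁻¹) ^ 2 * (ρ ^ m * ρ ^ m * C * X) := by ring
          _ = ρ ^ m * ρ ^ m * C * X := by
              rw [ENNReal.mul_inv_cancel (pow_ne_zero _ h0) (by finiteness), one_pow, one_mul]
          _ ≤ 1 * ρ ^ m * C * X := by gcongr; exact pow_le_one₀ zero_le h1.le
          _ = _ := by rw [one_mul]
    _ = _ := by
        rw [ENNReal.tsum_mul_right, ENNReal.tsum_mul_right, ENNReal.tsum_geometric]; ring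

/-- The operator is decomposed according to the scale difference `m`; the pieces have geometrically
decreasing norms, by `2⁻ᵐ` towards finer and by `(1 - (4Q)⁻¹)ᵐ` towards coarser intervals. -/
theorem exists_tsum_mass_mul_sq_almostDiag_le {Q : ℝ≥0∞} (hQ : Q ≠ ∞) :
    ∃ C : ℝ≥0∞, C ≠ ∞ ∧ ∀ w : ℝ → ℝ≥0∞, IsA2 Q w → ∀ u : DyadicInterval → ℝ≥0∞,
      ∑' I, mass w I * almostDiag u I ^ 2 ≤ C * ∑' J, mass w J * u J ^ 2 := by
  obtain ⟨ρ, h0, h1, hρ2, hρθ⟩ : ∃ ρ : ℝ≥0∞, ρ ≠ 0 ∧ ρ < 1 ∧ 2⁻¹ ≤ ρ ^ 4 ∧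
      1 - (4 * Q)⁻¹ ≤ ρ ^ 4 := by
    -- A common rate for both directions; it is below one because `Q` is finite.
    set τ : ℝ≥0∞ := max 2⁻¹ (1 - (4 * Q)⁻¹) with hτ
    have hτ1 : τ < 1 := by
      refine max_lt (by norm_num) (ENNReal.sub_lt_self (by simp) (by simp) ?_)
      exact ENNReal.inv_ne_zero.2 (by finiteness)
    have hp : (τ ^ (1 / 4 : ℝ)) ^ 4 = τ := by
      rw [← ENNReal.rpow_natCast, ← ENNReal.rpow_mul]; norm_num
    refine ⟨τ ^ (1 / 4 : ℝ), ?_, ENNReal.rpow_lt_one hτ1 (by norm_num), ?_, ?_⟩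
    · intro h
      rw [h] at hp
      have : (2⁻¹ : ℝ≥0∞) ≤ 0 := by
        calc (2⁻¹ : ℝ≥0∞) ≤ τ := le_max_left _ _
          _ = 0 := by rw [← hp]; simp
      simp at this
    · rw [hp]; exact le_max_left _ _
    · rw [hp]; exact le_max_right _ _
  set L := ∑' n, decay 2 n with hL
  have hLt : L ≠ ∞ := tsum_decay_two_ne_top
  set D := (1 - ρ)⁻¹ ^ 2 * (L ^ 2 * (9 * Q ^ 2)) with hD
  have hDt : D ≠ ∞ := by
    have : (1 - ρ)⁻¹ ≠ ∞ := by
      simp only [ne_eq, ENNReal.inv_eq_top, tsub_eq_zero_iff_le, not_le]; exact h1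
    finiteness
  refine ⟨16 * D, by finiteness, fun w hw u => ?_⟩
  set X := ∑' J, mass w J * u J ^ 2 with hX
  have hA : ∑' I, mass w I * (∑' m : ℕ, ∑' j : ℤ,
      (4 ^ m)⁻¹ * decay 4 (I.pos - j / 2 ^ m) * u ⟨I.scale - m, j⟩) ^ 2 ≤ D * X := by
    refine tsum_mul_sq_tsum_nat_le (mass w) _ h0 h1 fun m => ?_
    rw [tsum_dyadic]
    calc _ ≤ ∑' s : ℤ, L ^ 2 * Q ^ 2 * 2⁻¹ ^ m * ∑' j : ℤ, mass w ⟨s - m, j⟩ * u ⟨s - m, j⟩ ^ 2 :=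
          ENNReal.tsum_le_tsum fun s => tsum_mass_mul_sq_fine_le hw s m fun j => u ⟨s - m, j⟩
      _ = L ^ 2 * Q ^ 2 * 2⁻¹ ^ m * X := by
          rw [ENNReal.tsum_mul_left, tsum_int_sub_right
            (fun s => ∑' j : ℤ, mass w ⟨s, j⟩ * u ⟨s, j⟩ ^ 2), hX, tsum_dyadic]
      _ ≤ _ := by
          gcongr
          calc Q ^ 2 = 1 * Q ^ 2 := (one_mul _).symm
            _ ≤ 9 * Q ^ 2 := by gcongr; norm_num
  have hB : ∀ q ∈ Finset.range 3, ∑' I, mass w I * (∑' m : ℕ, ∑' j : ℤ,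
      decay 4 (I.pos - (2 * j + q) * 2 ^ m) * u ⟨I.scale + m + 1, j⟩) ^ 2 ≤ D * X := by
    intro q hq
    have hq2 : q ≤ 2 := by simpa [Nat.lt_succ_iff] using hq
    refine tsum_mul_sq_tsum_nat_le (mass w) _ h0 h1 fun m => ?_
    rw [tsum_dyadic]
    calc _ ≤ ∑' s : ℤ, L ^ 2 * (9 * Q ^ 2) * (1 - (4 * Q)⁻¹) ^ m *
            ∑' j : ℤ, mass w ⟨s + m + 1, j⟩ * u ⟨s + m + 1, j⟩ ^ 2 :=
          ENNReal.tsum_le_tsum fun s =>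
            tsum_mass_mul_sq_coarse_le hw s m q hq2 fun j => u ⟨s + m + 1, j⟩
      _ = L ^ 2 * (9 * Q ^ 2) * (1 - (4 * Q)⁻¹) ^ m * X := by
          have := ((Equiv.addRight (m : ℤ)).trans (Equiv.addRight (1 : ℤ))).tsum_eq
            (fun s => ∑' j : ℤ, mass w ⟨s, j⟩ * u ⟨s, j⟩ ^ 2)
          simp only [Equiv.trans_apply, Equiv.coe_addRight] at this
          rw [ENNReal.tsum_mul_left, this, hX, tsum_dyadic]
      _ ≤ _ := by gcongr
  have hsq4 : ∀ a b c d : ℝ≥0∞, (a + (b + c + d)) ^ 2 ≤ 4 * (a ^ 2 + (b ^ 2 + c ^ 2 + d ^ 2)) := by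
    intro a b c d
    have h := sq_tsum_mul_le (fun _ : Fin 4 => 1) ![a, b, c, d]
    simp only [one_mul, one_pow, tsum_fintype, Fin.sum_univ_four, Matrix.cons_val] at h
    calc (a + (b + c + d)) ^ 2 = (a + b + c + d) ^ 2 := by ring
      _ ≤ _ := h
      _ = _ := by ring
  calc ∑' I, mass w I * almostDiag u I ^ 2
      ≤ ∑' I, mass w I * (4 * ((∑' m : ℕ, ∑' j : ℤ,
          (4 ^ m)⁻¹ * decay 4 (I.pos - j / 2 ^ m) * u ⟨I.scale - m, j⟩) ^ 2 +
          ∑ q ∈ Finset.range 3, (∑' m : ℕ, ∑' j : ℤ,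
            decay 4 (I.pos - (2 * j + q) * 2 ^ m) * u ⟨I.scale + m + 1, j⟩) ^ 2)) := by
        refine ENNReal.tsum_le_tsum fun I => ?_
        gcongr
        rw [almostDiag]
        simp only [Finset.sum_range_succ, Finset.sum_range_zero, zero_add]
        exact hsq4 _ _ _ _
    _ = 4 * (∑' I, mass w I * (∑' m : ℕ, ∑' j : ℤ,
          (4 ^ m)⁻¹ * decay 4 (I.pos - j / 2 ^ m) * u ⟨I.scale - m, j⟩) ^ 2 +
          ∑ q ∈ Finset.range 3, ∑' I, mass w I * (∑' m : ℕ, ∑' j : ℤ,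
            decay 4 (I.pos - (2 * j + q) * 2 ^ m) * u ⟨I.scale + m + 1, j⟩) ^ 2) := by
        rw [← Summable.tsum_finsetSum fun _ _ => ENNReal.summable, ← ENNReal.tsum_add,
          ← ENNReal.tsum_mul_left]
        refine tsum_congr fun I => ?_
        rw [← Finset.mul_sum]; ring
    _ ≤ 4 * (D * X + ∑ q ∈ Finset.range 3, D * X) := by
        gcongr with q hq
        exact hB q hq
    _ = _ := by
        simp only [Finset.sum_const, Finset.card_range, nsmul_eq_mul]; push_cast; ring

/-! ### The weighted Haar square function estimate -/

/-- The Haar coefficient of `g` at `J`, divided by `|J|^{1/2}`. -/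
noncomputable def haarDiff {E : Type*} [NormedAddCommGroup E] [NormedSpace ℝ E] (g : ℝ → E)
    (J : DyadicInterval) : E :=
  (J.length)⁻¹ • ((∫ t in DyadicInterval.toSet ⟨J.scale - 1, 2 * J.pos⟩, g t) -
    ∫ t in DyadicInterval.toSet ⟨J.scale - 1, 2 * J.pos + 1⟩, g t)

/-- The Bellman function of the weighted Haar square function estimate. -/
noncomputable def bellman (Q F W V : ℝ) : ℝ := F ^ 2 * W + 8 * Q ^ 2 * (F ^ 2 / (2 * V - W⁻¹))

theorem sq_div_add_le {a b x y : ℝ} (hx : 0 < x) (hy : 0 < y) :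
    (a + b) ^ 2 / (x + y) ≤ a ^ 2 / x + b ^ 2 / y := by
  rw [div_add_div _ _ hx.ne' hy.ne', div_le_div_iff₀ (by positivity) (by positivity)]
  nlinarith [sq_nonneg (a * y - b * x), mul_pos hx hy]

/-- The term `F² W` alone produces `δ² W + 2 F δ ε`, and the cross term has no sign. Completing the
square, half of `δ² W` together with `2 F² ε² / W` absorbs it. The second term of the Bellman
function supplies this amount: `F² / m` is jointly convex, and the convexity of `1 / W` makes the
mean of the two values of `m = 2V - W⁻¹` smaller than `m` by at least `ε² / W³`. As `m ≤ 2V` and `V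
W ≤ Q`, the gain in `F² / m` is at least `F² ε² / (4 Q² W)`; this is where the factor `8 Q²` comes
from. -/
theorem bellman_concavity {Q F δ W ε V η : ℝ} (h1 : 0 < W + ε) (h2 : 0 < W - ε)
    (h3 : 1 ≤ (V + η) * (W + ε)) (h4 : 1 ≤ (V - η) * (W - ε)) (h5 : V * W ≤ Q) :
    δ ^ 2 * W / 2 + bellman Q F W V ≤
      (bellman Q (F + δ) (W + ε) (V + η) + bellman Q (F - δ) (W - ε) (V - η)) / 2 := by
  have hW : 0 < W := by linarith
  have e1 : (W + ε)⁻¹ ≤ V + η := by rw [inv_le_iff_one_le_mul₀ h1]; exact h3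
  have e2 : (W - ε)⁻¹ ≤ V - η := by rw [inv_le_iff_one_le_mul₀ h2]; exact h4
  have p1 : 0 < (W + ε)⁻¹ := inv_pos.2 h1
  have p2 : 0 < (W - ε)⁻¹ := inv_pos.2 h2
  have hV : 0 < V := by linarith
  have hQ : 0 < Q := lt_of_lt_of_le (mul_pos hV hW) h5
  set m₁ := 2 * (V + η) - (W + ε)⁻¹ with hm1
  set m₂ := 2 * (V - η) - (W - ε)⁻¹ with hm2
  have hm1p : 0 < m₁ := by linarith
  have hm2p : 0 < m₂ := by linarith
  set m := 2 * V - W⁻¹ with hm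
  set mb := (m₁ + m₂) / 2 with hmb
  have hmbp : 0 < mb := by positivity
  have hinv : W⁻¹ + ε ^ 2 * (W⁻¹) ^ 3 ≤ ((W + ε)⁻¹ + (W - ε)⁻¹) / 2 := by
    have h6 : 0 < W ^ 2 - ε ^ 2 := by nlinarith
    have h7 : ((W + ε)⁻¹ + (W - ε)⁻¹) / 2 = W / (W ^ 2 - ε ^ 2) := by
      field_simp; ring
    have h8 : W⁻¹ + ε ^ 2 * (W⁻¹) ^ 3 = (W ^ 2 + ε ^ 2) / W ^ 3 := by field_simp
    rw [h7, h8, div_le_div_iff₀ (by positivity) h6]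
    nlinarith [sq_nonneg (ε ^ 2)]
  have hdiff : mb ≤ m - ε ^ 2 * (W⁻¹) ^ 3 := by rw [hmb, hm1, hm2, hm]; linarith
  have hd0 : 0 ≤ ε ^ 2 * (W⁻¹) ^ 3 := by positivity
  have hmp : 0 < m := by linarith
  have hm2V : m ≤ 2 * V := by have := inv_pos.2 hW; linarith
  have key : m⁻¹ + ε ^ 2 / (4 * Q ^ 2 * W) ≤ mb⁻¹ := by
    have h6 : mb⁻¹ - m⁻¹ = (m - mb) / (m * mb) := by field_simp
    have h7 : ε ^ 2 / (4 * Q ^ 2 * W) ≤ (m - mb) / (m * mb) := by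
      calc ε ^ 2 / (4 * Q ^ 2 * W) ≤ ε ^ 2 / (4 * (V * W) ^ 2 * W) := by gcongr
        _ = (ε ^ 2 * (W⁻¹) ^ 3) / (2 * V * (2 * V)) := by field_simp; ring
        _ ≤ (m - mb) / (m * mb) := by
            gcongr
            · linarith
            · linarith
            · linarith
    linarith
  have hT : F ^ 2 / mb ≤ ((F + δ) ^ 2 / m₁ + (F - δ) ^ 2 / m₂) / 2 := by
    have := sq_div_add_le (a := F + δ) (b := F - δ) hm1p hm2p
    have h6 : (F + δ + (F - δ)) ^ 2 / (m₁ + m₂) = 2 * (F ^ 2 / mb) := by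
      rw [hmb]; field_simp; ring
    linarith
  have hF : F ^ 2 / m + F ^ 2 * (ε ^ 2 / (4 * Q ^ 2 * W)) ≤ F ^ 2 / mb := by
    rw [div_eq_mul_inv, div_eq_mul_inv (F ^ 2) mb, ← mul_add]
    gcongr
  have hmul : 8 * Q ^ 2 * (F ^ 2 * (ε ^ 2 / (4 * Q ^ 2 * W))) = 2 * (F ^ 2 * ε ^ 2 / W) := by
    field_simp; ring
  have hfin : 8 * Q ^ 2 * (F ^ 2 / m) + 2 * (F ^ 2 * ε ^ 2 / W) ≤
      8 * Q ^ 2 * (((F + δ) ^ 2 / m₁ + (F - δ) ^ 2 / m₂) / 2) := by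
    rw [← hmul, ← mul_add]
    gcongr
    linarith
  have hsq : 0 ≤ δ ^ 2 * W / 2 + 2 * F * δ * ε + 2 * (F ^ 2 * ε ^ 2 / W) := by
    have : δ ^ 2 * W / 2 + 2 * F * δ * ε + 2 * (F ^ 2 * ε ^ 2 / W) =
      (δ * W + 2 * F * ε) ^ 2 / (2 * W) := by field_simp; ring
    rw [this]; positivity
  unfold bellman
  nlinarith

theorem IsA2.sq_setLIntegral_le {Q : ℝ≥0∞} {w : ℝ → ℝ≥0∞} (hw : IsA2 Q w) {g : ℝ → ℝ≥0∞}
    (hg : Measurable g) (s : Set ℝ) :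
    (∫⁻ t in s, g t) ^ 2 ≤ (∫⁻ t in s, g t ^ 2 * w t) * ∫⁻ t in s, (w t)⁻¹ := by
  have h := sq_lintegral_mul_le (volume.restrict s) (f := fun t => g t * w t ^ (1 / 2 : ℝ))
    (g := fun t => (w t)⁻¹ ^ (1 / 2 : ℝ)) (hg.mul (hw.measurable.pow_const _)).aemeasurable
    (hw.measurable.inv.pow_const _).aemeasurable
  have h1 : ∀ t, g t * w t ^ (1 / 2 : ℝ) * (w t)⁻¹ ^ (1 / 2 : ℝ) = g t := fun t => by
    rw [mul_assoc, ← ENNReal.mul_rpow_of_nonneg _ _ (by norm_num),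
      ENNReal.mul_inv_cancel (hw.ne_zero t) (hw.ne_top t), ENNReal.one_rpow, mul_one]
  have h2 : ∀ y : ℝ≥0∞, (y ^ (1 / 2 : ℝ)) ^ 2 = y := fun y => by
    rw [← ENNReal.rpow_natCast, ← ENNReal.rpow_mul]; simp
  simpa only [h1, h2, mul_pow] using h

theorem iUnion_toSet (s : ℤ) : (⋃ j : ℤ, DyadicInterval.toSet ⟨s, j⟩) = Set.univ := by
  have h0 := zpow_two_pos s
  refine Set.eq_univ_of_forall fun x => Set.mem_iUnion.2 ⟨⌊x / 2 ^ s⌋, ?_, ?_⟩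
  · exact (le_div_iff₀ h0).1 (Int.floor_le _)
  · exact (div_lt_iff₀ h0).1 (Int.lt_floor_add_one _)

theorem eq_of_mem_toSet {s i j : ℤ} {x : ℝ} (hi : x ∈ DyadicInterval.toSet ⟨s, i⟩)
    (hj : x ∈ DyadicInterval.toSet ⟨s, j⟩) : i = j := by
  have h0 := zpow_two_pos s
  obtain ⟨h1, h2⟩ := hi
  obtain ⟨h3, h4⟩ := hj
  have h5 : (i : ℝ) < j + 1 := lt_of_mul_lt_mul_right (h1.trans_lt h4) h0.le
  have h6 : (j : ℝ) < i + 1 := lt_of_mul_lt_mul_right (h3.trans_lt h2) h0.le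
  norm_cast at h5 h6
  omega

theorem pairwise_disjoint_toSet (s : ℤ) :
    Pairwise (Function.onFun Disjoint fun j : ℤ => DyadicInterval.toSet ⟨s, j⟩) := by
  intro i j hij
  exact Set.disjoint_left.2 fun x hi hj => hij (eq_of_mem_toSet hi hj)

theorem tsum_setLIntegral_toSet (g : ℝ → ℝ≥0∞) (s : ℤ) :
    ∑' j : ℤ, ∫⁻ t in DyadicInterval.toSet ⟨s, j⟩, g t = ∫⁻ t, g t := by
  rw [← lintegral_iUnion (fun j => DyadicInterval.measurableSet_toSet _)
    (pairwise_disjoint_toSet s), iUnion_toSet, setLIntegral_univ]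

theorem tsum_int_two_mul (g : ℤ → ℝ≥0∞) :
    ∑' j : ℤ, (g (2 * j) + g (2 * j + 1)) = ∑' n, g n := by
  rw [← (Int.divModEquiv 2).symm.tsum_eq g, ENNReal.tsum_prod']
  refine tsum_congr fun j => ?_
  rw [tsum_fintype, Fin.sum_univ_two]
  have h : ∀ b : Fin 2, (Int.divModEquiv 2).symm (j, b) = 2 * j + b := by
    intro b
    simp [Int.divModEquiv, mul_comm]
  simp [h]

namespace IsA2

variable {Q : ℝ≥0∞} {w : ℝ → ℝ≥0∞}

protected theorem inv (hw : IsA2 Q w) : IsA2 Q fun t => (w t)⁻¹ where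
  measurable := hw.measurable.inv
  ne_zero x := ENNReal.inv_ne_zero.2 (hw.ne_top x)
  ne_top x := ENNReal.inv_ne_top.2 (hw.ne_zero x)
  lintegral_ne_top := hw.lintegral_inv_ne_top
  lintegral_inv_ne_top := by simpa using hw.lintegral_ne_top
  mul_le a b := by simpa [mul_comm] using hw.mul_le a b

theorem mass_ne_zero (hw : IsA2 Q w) (I : DyadicInterval) : mass w I ≠ 0 :=
  setLIntegral_Ico_ne_zero hw.measurable hw.ne_zero (by
    have := zpow_two_pos I.scale; nlinarith)

theorem ofReal_sub_eq (I : DyadicInterval) :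
    ENNReal.ofReal (((I.pos : ℝ) + 1) * 2 ^ I.scale - I.pos * 2 ^ I.scale) =
      ENNReal.ofReal I.length := by
  congr 1; rw [DyadicInterval.length]; ring

theorem one_le_mul_toReal (hw : IsA2 Q w) (I : DyadicInterval) :
    I.length ^ 2 ≤ (mass w I).toReal * (mass (fun t => (w t)⁻¹) I).toReal := by
  have h := sq_ofReal_le_mul hw.measurable hw.ne_zero hw.ne_top (I.pos * 2 ^ I.scale)
    ((I.pos + 1) * 2 ^ I.scale)
  have hl : 0 < I.length := zpow_two_pos _
  rw [ofReal_sub_eq] at h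
  have h2 := ENNReal.toReal_mono (ENNReal.mul_ne_top (hw.mass_ne_top I) (hw.inv.mass_ne_top I)) h
  rw [ENNReal.toReal_pow, ENNReal.toReal_ofReal hl.le] at h2
  rw [← ENNReal.toReal_mul]
  exact h2

theorem mul_toReal_le (hw : IsA2 Q w) (hQ : Q ≠ ∞) (I : DyadicInterval) :
    (mass w I).toReal * (mass (fun t => (w t)⁻¹) I).toReal ≤ Q.toReal * I.length ^ 2 := by
  have h := hw.mul_le (I.pos * 2 ^ I.scale) ((I.pos + 1) * 2 ^ I.scale)
  have hl : 0 < I.length := zpow_two_pos _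
  rw [ofReal_sub_eq] at h
  have h2 := ENNReal.toReal_mono (by finiteness) h
  rw [← ENNReal.toReal_mul]
  refine h2.trans (le_of_eq ?_)
  rw [ENNReal.toReal_mul, ENNReal.toReal_pow, ENNReal.toReal_ofReal hl.le]

end IsA2

/-- The Bellman function, evaluated at the averages over a dyadic interval. -/
noncomputable def bellmanAt (Q : ℝ) (w : ℝ → ℝ≥0∞) (f : ℝ → ℝ) (I : DyadicInterval) : ℝ :=
  I.length * bellman Q ((∫ t in I.toSet, f t) / I.length) ((mass w I).toReal / I.length)
    ((mass (fun t => (w t)⁻¹) I).toReal / I.length)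

/-- The averages over an interval are the midpoints of those over its halves, and the
half-difference of the averages of `f` is `haarDiff`. The claim is thus `bellman_concavity`
multiplied by the length. -/
theorem bellmanAt_children {Q : ℝ≥0∞} {w : ℝ → ℝ≥0∞} (hQ : Q ≠ ∞) (hw : IsA2 Q w) {f : ℝ → ℝ}
    (hf : Integrable f) (s j : ℤ) :
    (mass w ⟨s + 1, j⟩).toReal * haarDiff f ⟨s + 1, j⟩ ^ 2 / 2 +
        bellmanAt Q.toReal w f ⟨s + 1, j⟩ ≤
      bellmanAt Q.toReal w f ⟨s, 2 * j⟩ + bellmanAt Q.toReal w f ⟨s, 2 * j + 1⟩ := by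
  set l : ℝ := 2 ^ s with hl
  have hl0 : 0 < l := zpow_two_pos s
  have hlen : DyadicInterval.length ⟨s + 1, j⟩ = 2 * l := by
    simp only [DyadicInterval.length]; rw [zpow_add_one₀ (by norm_num), mul_comm]
  have hlen' : ∀ i, DyadicInterval.length ⟨s, i⟩ = l := fun i => rfl
  set f₁ := ∫ t in DyadicInterval.toSet ⟨s, 2 * j⟩, f t with hf1
  set f₂ := ∫ t in DyadicInterval.toSet ⟨s, 2 * j + 1⟩, f t with hf2
  have hfs : ∫ t in DyadicInterval.toSet ⟨s + 1, j⟩, f t = f₁ + f₂ := by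
    rw [toSet_eq_union_children, setIntegral_union (disjoint_children s j)
      (DyadicInterval.measurableSet_toSet _) hf.integrableOn hf.integrableOn]
  have hd : haarDiff f ⟨s + 1, j⟩ = (f₁ - f₂) / (2 * l) := by
    simp only [haarDiff, add_sub_cancel_right, smul_eq_mul, hlen]
    rw [div_eq_inv_mul]
  have hws : (mass w ⟨s + 1, j⟩).toReal =
      (mass w ⟨s, 2 * j⟩).toReal + (mass w ⟨s, 2 * j + 1⟩).toReal := by
    rw [mass_eq_add_children, ENNReal.toReal_add (hw.mass_ne_top _) (hw.mass_ne_top _)]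
  have hvs : (mass (fun t => (w t)⁻¹) ⟨s + 1, j⟩).toReal =
      (mass (fun t => (w t)⁻¹) ⟨s, 2 * j⟩).toReal +
        (mass (fun t => (w t)⁻¹) ⟨s, 2 * j + 1⟩).toReal := by
    rw [mass_eq_add_children, ENNReal.toReal_add (hw.inv.mass_ne_top _) (hw.inv.mass_ne_top _)]
  have hA := hw.one_le_mul_toReal ⟨s, 2 * j⟩
  have hB := hw.one_le_mul_toReal ⟨s, 2 * j + 1⟩
  have hC := hw.mul_toReal_le hQ ⟨s + 1, j⟩
  have hp1 := ENNReal.toReal_pos (hw.mass_ne_zero ⟨s, 2 * j⟩) (hw.mass_ne_top _)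
  have hp2 := ENNReal.toReal_pos (hw.mass_ne_zero ⟨s, 2 * j + 1⟩) (hw.mass_ne_top _)
  simp only [bellmanAt, hfs, hd, hws, hvs, hlen, hlen', ← hf1, ← hf2] at hA hB hC ⊢
  set w₁ := (mass w ⟨s, 2 * j⟩).toReal
  set w₂ := (mass w ⟨s, 2 * j + 1⟩).toReal
  set v₁ := (mass (fun t => (w t)⁻¹) ⟨s, 2 * j⟩).toReal
  set v₂ := (mass (fun t => (w t)⁻¹) ⟨s, 2 * j + 1⟩).toReal
  have key := bellman_concavity (Q := Q.toReal) (F := (f₁ + f₂) / (2 * l))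
    (δ := (f₁ - f₂) / (2 * l)) (W := (w₁ + w₂) / (2 * l)) (ε := (w₁ - w₂) / (2 * l))
    (V := (v₁ + v₂) / (2 * l)) (η := (v₁ - v₂) / (2 * l))
  have r1 : ∀ a b : ℝ, (a + b) / (2 * l) + (a - b) / (2 * l) = a / l := by
    intro a b; field_simp; ring
  have r2 : ∀ a b : ℝ, (a + b) / (2 * l) - (a - b) / (2 * l) = b / l := by
    intro a b; field_simp; ring
  simp only [r1, r2] at key
  have key2 := key (by positivity) (by positivity)
    (by rw [div_mul_div_comm, one_le_div (by positivity)]; linarith)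
    (by rw [div_mul_div_comm, one_le_div (by positivity)]; linarith)
    (by rw [div_mul_div_comm, div_le_iff₀ (by positivity)]; linarith)
  have h3 := mul_le_mul_of_nonneg_left key2 (by positivity : 0 ≤ 2 * l)
  refine le_trans (le_of_eq ?_) (h3.trans (le_of_eq ?_))
  · field_simp
  · ring

theorem bellmanAt_nonneg {Q : ℝ≥0∞} {w : ℝ → ℝ≥0∞} (hw : IsA2 Q w) (q : ℝ)
    (f : ℝ → ℝ) (I : DyadicInterval) : 0 ≤ bellmanAt q w f I := by
  have hl : 0 < I.length := zpow_two_pos _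
  have hp1 := ENNReal.toReal_pos (hw.mass_ne_zero I) (hw.mass_ne_top _)
  have hp2 := ENNReal.toReal_pos (hw.inv.mass_ne_zero I) (hw.inv.mass_ne_top _)
  have hA := hw.one_le_mul_toReal I
  have : ((mass w I).toReal / I.length)⁻¹ ≤ (mass (fun t => (w t)⁻¹) I).toReal / I.length := by
    rw [inv_le_iff_one_le_mul₀ (by positivity), div_mul_div_comm, one_le_div (by positivity)]
    linarith
  have h2 : 0 < (mass (fun t => (w t)⁻¹) I).toReal / I.length := by positivity
  have h3 : 0 ≤ 2 * ((mass (fun t => (w t)⁻¹) I).toReal / I.length) -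
    ((mass w I).toReal / I.length)⁻¹ := by linarith
  unfold bellmanAt bellman
  positivity

/-- Since `2V - W⁻¹ ≥ V` and `V W ≤ Q`, both terms of the Bellman function are at most multiples of
`F² / V`, and Cauchy–Schwarz bounds this by the weighted square integral over the interval. -/
theorem ofReal_bellmanAt_le {Q : ℝ≥0∞} {w : ℝ → ℝ≥0∞} (hQ : Q ≠ ∞) (hw : IsA2 Q w) {f : ℝ → ℝ}
    (hf : Measurable f) (I : DyadicInterval) :
    ENNReal.ofReal (bellmanAt Q.toReal w f I) ≤
      (Q + 8 * Q ^ 2) * ∫⁻ t in I.toSet, ‖f t‖ₑ ^ 2 * w t := by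
  set X := ∫⁻ t in I.toSet, ‖f t‖ₑ ^ 2 * w t with hX
  have hl : 0 < I.length := zpow_two_pos _
  have hp1 := ENNReal.toReal_pos (hw.mass_ne_zero I) (hw.mass_ne_top _)
  have hp2 := ENNReal.toReal_pos (hw.inv.mass_ne_zero I) (hw.inv.mass_ne_top _)
  have hA := hw.one_le_mul_toReal I
  have hC := hw.mul_toReal_le hQ I
  have hsq : ENNReal.ofReal ((∫ t in I.toSet, f t) ^ 2) ≤ X * mass (fun t => (w t)⁻¹) I := by
    calc ENNReal.ofReal ((∫ t in I.toSet, f t) ^ 2) = ‖∫ t in I.toSet, f t‖ₑ ^ 2 := by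
          rw [← sq_abs, ENNReal.ofReal_pow (abs_nonneg _), ← Real.norm_eq_abs, ofReal_norm]
      _ ≤ (∫⁻ t in I.toSet, ‖f t‖ₑ) ^ 2 := by gcongr; exact enorm_integral_le_lintegral_enorm _
      _ ≤ _ := hw.sq_setLIntegral_le hf.enorm _
  set W := (mass w I).toReal with hW
  set V := (mass (fun t => (w t)⁻¹) I).toReal with hV
  set F := ∫ t in I.toSet, f t with hF
  set q := Q.toReal with hq
  have hq0 : 0 ≤ q := ENNReal.toReal_nonneg
  have hmV : V / I.length ≤ 2 * (V / I.length) - (W / I.length)⁻¹ := by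
    have : (W / I.length)⁻¹ ≤ V / I.length := by
      rw [inv_le_iff_one_le_mul₀ (by positivity), div_mul_div_comm, one_le_div (by positivity)]
      linarith
    linarith
  have hle : bellmanAt q w f I ≤ (q + 8 * q ^ 2) * (F ^ 2 / V) := by
    unfold bellmanAt bellman
    rw [← hF, ← hW, ← hV, mul_add, add_mul]
    refine add_le_add ?_ ?_
    · rw [← mul_div_assoc q, le_div_iff₀ hp2]
      calc I.length * ((F / I.length) ^ 2 * (W / I.length)) * V
          = F ^ 2 * (W * V) / I.length ^ 2 := by field_simp
        _ ≤ F ^ 2 * (q * I.length ^ 2) / I.length ^ 2 := by gcongr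
        _ = q * F ^ 2 := by field_simp
    · calc I.length * (8 * q ^ 2 * ((F / I.length) ^ 2 / (2 * (V / I.length) - (W / I.length)⁻¹)))
          ≤ I.length * (8 * q ^ 2 * ((F / I.length) ^ 2 / (V / I.length))) := by gcongr
        _ = _ := by field_simp
  refine (ENNReal.ofReal_le_ofReal hle).trans ?_
  rw [ENNReal.ofReal_mul (by positivity), ENNReal.ofReal_add hq0 (by positivity),
    ENNReal.ofReal_mul (by norm_num), ENNReal.ofReal_pow hq0, hq, ENNReal.ofReal_toReal hQ,
    ENNReal.ofReal_div_of_pos hp2, hV, ENNReal.ofReal_toReal (hw.inv.mass_ne_top _)]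
  have h8 : ENNReal.ofReal 8 = 8 := by simp
  rw [h8]
  gcongr
  exact ENNReal.div_le_of_le_mul hsq

/-- From one scale to the next finer one, the total of the Bellman values increases by at least half
of the square function at that scale. The totals are nonnegative and at most `X` at every scale, so
the increments telescope. -/
theorem tsum_mass_mul_haarDiff_real_le {Q : ℝ≥0∞} {w : ℝ → ℝ≥0∞} (hQ : Q ≠ ∞) (hw : IsA2 Q w)
    {f : ℝ → ℝ} (hfm : Measurable f) (hf : Integrable f) :
    ∑' J, mass w J * ‖haarDiff f J‖ₑ ^ 2 ≤
      2 * ((Q + 8 * Q ^ 2) * ∫⁻ t, ‖f t‖ₑ ^ 2 * w t) := by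
  set X := (Q + 8 * Q ^ 2) * ∫⁻ t, ‖f t‖ₑ ^ 2 * w t with hX
  set B : ℤ → ℝ≥0∞ := fun s => ∑' j : ℤ, ENNReal.ofReal (bellmanAt Q.toReal w f ⟨s, j⟩) with hB
  set G : ℤ → ℝ≥0∞ := fun s => ∑' j : ℤ, mass w ⟨s, j⟩ * ‖haarDiff f ⟨s, j⟩‖ₑ ^ 2 with hG
  have hBX : ∀ s, B s ≤ X := by
    intro s
    calc B s ≤ ∑' j : ℤ, (Q + 8 * Q ^ 2) *
          ∫⁻ t in DyadicInterval.toSet ⟨s, j⟩, ‖f t‖ₑ ^ 2 * w t :=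
          ENNReal.tsum_le_tsum fun j => ofReal_bellmanAt_le hQ hw hfm _
      _ = X := by rw [ENNReal.tsum_mul_left, tsum_setLIntegral_toSet]
  have hstep : ∀ s, G (s + 1) + 2 * B (s + 1) ≤ 2 * B s := by
    intro s
    simp only [hG, hB]
    rw [← tsum_int_two_mul (fun j => ENNReal.ofReal (bellmanAt Q.toReal w f ⟨s, j⟩)),
      ← ENNReal.tsum_mul_left, ← ENNReal.tsum_mul_left, ← ENNReal.tsum_add]
    refine ENNReal.tsum_le_tsum fun j => ?_
    have h := bellmanAt_children hQ hw hf s j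
    have e1 : mass w ⟨s + 1, j⟩ * ‖haarDiff f ⟨s + 1, j⟩‖ₑ ^ 2 =
        2 * ENNReal.ofReal ((mass w ⟨s + 1, j⟩).toReal * haarDiff f ⟨s + 1, j⟩ ^ 2 / 2) := by
      rw [← ENNReal.ofReal_ofNat, ← ENNReal.ofReal_mul (by norm_num), mul_div_cancel₀ _ (by norm_num),
        ENNReal.ofReal_mul ENNReal.toReal_nonneg, ENNReal.ofReal_toReal (hw.mass_ne_top _),
        ← sq_abs, ENNReal.ofReal_pow (abs_nonneg _), ← Real.norm_eq_abs, ofReal_norm]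
    rw [e1, ← mul_add, ← ENNReal.ofReal_add (by positivity) (bellmanAt_nonneg hw _ _ _),
      ← ENNReal.ofReal_add (bellmanAt_nonneg hw _ _ _) (bellmanAt_nonneg hw _ _ _)]
    gcongr
  have hsum : ∀ (s : ℤ) (n : ℕ), ∑ i ∈ Finset.range n, G (s - i) + 2 * B s ≤ 2 * B (s - n) := by
    intro s n
    induction n with
    | zero => simp
    | succ n ih =>
      rw [Finset.sum_range_succ]
      have h1 := hstep (s - n - 1)
      rw [sub_add_cancel] at h1
      have h2 : s - ((n + 1 : ℕ) : ℤ) = s - n - 1 := by push_cast; ring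
      rw [h2]
      calc ∑ i ∈ Finset.range n, G (s - i) + G (s - n) + 2 * B s
          = G (s - n) + (∑ i ∈ Finset.range n, G (s - i) + 2 * B s) := by ring
        _ ≤ G (s - n) + 2 * B (s - n) := by gcongr
        _ ≤ _ := h1
  rw [tsum_dyadic]
  change ∑' s, G s ≤ _
  rw [ENNReal.tsum_eq_iSup_sum]
  refine iSup_le fun t => ?_
  obtain ⟨M, hM⟩ : ∃ M : ℕ, ∀ s ∈ t, s.natAbs ≤ M :=
    ⟨t.sup Int.natAbs, fun s hs => Finset.le_sup (f := Int.natAbs) hs⟩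
  have hsub : t ⊆ (Finset.range (2 * M + 1)).image fun i : ℕ => (M : ℤ) - i := by
    intro s hs
    have := hM s hs
    exact Finset.mem_image.2 ⟨((M : ℤ) - s).toNat, Finset.mem_range.2 (by omega), by omega⟩
  calc ∑ s ∈ t, G s ≤ ∑ s ∈ (Finset.range (2 * M + 1)).image fun i : ℕ => (M : ℤ) - i, G s :=
        Finset.sum_le_sum_of_subset hsub
    _ = ∑ i ∈ Finset.range (2 * M + 1), G (M - i) := by
        rw [Finset.sum_image fun a _ b _ h => by simpa using h]
    _ ≤ 2 * B (M - (2 * M + 1 : ℕ)) := le_trans le_self_add (hsum _ _)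
    _ ≤ 2 * X := by gcongr; exact hBX _

theorem tsum_mass_mul_haarDiff_le {Q : ℝ≥0∞} {w : ℝ → ℝ≥0∞} (hQ : Q ≠ ∞) (hw : IsA2 Q w)
    {f : ℝ → ℂ} (hfm : Measurable f) (hf : Integrable f) :
    ∑' J, mass w J * ‖haarDiff f J‖ₑ ^ 2 ≤
      2 * (Q + 8 * Q ^ 2) * ∫⁻ t, ‖f t‖ₑ ^ 2 * w t := by
  have hsq : ∀ z : ℂ, ‖z‖ₑ ^ 2 = ‖z.re‖ₑ ^ 2 + ‖z.im‖ₑ ^ 2 := by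
    intro z
    rw [← ofReal_norm, ← ofReal_norm, ← ofReal_norm, ← ENNReal.ofReal_pow (norm_nonneg _),
      ← ENNReal.ofReal_pow (norm_nonneg _), ← ENNReal.ofReal_pow (norm_nonneg _),
      ← ENNReal.ofReal_add (by positivity) (by positivity)]
    congr 1
    rw [Complex.sq_norm, Complex.normSq_apply, Real.norm_eq_abs, Real.norm_eq_abs, sq_abs, sq_abs]
    ring
  have hre : ∀ J, (haarDiff f J).re = haarDiff (fun t => (f t).re) J := by
    intro J
    have h : ∀ s : Set ℝ, (∫ t in s, f t).re = ∫ t in s, (f t).re := fun s =>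
      (Complex.reCLM.integral_comp_comm hf.integrableOn).symm
    simp only [haarDiff, Complex.real_smul, Complex.re_ofReal_mul, Complex.sub_re, h, smul_eq_mul]
  have him : ∀ J, (haarDiff f J).im = haarDiff (fun t => (f t).im) J := by
    intro J
    have h : ∀ s : Set ℝ, (∫ t in s, f t).im = ∫ t in s, (f t).im := fun s =>
      (Complex.imCLM.integral_comp_comm hf.integrableOn).symm
    simp only [haarDiff, Complex.real_smul, Complex.im_ofReal_mul, Complex.sub_im, h, smul_eq_mul]
  have h1 := tsum_mass_mul_haarDiff_real_le hQ hw (Complex.measurable_re.comp hfm) hf.re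
  have h2 := tsum_mass_mul_haarDiff_real_le hQ hw (Complex.measurable_im.comp hfm) hf.im
  simp only [hsq, mul_add, ENNReal.tsum_add, hre, him, add_mul]
  refine (add_le_add h1 h2).trans (le_of_eq ?_)
  have hm : Measurable fun t => ‖(f t).re‖ₑ ^ 2 * w t :=
    ((Complex.measurable_re.comp hfm).enorm.pow_const 2).mul hw.measurable
  rw [lintegral_add_left hm]
  simp only [Function.comp]
  ring

/-! ### Bump functions and their Haar coefficients -/

/-- `L¹`-normalized bump functions adapted to a dyadic interval. -/
structure IsBump (K : ℝ) (I : DyadicInterval) (ψ : ℝ → ℂ) : Prop where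
  nonneg : 0 ≤ K
  differentiable : Differentiable ℝ ψ
  norm_le : ∀ x, ‖ψ x‖ ≤ K * I.length⁻¹ * ((1 + |x - I.center| / I.length) ^ 6)⁻¹
  norm_deriv_le : ∀ x, ‖deriv ψ x‖ ≤
    K * (I.length ^ 2)⁻¹ * ((1 + |x - I.center| / I.length) ^ 6)⁻¹

/-- The real valued version of `decay`. -/
noncomputable def realDecay (a : ℕ) (n : ℤ) : ℝ := ((1 + (n.natAbs : ℝ)) ^ a)⁻¹

theorem ofReal_realDecay (a : ℕ) (n : ℤ) : ENNReal.ofReal (realDecay a n) = decay a n := by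
  rw [realDecay, decay, ENNReal.ofReal_inv_of_pos (by positivity), ENNReal.ofReal_pow (by positivity),
    ENNReal.ofReal_add (by norm_num) (by positivity), ENNReal.ofReal_natCast, ENNReal.ofReal_one]

theorem realDecay_nonneg (a : ℕ) (n : ℤ) : 0 ≤ realDecay a n := by unfold realDecay; positivity

/-- For `x` in the `n`-th interval, `1 + |x - c(I)| / |I|` is at least `(1 + |i - n|) / 2`; the
sixth power gives `64`. -/
theorem tail_le_realDecay {s i n : ℤ} {x : ℝ} (hx : x ∈ DyadicInterval.toSet ⟨s, n⟩) :
    ((1 + |x - DyadicInterval.center ⟨s, i⟩| / DyadicInterval.length ⟨s, i⟩) ^ 6)⁻¹ ≤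
      64 * realDecay 6 (i - n) := by
  have h0 := zpow_two_pos s
  have hx1 : (n : ℝ) ≤ x / 2 ^ s := (le_div_iff₀ h0).2 hx.1
  have hx2 : x / 2 ^ s < n + 1 := (div_lt_iff₀ h0).2 hx.2
  have h1 : |x - DyadicInterval.center ⟨s, i⟩| / DyadicInterval.length ⟨s, i⟩ =
      |x / 2 ^ s - (i + 1 / 2)| := by
    simp only [DyadicInterval.center, DyadicInterval.length]
    rw [← abs_of_pos h0, ← abs_div, abs_of_pos h0]
    congr 1; field_simp
  have h2 : ((i - n).natAbs : ℝ) - 1 / 2 ≤ |x / 2 ^ s - (i + 1 / 2)| := by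
    rw [Nat.cast_natAbs, Int.cast_abs]; push_cast
    rcases abs_cases ((i : ℝ) - n) with h | h <;>
      rcases abs_cases (x / 2 ^ s - ((i : ℝ) + 1 / 2)) with h' | h' <;> linarith
  rw [h1, realDecay]
  have h3 : (1 + ((i - n).natAbs : ℝ)) / 2 ≤ 1 + |x / 2 ^ s - (i + 1 / 2)| := by
    have : (0 : ℝ) ≤ ((i - n).natAbs : ℝ) := by positivity
    linarith
  calc ((1 + |x / 2 ^ s - (i + 1 / 2)|) ^ 6)⁻¹ ≤ (((1 + ((i - n).natAbs : ℝ)) / 2) ^ 6)⁻¹ := by gcongr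
    _ = _ := by rw [div_pow, inv_div]; norm_num; rw [div_eq_mul_inv]

namespace IsBump

variable {K : ℝ} {s i : ℤ} {ψ : ℝ → ℂ}

theorem norm_le_of_mem (h : IsBump K ⟨s, i⟩ ψ) {n : ℤ} {x : ℝ}
    (hx : x ∈ DyadicInterval.toSet ⟨s, n⟩) :
    ‖ψ x‖ ≤ 64 * K * (2 ^ s)⁻¹ * realDecay 6 (i - n) := by
  have h0 := zpow_two_pos s
  have hK := h.nonneg
  calc ‖ψ x‖ ≤ K * (2 ^ s)⁻¹ * (64 * realDecay 6 (i - n)) := by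
        refine (h.norm_le x).trans ?_
        exact mul_le_mul_of_nonneg_left (tail_le_realDecay hx) (by positivity)
    _ = _ := by ring

theorem norm_deriv_le_of_mem (h : IsBump K ⟨s, i⟩ ψ) {n : ℤ} {x : ℝ}
    (hx : x ∈ DyadicInterval.toSet ⟨s, n⟩) :
    ‖deriv ψ x‖ ≤ 64 * K * ((2 ^ s) ^ 2)⁻¹ * realDecay 6 (i - n) := by
  have h0 := zpow_two_pos s
  have hK := h.nonneg
  calc ‖deriv ψ x‖ ≤ K * ((2 ^ s) ^ 2)⁻¹ * (64 * realDecay 6 (i - n)) := by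
        refine (h.norm_deriv_le x).trans ?_
        exact mul_le_mul_of_nonneg_left (tail_le_realDecay hx) (by positivity)
    _ = _ := by ring

theorem setLIntegral_enorm_mul_le (h : IsBump K ⟨s, i⟩ ψ) (n : ℤ) (V : ℝ → ℝ≥0∞) :
    ∫⁻ t in DyadicInterval.toSet ⟨s, n⟩, ‖ψ t‖ₑ * V t ≤
      ENNReal.ofReal (64 * K * (2 ^ s)⁻¹) * decay 6 (i - n) *
        ∫⁻ t in DyadicInterval.toSet ⟨s, n⟩, V t := by
  have h0 := zpow_two_pos s
  have hK := h.nonneg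
  have hc : ENNReal.ofReal (64 * K * (2 ^ s)⁻¹) * decay 6 (i - n) ≠ ∞ := by
    rw [← ofReal_realDecay]; finiteness
  rw [← lintegral_const_mul' _ _ hc]
  refine setLIntegral_mono' (DyadicInterval.measurableSet_toSet _) fun t ht => ?_
  gcongr
  rw [← ofReal_realDecay, ← ENNReal.ofReal_mul (by positivity), ← ofReal_norm]
  exact ENNReal.ofReal_le_ofReal (h.norm_le_of_mem ht)

/-- The convex hull of the two intervals contains `x` and has rational endpoints, so it is
admissible in `maxFn`; it is `1 + |i - n|` times as long as each of them. -/
theorem setLIntegral_toSet_le_mul_maxFn (V : ℝ → ℝ≥0∞) (n : ℤ) {x : ℝ}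
    (hx : x ∈ DyadicInterval.toSet ⟨s, i⟩) :
    ∫⁻ t in DyadicInterval.toSet ⟨s, n⟩, V t ≤
      ENNReal.ofReal (2 ^ s) * (1 + (i - n).natAbs) * maxFn volume V x := by
  have h0 := zpow_two_pos s
  set a : ℚ := (min i n : ℤ) * 2 ^ s with ha
  set b : ℚ := ((max i n : ℤ) + 1) * 2 ^ s with hb
  have ha' : (a : ℝ) = (min i n : ℤ) * 2 ^ s := by rw [ha]; push_cast; rfl
  have hb' : (b : ℝ) = ((max i n : ℤ) + 1) * 2 ^ s := by rw [hb]; push_cast; rfl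
  have hsub : ∀ k : ℤ, min i n ≤ k → k ≤ max i n →
      DyadicInterval.toSet ⟨s, k⟩ ⊆ Set.Ico (a : ℝ) b := by
    intro k h1 h2
    rw [ha', hb']
    refine Set.Ico_subset_Ico ?_ ?_ <;> simp only [] <;> gcongr
  have hxJ := hsub i (min_le_left _ _) (le_max_left _ _) hx
  have hM := average_le_maxFn volume V hxJ
  have hlen : (b : ℝ) - a = 2 ^ s * (1 + (i - n).natAbs) := by
    have : ((max i n : ℤ) : ℝ) - (min i n : ℤ) = (i - n).natAbs := by
      rw [Nat.cast_natAbs]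
      have : max i n - min i n = |i - n| := max_sub_min_eq_abs' i n
      exact_mod_cast this
    rw [← this, ha', hb']; ring
  have hvol : volume (Set.Ico (a : ℝ) b) = ENNReal.ofReal (2 ^ s) * (1 + (i - n).natAbs) := by
    rw [Real.volume_Ico, hlen, ENNReal.ofReal_mul h0.le, ENNReal.ofReal_add (by norm_num)
      (by positivity), ENNReal.ofReal_one, ENNReal.ofReal_natCast]
  rw [hvol] at hM
  refine (lintegral_mono_set (hsub n (min_le_right _ _) (le_max_right _ _))).trans ?_
  rw [mul_comm]
  refine (ENNReal.div_le_iff ?_ ?_).1 hM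
  · simp [h0]
  · finiteness

theorem lintegral_enorm_mul_le (h : IsBump K ⟨s, i⟩ ψ) (V : ℝ → ℝ≥0∞) {x : ℝ}
    (hx : x ∈ DyadicInterval.toSet ⟨s, i⟩) :
    ∫⁻ t, ‖ψ t‖ₑ * V t ≤ ENNReal.ofReal (64 * K) * (∑' n, decay 2 n) * maxFn volume V x := by
  have h0 := zpow_two_pos s
  have hK := h.nonneg
  rw [← tsum_setLIntegral_toSet _ s]
  calc _ ≤ ∑' n : ℤ, ENNReal.ofReal (64 * K) * maxFn volume V x * decay 2 (i - n) := by
        refine ENNReal.tsum_le_tsum fun n => (h.setLIntegral_enorm_mul_le n V).trans ?_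
        calc _ ≤ ENNReal.ofReal (64 * K * (2 ^ s)⁻¹) * decay 6 (i - n) *
              (ENNReal.ofReal (2 ^ s) * (1 + (i - n).natAbs) * maxFn volume V x) := by
              gcongr; exact setLIntegral_toSet_le_mul_maxFn V n hx
          _ = (ENNReal.ofReal (64 * K * (2 ^ s)⁻¹) * ENNReal.ofReal (2 ^ s)) * maxFn volume V x *
              (decay 6 (i - n) * (1 + ((i - n).natAbs : ℝ≥0∞)) ^ 1) := by rw [pow_one]; ring
          _ = ENNReal.ofReal (64 * K) * maxFn volume V x * decay 5 (i - n) := by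
              rw [← ENNReal.ofReal_mul (by positivity), inv_mul_cancel_right₀ h0.ne',
                decay_add_mul 5 1]
          _ ≤ _ := by gcongr; exact decay_anti (by norm_num) _
    _ = _ := by rw [ENNReal.tsum_mul_left, tsum_int_sub_left (decay 2)]; ring

theorem continuous (h : IsBump K ⟨s, i⟩ ψ) : Continuous ψ := h.differentiable.continuous

theorem setLIntegral_le (h : IsBump K ⟨s, i⟩ ψ) (n : ℤ) :
    ∫⁻ t in DyadicInterval.toSet ⟨s, n⟩, ‖ψ t‖ₑ ≤ ENNReal.ofReal (64 * K) * decay 6 (i - n) := by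
  have h0 := zpow_two_pos s
  have hK := h.nonneg
  have h1 := h.setLIntegral_enorm_mul_le n fun _ => 1
  simp only [mul_one, setLIntegral_one] at h1
  refine h1.trans (le_of_eq ?_)
  have : volume (DyadicInterval.toSet ⟨s, n⟩) = ENNReal.ofReal (2 ^ s) := by
    rw [DyadicInterval.toSet, Real.volume_Ico]; congr 1; ring
  rw [this, mul_right_comm, ← ENNReal.ofReal_mul (by positivity), inv_mul_cancel_right₀ h0.ne']

theorem integrable (h : IsBump K ⟨s, i⟩ ψ) : Integrable ψ := by
  refine ⟨h.continuous.aestronglyMeasurable, ?_⟩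
  rw [hasFiniteIntegral_iff_enorm, ← tsum_setLIntegral_toSet _ s]
  refine lt_of_le_of_lt (b := ∑' n : ℤ, ENNReal.ofReal (64 * K) * decay 2 (i - n))
    (ENNReal.tsum_le_tsum fun n => (h.setLIntegral_le n).trans ?_) ?_
  · gcongr; exact decay_anti (by norm_num) _
  · rw [ENNReal.tsum_mul_left, tsum_int_sub_left (decay 2)]
    have := tsum_decay_two_ne_top
    finiteness

/-- The primitive of a bump function with mean zero is a bump function. -/
theorem enorm_integral_Iio_le (h : IsBump K ⟨s, i⟩ ψ) (hz : ∫ t, ψ t = 0) (e : ℤ) :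
    ‖∫ t in Set.Iio ((e : ℝ) * 2 ^ s), ψ t‖ₑ ≤
      ENNReal.ofReal (64 * K) * (∑' n, decay 2 n) * decay 4 (i - e) := by
  have h0 := zpow_two_pos s
  have key : ∀ S : Set ℝ, MeasurableSet S → (∀ n : ℤ, (i - e).natAbs ≤ (i - n).natAbs ∨
      Disjoint (DyadicInterval.toSet ⟨s, n⟩) S) → ‖∫ t in S, ψ t‖ₑ ≤
        ENNReal.ofReal (64 * K) * (∑' n, decay 2 n) * decay 4 (i - e) := by
    intro S hS hn
    refine (enorm_integral_le_lintegral_enorm _).trans ?_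
    rw [← lintegral_indicator hS, ← tsum_setLIntegral_toSet _ s]
    calc _ ≤ ∑' n : ℤ, ENNReal.ofReal (64 * K) * decay 4 (i - e) * decay 2 (i - n) := by
          refine ENNReal.tsum_le_tsum fun n => ?_
          rcases hn n with h1 | h1
          · calc ∫⁻ t in DyadicInterval.toSet ⟨s, n⟩, S.indicator (fun a => ‖ψ a‖ₑ) t
                ≤ ∫⁻ t in DyadicInterval.toSet ⟨s, n⟩, ‖ψ t‖ₑ :=
                  lintegral_mono fun t => Set.indicator_le_self _ _ _
              _ ≤ ENNReal.ofReal (64 * K) * decay 6 (i - n) := h.setLIntegral_le n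
              _ ≤ ENNReal.ofReal (64 * K) * (decay 4 (i - e) * decay 2 (i - n)) := by
                  gcongr
                  unfold decay
                  -- Two of the six powers of decay serve to sum over `n`, the other four become the
                  -- decay of the primitive.
                  rw [← ENNReal.mul_inv (Or.inr (by finiteness)) (Or.inl (by finiteness)),
                    show (6 : ℕ) = 4 + 2 by norm_num, pow_add]
                  gcongr
              _ = _ := by ring
          · rw [setLIntegral_congr_fun (g := fun _ => 0) (DyadicInterval.measurableSet_toSet _)
              fun t ht => Set.indicator_of_notMem (Set.disjoint_left.1 h1 ht) _]
            simp
      _ = _ := by rw [ENNReal.tsum_mul_left, tsum_int_sub_left (decay 2)]; ring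
  -- The integration runs over the half-line that stays away from the interval `i`. When this is the
  -- right one, the mean zero of `ψ` permits the exchange.
  rcases le_or_gt e i with hei | hei
  · refine key _ measurableSet_Iio fun n => ?_
    rcases lt_or_ge n e with hn | hn
    · left; omega
    · right
      refine Set.disjoint_left.2 fun t ht ht' => ?_
      have h1 : (e : ℝ) ≤ n := by exact_mod_cast hn
      have h2 : (n : ℝ) * 2 ^ s ≤ t := ht.1
      have h3 : t < (e : ℝ) * 2 ^ s := ht'
      nlinarith
  · have h1 : ∫ t in Set.Iio ((e : ℝ) * 2 ^ s), ψ t = -∫ t in Set.Ici ((e : ℝ) * 2 ^ s), ψ t := by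
      have := integral_add_compl (measurableSet_Iio (a := (e : ℝ) * 2 ^ s)) h.integrable
      rw [hz, Set.compl_Iio] at this
      exact eq_neg_of_add_eq_zero_left this
    rw [h1, enorm_neg]
    refine key _ measurableSet_Ici fun n => ?_
    rcases lt_or_ge n e with hn | hn
    · right
      refine Set.disjoint_left.2 fun t ht ht' => ?_
      have h1 : (n : ℝ) + 1 ≤ e := by exact_mod_cast hn
      have h2 : t < ((n : ℝ) + 1) * 2 ^ s := ht.2
      have h3 : (e : ℝ) * 2 ^ s ≤ t := ht'
      nlinarith
    · left; omega

end IsBump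

/-- The integral of `ψ` against the `L^∞`-normalized Haar function of `J`, in absolute value. -/
noncomputable def haarSize (ψ : ℝ → ℂ) (J : DyadicInterval) : ℝ≥0∞ :=
  ‖(∫ t in DyadicInterval.toSet ⟨J.scale - 1, 2 * J.pos⟩, ψ t) -
    ∫ t in DyadicInterval.toSet ⟨J.scale - 1, 2 * J.pos + 1⟩, ψ t‖ₑ

namespace IsBump

variable {K : ℝ} {s i : ℤ} {ψ : ℝ → ℂ}

/-- On `J` the bump differs from a constant by at most `|J| sup |ψ'|`, and the constant cancels
between the two halves. Integration over `J` gives a second factor `|J|`; relative to the length of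
the bump's interval, `|J|² = 4⁻ᵐ`. No cancellation of `ψ` is needed. -/
theorem haarSize_fine_le (h : IsBump K ⟨s, i⟩ ψ) (m : ℕ) (j : ℤ) :
    haarSize ψ ⟨s - m, j⟩ ≤ ENNReal.ofReal (64 * K) * ((4 ^ m)⁻¹ * decay 4 (i - j / 2 ^ m)) := by
  have h0 := zpow_two_pos s
  have hK := h.nonneg
  set n := j / 2 ^ m with hn
  set l : ℝ := 2 ^ (s - m - 1) with hl
  have hl0 : 0 < l := zpow_two_pos _
  have hl2 : l * (2 * 2 ^ m) = 2 ^ s := by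
    rw [hl, zpow_sub₀ (by norm_num), zpow_sub₀ (by norm_num), zpow_natCast, zpow_one]; field_simp
  set D : ℝ := 64 * K * ((2 ^ s) ^ 2)⁻¹ * realDecay 6 (i - n) with hD
  have hD0 : 0 ≤ D := by have := realDecay_nonneg 6 (i - n); positivity
  have hJ : DyadicInterval.toSet ⟨s - m, j⟩ ⊆ DyadicInterval.toSet ⟨s, n⟩ := by
    have := toSet_subset_toSet_ancestor (s - m) j m
    rwa [sub_add_cancel] at this
  have hch : DyadicInterval.toSet ⟨s - m, j⟩ = DyadicInterval.toSet ⟨s - m - 1, 2 * j⟩ ∪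
      DyadicInterval.toSet ⟨s - m - 1, 2 * j + 1⟩ := by
    have := toSet_eq_union_children (s - m - 1) j
    rwa [sub_add_cancel] at this
  have hlJ : (2 : ℝ) ^ (s - m) = 2 * l := by
    rw [hl, zpow_sub_one₀ (by norm_num)]; ring
  set t₀ : ℝ := j * 2 ^ (s - m) with ht0
  have ht0J : t₀ ∈ DyadicInterval.toSet ⟨s - m, j⟩ :=
    ⟨le_rfl, by have := zpow_two_pos (s - m); simp only [ht0]; nlinarith⟩
  have hdiff : ∀ t ∈ DyadicInterval.toSet ⟨s - m, j⟩, ‖ψ t - ψ t₀‖ ≤ D * (2 * l) := by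
    intro t ht
    have h1 := Convex.norm_image_sub_le_of_norm_deriv_le (𝕜 := ℝ) (f := ψ) (C := D)
      (s := DyadicInterval.toSet ⟨s, n⟩) (fun x _ => h.differentiable x)
      (fun x hx => h.norm_deriv_le_of_mem hx) (convex_Ico _ _) (hJ ht0J) (hJ ht)
    refine h1.trans (mul_le_mul_of_nonneg_left ?_ hD0)
    rw [← hlJ, Real.norm_eq_abs, abs_of_nonneg (sub_nonneg.2 ht.1)]
    have h2 : t < ((j : ℝ) + 1) * 2 ^ (s - m) := ht.2
    linarith
  have hint : ∀ k : ℤ, DyadicInterval.toSet ⟨s - m - 1, k⟩ ⊆ DyadicInterval.toSet ⟨s - m, j⟩ →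
      ‖(∫ t in DyadicInterval.toSet ⟨s - m - 1, k⟩, ψ t) - l * ψ t₀‖ ≤ D * (2 * l) * l := by
    intro k hk
    have hvol : volume.real (DyadicInterval.toSet ⟨s - m - 1, k⟩) = l := by
      rw [DyadicInterval.toSet, Real.volume_real_Ico_of_le (by simp only []; nlinarith)]
      simp only [hl]; ring
    have hvt : volume (DyadicInterval.toSet ⟨s - m - 1, k⟩) < ∞ := by
      rw [DyadicInterval.toSet]; exact measure_Ico_lt_top
    have h1 : (l : ℂ) * ψ t₀ = ∫ _ in DyadicInterval.toSet ⟨s - m - 1, k⟩, ψ t₀ := by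
      rw [setIntegral_const, hvol, Complex.real_smul]
    rw [h1, ← integral_sub h.integrable.integrableOn (integrableOn_const hvt.ne)]
    refine (norm_setIntegral_le_of_norm_le_const hvt fun t ht => hdiff t (hk ht)).trans ?_
    rw [hvol]
  have h1 := hint (2 * j) (by rw [hch]; exact Set.subset_union_left)
  have h2 := hint (2 * j + 1) (by rw [hch]; exact Set.subset_union_right)
  have h3 : ‖(∫ t in DyadicInterval.toSet ⟨s - m - 1, 2 * j⟩, ψ t) -
      ∫ t in DyadicInterval.toSet ⟨s - m - 1, 2 * j + 1⟩, ψ t‖ ≤ D * (2 * l) ^ 2 := by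
    have h4 := norm_sub_le ((∫ t in DyadicInterval.toSet ⟨s - m - 1, 2 * j⟩, ψ t) - l * ψ t₀)
      ((∫ t in DyadicInterval.toSet ⟨s - m - 1, 2 * j + 1⟩, ψ t) - l * ψ t₀)
    rw [sub_sub_sub_cancel_right] at h4
    nlinarith
  have h5 : D * (2 * l) ^ 2 = 64 * K * ((4 ^ m)⁻¹ * realDecay 6 (i - n)) := by
    have : (2 * l) ^ 2 = (2 ^ s) ^ 2 * (4 ^ m)⁻¹ := by
      rw [← hl2, show (4 : ℝ) = 2 ^ 2 by norm_num, ← pow_mul, mul_comm 2 m, pow_mul]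
      field_simp
    rw [hD, this]; field_simp
  rw [haarSize, ← ofReal_norm]
  refine (ENNReal.ofReal_le_ofReal (h3.trans h5.le)).trans ?_
  rw [ENNReal.ofReal_mul (p := 64 * K) (by positivity), ENNReal.ofReal_mul (p := (4 ^ m)⁻¹)
    (by positivity), ofReal_realDecay,
    ENNReal.ofReal_inv_of_pos (by positivity), ENNReal.ofReal_pow (by norm_num)]
  have : ENNReal.ofReal 4 = 4 := by simp
  rw [this]
  gcongr
  exact decay_anti (by norm_num) _

/-- The pairing with a Haar function is a second difference of the primitive of `ψ` at the two ends
and the midpoint of `J`, the points `(2j + q) 2^m` in units of `2 ^ s`. The primitive decays because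
`ψ` has mean zero, so only bumps near one of these three points matter. The coefficients are `1, 2,
1`, whence the factor 2. -/
theorem haarSize_coarse_le (h : IsBump K ⟨s, i⟩ ψ) (hz : ∫ t, ψ t = 0) (m : ℕ) (j : ℤ) :
    haarSize ψ ⟨s + m + 1, j⟩ ≤ 2 * (ENNReal.ofReal (64 * K) * (∑' n, decay 2 n)) *
      ∑ q ∈ Finset.range 3, decay 4 (i - (2 * j + q) * 2 ^ m) := by
  have h0 := zpow_two_pos s
  set P : ℤ → ℂ := fun e => ∫ t in Set.Iio ((e : ℝ) * 2 ^ s), ψ t with hP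
  have hchild : ∀ k : ℤ, ∫ t in DyadicInterval.toSet ⟨s + m, k⟩, ψ t =
      P ((k + 1) * 2 ^ m) - P (k * 2 ^ m) := by
    intro k
    have h1 : DyadicInterval.toSet ⟨s + m, k⟩ = Set.Iio ((((k + 1) * 2 ^ m : ℤ) : ℝ) * 2 ^ s) \
        Set.Iio (((k * 2 ^ m : ℤ) : ℝ) * 2 ^ s) := by
      ext x
      simp only [DyadicInterval.toSet, zpow_two_add_nat, Set.mem_Ico, Set.mem_sdiff, Set.mem_Iio,
        not_lt, Int.cast_mul, Int.cast_add, Int.cast_one, Int.cast_pow, Int.cast_ofNat, mul_assoc]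
      exact and_comm
    rw [h1, setIntegral_sdiff measurableSet_Iio h.integrable.integrableOn]
    refine Set.Iio_subset_Iio ?_
    have : k * 2 ^ m ≤ (k + 1) * 2 ^ m := by gcongr; omega
    have h2 : ((k * 2 ^ m : ℤ) : ℝ) ≤ (((k + 1) * 2 ^ m : ℤ) : ℝ) := by exact_mod_cast this
    gcongr
  set A := ENNReal.ofReal (64 * K) * (∑' n, decay 2 n) with hA
  have hPe : ∀ e, ‖P e‖ₑ ≤ A * decay 4 (i - e) := h.enorm_integral_Iio_le hz
  rw [haarSize]
  simp only [add_sub_cancel_right]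
  rw [hchild, hchild]
  have e0 : (2 * j + ((0 : ℕ) : ℤ)) = 2 * j := by simp
  have e1 : (2 * j + ((1 : ℕ) : ℤ)) = 2 * j + 1 := by simp
  have e2 : (2 * j + ((2 : ℕ) : ℤ)) = 2 * j + 1 + 1 := by push_cast; ring
  simp only [Finset.sum_range_succ, Finset.sum_range_zero, zero_add, e0, e1, e2]
  set a := P (2 * j * 2 ^ m)
  set b := P ((2 * j + 1) * 2 ^ m)
  set c := P ((2 * j + 1 + 1) * 2 ^ m)
  calc ‖b - a - (c - b)‖ₑ ≤ ‖b - a‖ₑ + ‖c - b‖ₑ := enorm_sub_le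
    _ ≤ (‖b‖ₑ + ‖a‖ₑ) + (‖c‖ₑ + ‖b‖ₑ) := add_le_add enorm_sub_le enorm_sub_le
    _ ≤ (‖b‖ₑ + ‖a‖ₑ) + (‖c‖ₑ + ‖b‖ₑ) + (‖a‖ₑ + ‖c‖ₑ) := le_self_add
    _ = 2 * (‖a‖ₑ + ‖b‖ₑ + ‖c‖ₑ) := by ring
    _ ≤ 2 * (A * decay 4 (i - 2 * j * 2 ^ m) + A * decay 4 (i - (2 * j + 1) * 2 ^ m) +
          A * decay 4 (i - (2 * j + 1 + 1) * 2 ^ m)) := by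
        gcongr
        · exact hPe _
        · exact hPe _
        · exact hPe _
    _ = _ := by ring

end IsBump

theorem tsum_int_split (g : ℤ → ℝ≥0∞) (s : ℤ) :
    ∑' z, g z = ∑' m : ℕ, g (s - m) + ∑' m : ℕ, g (s + m + 1) := by
  rw [← tsum_int_sub_left g s, tsum_of_nat_of_neg_add_one ENNReal.summable ENNReal.summable]
  congr 1
  refine tsum_congr fun m => ?_
  congr 1; ring

/-- The constant that controls the Haar coefficients of bump functions. -/
noncomputable def bumpConst (K : ℝ) : ℝ≥0∞ := ENNReal.ofReal (64 * K) * (1 + 2 * ∑' n, decay 2 n)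

theorem bumpConst_ne_top (K : ℝ) : bumpConst K ≠ ∞ := by
  have := tsum_decay_two_ne_top
  unfold bumpConst
  finiteness

theorem IsBump.tsum_haarSize_mul_le {K : ℝ} {I : DyadicInterval} {ψ : ℝ → ℂ} (h : IsBump K I ψ)
    (hz : ∫ t, ψ t = 0) (u : DyadicInterval → ℝ≥0∞) :
    ∑' J, haarSize ψ J * u J ≤ bumpConst K * almostDiag u I := by
  obtain ⟨s, i⟩ := I
  set L := ∑' n, decay 2 n with hL
  rw [tsum_dyadic, tsum_int_split _ s, almostDiag, mul_add]
  refine add_le_add ?_ ?_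
  · rw [← ENNReal.tsum_mul_left]
    refine ENNReal.tsum_le_tsum fun m => ?_
    rw [← ENNReal.tsum_mul_left]
    refine ENNReal.tsum_le_tsum fun j => ?_
    rw [← mul_assoc]
    gcongr
    refine (h.haarSize_fine_le m j).trans ?_
    gcongr
    rw [bumpConst]
    exact le_mul_of_one_le_right' le_self_add
  · rw [← Summable.tsum_finsetSum fun _ _ => ENNReal.summable, ← ENNReal.tsum_mul_left]
    refine ENNReal.tsum_le_tsum fun m => ?_
    rw [← Summable.tsum_finsetSum fun _ _ => ENNReal.summable, ← ENNReal.tsum_mul_left]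
    refine ENNReal.tsum_le_tsum fun j => ?_
    rw [← Finset.sum_mul, ← mul_assoc]
    gcongr
    refine (h.haarSize_coarse_le hz m j).trans ?_
    gcongr
    rw [bumpConst, ← hL]
    calc 2 * (ENNReal.ofReal (64 * K) * L) = ENNReal.ofReal (64 * K) * (2 * L) := by ring
      _ ≤ _ := by gcongr; exact le_add_self

/-! ### Expansion of a pairing in the Haar system -/

/-- The average of `ψ` over the dyadic interval of scale `k` that contains the point. -/
noncomputable def dyadicAvg (ψ : ℝ → ℂ) (k : ℤ) (t : ℝ) : ℂ :=
  (2 ^ k : ℝ)⁻¹ • ∫ u in DyadicInterval.toSet ⟨k, ⌊t / 2 ^ k⌋⟩, ψ u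

theorem floor_eq_of_mem_toSet {k j : ℤ} {t : ℝ} (ht : t ∈ DyadicInterval.toSet ⟨k, j⟩) :
    ⌊t / 2 ^ k⌋ = j := by
  have h0 := zpow_two_pos k
  exact Int.floor_eq_iff.2 ⟨(le_div_iff₀ h0).2 ht.1, (div_lt_iff₀ h0).2 ht.2⟩

theorem mem_toSet_floor (k : ℤ) (t : ℝ) : t ∈ DyadicInterval.toSet ⟨k, ⌊t / 2 ^ k⌋⟩ := by
  have h0 := zpow_two_pos k
  exact ⟨(le_div_iff₀ h0).1 (Int.floor_le _), (div_lt_iff₀ h0).1 (Int.lt_floor_add_one _)⟩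

theorem measurable_dyadicAvg (ψ : ℝ → ℂ) (k : ℤ) : Measurable (dyadicAvg ψ k) := by
  have h1 : Measurable fun j : ℤ => (2 ^ k : ℝ)⁻¹ • ∫ u in DyadicInterval.toSet ⟨k, j⟩, ψ u :=
    measurable_of_countable _
  exact h1.comp (Int.measurable_floor.comp (measurable_id.div_const _))

theorem norm_dyadicAvg_le {ψ : ℝ → ℂ} (hψ : Integrable ψ) (k : ℤ) (t : ℝ) :
    ‖dyadicAvg ψ k t‖ ≤ (2 ^ k)⁻¹ * ∫ u, ‖ψ u‖ := by
  have h0 := zpow_two_pos k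
  rw [dyadicAvg, norm_smul, Real.norm_eq_abs, abs_of_pos (inv_pos.2 h0)]
  gcongr
  exact (norm_integral_le_integral_norm _).trans
    (setIntegral_le_integral hψ.norm (Filter.Eventually.of_forall fun _ => norm_nonneg _))

theorem norm_dyadicAvg_sub_le {ψ : ℝ → ℂ} (hψ : Integrable ψ) {Λ : ℝ} (hΛ : 0 ≤ Λ)
    (hL : ∀ x y, ‖ψ x - ψ y‖ ≤ Λ * |x - y|) (k : ℤ) (t : ℝ) :
    ‖dyadicAvg ψ k t - ψ t‖ ≤ Λ * 2 ^ k := by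
  have h0 := zpow_two_pos k
  set S := DyadicInterval.toSet ⟨k, ⌊t / 2 ^ k⌋⟩ with hS
  have ht := mem_toSet_floor k t
  have hvol : volume.real S = 2 ^ k := by
    rw [hS, DyadicInterval.toSet, Real.volume_real_Ico_of_le (by simp only []; nlinarith)]
    ring
  have hvt : volume S < ∞ := measure_Ico_lt_top
  have h1 : ψ t = (2 ^ k : ℝ)⁻¹ • ∫ _ in S, ψ t := by
    rw [setIntegral_const, hvol, smul_smul, inv_mul_cancel₀ h0.ne', one_smul]
  rw [dyadicAvg, ← hS]
  rw [h1]
  rw [← smul_sub, ← integral_sub hψ.integrableOn (integrableOn_const hvt.ne), norm_smul,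
    Real.norm_eq_abs, abs_of_pos (inv_pos.2 h0), inv_mul_le_iff₀ h0]
  have h2 : ∀ u ∈ S, ‖ψ u - ψ t‖ ≤ Λ * 2 ^ k := by
    intro u hu
    refine (hL u t).trans (mul_le_mul_of_nonneg_left ?_ hΛ)
    have a1 := hu.1
    have a2 := hu.2
    have a3 := ht.1
    have a4 := ht.2
    simp only [] at a1 a2 a3 a4
    rw [abs_le]
    constructor <;> linarith
  refine (norm_setIntegral_le_of_norm_le_const hvt h2).trans (le_of_eq ?_)
  rw [hvol, mul_comm]

theorem enorm_integral_le_tsum {F : ℝ → ℂ} (hF : Integrable F) (k : ℤ) :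
    ‖∫ t, F t‖ₑ ≤ ∑' j : ℤ, ‖∫ t in DyadicInterval.toSet ⟨k, j⟩, F t‖ₑ := by
  have h := hasSum_integral_iUnion (f := F) (μ := volume)
    (fun j : ℤ => DyadicInterval.measurableSet_toSet ⟨k, j⟩) (pairwise_disjoint_toSet k)
    (by rw [iUnion_toSet]; exact hF.integrableOn)
  rw [iUnion_toSet, setIntegral_univ] at h
  rw [← h.tsum_eq]
  exact enorm_tsum_le_tsum_enorm

/-- The difference of successive averages is constant on each half of the interval, with opposite
signs on the two halves: it is a multiple of the Haar function. -/
theorem setIntegral_mul_dyadicAvg_sub {ψ g : ℝ → ℂ} (hψ : Integrable ψ) (hg : Integrable g)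
    (k j : ℤ) :
    ∫ t in DyadicInterval.toSet ⟨k, j⟩, g t * (dyadicAvg ψ (k - 1) t - dyadicAvg ψ k t) =
      ((∫ t in DyadicInterval.toSet ⟨k - 1, 2 * j⟩, ψ t) -
        ∫ t in DyadicInterval.toSet ⟨k - 1, 2 * j + 1⟩, ψ t) * haarDiff g ⟨k, j⟩ := by
  have h0 := zpow_two_pos k
  have hch : DyadicInterval.toSet ⟨k, j⟩ = DyadicInterval.toSet ⟨k - 1, 2 * j⟩ ∪
      DyadicInterval.toSet ⟨k - 1, 2 * j + 1⟩ := by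
    have := toSet_eq_union_children (k - 1) j
    rwa [sub_add_cancel] at this
  set a := ∫ t in DyadicInterval.toSet ⟨k - 1, 2 * j⟩, ψ t with ha
  set b := ∫ t in DyadicInterval.toSet ⟨k - 1, 2 * j + 1⟩, ψ t with hb
  have hab : ∫ t in DyadicInterval.toSet ⟨k, j⟩, ψ t = a + b := by
    rw [hch, setIntegral_union (disjoint_children (k - 1) j)
      (DyadicInterval.measurableSet_toSet _) hψ.integrableOn hψ.integrableOn]
  have hk : ((2 : ℝ) ^ (k - 1))⁻¹ = 2 * (2 ^ k)⁻¹ := by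
    rw [zpow_sub_one₀ (by norm_num), mul_inv, inv_inv, mul_comm]
  have h1 : ∀ t ∈ DyadicInterval.toSet ⟨k - 1, 2 * j⟩,
      g t * (dyadicAvg ψ (k - 1) t - dyadicAvg ψ k t) = g t * ((2 ^ k : ℝ)⁻¹ • (a - b)) := by
    intro t ht
    have ht' : t ∈ DyadicInterval.toSet ⟨k, j⟩ := by rw [hch]; exact Or.inl ht
    rw [dyadicAvg, dyadicAvg, floor_eq_of_mem_toSet ht, floor_eq_of_mem_toSet ht', hab, ← ha, hk]
    simp only [Complex.real_smul]; push_cast; ring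
  have h2 : ∀ t ∈ DyadicInterval.toSet ⟨k - 1, 2 * j + 1⟩,
      g t * (dyadicAvg ψ (k - 1) t - dyadicAvg ψ k t) = g t * ((2 ^ k : ℝ)⁻¹ • (b - a)) := by
    intro t ht
    have ht' : t ∈ DyadicInterval.toSet ⟨k, j⟩ := by rw [hch]; exact Or.inr ht
    rw [dyadicAvg, dyadicAvg, floor_eq_of_mem_toSet ht, floor_eq_of_mem_toSet ht', hab, ← hb, hk]
    simp only [Complex.real_smul]; push_cast; ring
  have hm := fun i => DyadicInterval.measurableSet_toSet i
  have i1 : IntegrableOn (fun t => g t * (dyadicAvg ψ (k - 1) t - dyadicAvg ψ k t))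
      (DyadicInterval.toSet ⟨k - 1, 2 * j⟩) :=
    (integrableOn_congr_fun h1 (hm _)).2 (hg.integrableOn.mul_const _)
  have i2 : IntegrableOn (fun t => g t * (dyadicAvg ψ (k - 1) t - dyadicAvg ψ k t))
      (DyadicInterval.toSet ⟨k - 1, 2 * j + 1⟩) :=
    (integrableOn_congr_fun h2 (hm _)).2 (hg.integrableOn.mul_const _)
  rw [hch, setIntegral_union (disjoint_children (k - 1) j) (hm _) i1 i2,
    setIntegral_congr_fun (hm _) h1, setIntegral_congr_fun (hm _) h2, integral_mul_const,
    integral_mul_const, haarDiff]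
  simp only [Complex.real_smul, DyadicInterval.length]
  ring

/-- The pairing `P k` of `g` with the averages of `ψ` at scale `k` tends to `0` as `k → ∞`, because
these averages are at most `2⁻ᵏ ‖ψ‖₁`, and to `∫ g ψ` as `k → -∞`, because `ψ` is Lipschitz.
Telescoping between the two limits bounds the pairing for `g` merely integrable, without any
completeness of the Haar system. -/
theorem enorm_integral_mul_le_tsum_haarSize {ψ g : ℝ → ℂ} (hψ : Integrable ψ)
    {Λ : ℝ} (hΛ : 0 ≤ Λ) (hL : ∀ x y, ‖ψ x - ψ y‖ ≤ Λ * |x - y|)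
    (hg : Integrable g) (hψb : ∃ B, ∀ t, ‖ψ t‖ ≤ B) :
    ‖∫ t, g t * ψ t‖ₑ ≤ ∑' J, haarSize ψ J * ‖haarDiff g J‖ₑ := by
  have hψc : Continuous ψ := by
    have : LipschitzWith ⟨Λ, hΛ⟩ ψ := LipschitzWith.of_dist_le_mul fun x y => by
      rw [dist_eq_norm, Real.dist_eq]; exact hL x y
    exact this.continuous
  set P : ℤ → ℂ := fun k => ∫ t, g t * dyadicAvg ψ k t with hP
  have hiavg : ∀ k, Integrable fun t => g t * dyadicAvg ψ k t := fun k =>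
    hg.mul_bdd (measurable_dyadicAvg ψ k).aestronglyMeasurable
      (Filter.Eventually.of_forall (norm_dyadicAvg_le hψ k))
  have higψ : Integrable fun t => g t * ψ t := by
    obtain ⟨B, hB⟩ := hψb
    exact hg.mul_bdd hψc.aestronglyMeasurable (Filter.Eventually.of_forall hB)
  set G : ℤ → ℝ≥0∞ := fun k => ∑' j : ℤ, haarSize ψ ⟨k, j⟩ * ‖haarDiff g ⟨k, j⟩‖ₑ with hG
  have hstep : ∀ k, ‖P (k - 1) - P k‖ₑ ≤ G k := by
    intro k
    rw [hP, ← integral_sub (hiavg _) (hiavg _)]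
    simp only [← mul_sub]
    refine (enorm_integral_le_tsum ?_ k).trans ?_
    · simp only [mul_sub]; exact (hiavg _).sub (hiavg _)
    · refine ENNReal.tsum_le_tsum fun j => ?_
      rw [setIntegral_mul_dyadicAvg_sub hψ hg, enorm_mul, haarSize]
  have htel : ∀ (k : ℤ) (n : ℕ), ‖P (k - n)‖ₑ ≤ ∑ i ∈ Finset.range n, G (k - i) + ‖P k‖ₑ := by
    intro k n
    induction n with
    | zero => simp
    | succ n ih =>
      rw [Finset.sum_range_succ]
      have h2 : k - ((n + 1 : ℕ) : ℤ) = k - n - 1 := by push_cast; ring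
      rw [h2]
      calc ‖P (k - n - 1)‖ₑ = ‖(P (k - n - 1) - P (k - n)) + P (k - n)‖ₑ := by rw [sub_add_cancel]
        _ ≤ ‖P (k - n - 1) - P (k - n)‖ₑ + ‖P (k - n)‖ₑ := enorm_add_le _ _
        _ ≤ G (k - n) + (∑ i ∈ Finset.range n, G (k - i) + ‖P k‖ₑ) := add_le_add (hstep _) ih
        _ = _ := by ring
  have hGsum : ∀ (k : ℤ) (n : ℕ), ∑ i ∈ Finset.range n, G (k - i) ≤ ∑' k, G k := by
    intro k n
    refine (ENNReal.sum_le_tsum _).trans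
      (ENNReal.tsum_comp_le_tsum_of_injective (f := fun i : ℕ => k - (i : ℤ)) ?_ G)
    intro a b h; simp only at h; omega
  set A : ℝ := ∫ t, ‖g t‖ with hA
  have hA0 : 0 ≤ A := integral_nonneg fun _ => norm_nonneg _
  have hcoarse : ∀ k, ‖P k‖ ≤ (2 ^ k)⁻¹ * ((∫ u, ‖ψ u‖) * A) := by
    intro k
    calc ‖P k‖ ≤ ∫ t, ‖g t‖ * ((2 ^ k)⁻¹ * ∫ u, ‖ψ u‖) := by
          refine norm_integral_le_of_norm_le (hg.norm.mul_const _)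
            (Filter.Eventually.of_forall fun t => ?_)
          rw [norm_mul]
          gcongr
          exact norm_dyadicAvg_le hψ k t
      _ = _ := by rw [integral_mul_const]; ring
  have hfine : ∀ k, ‖(∫ t, g t * ψ t) - P k‖ ≤ 2 ^ k * (Λ * A) := by
    intro k
    rw [hP, ← integral_sub higψ (hiavg _)]
    calc _ ≤ ∫ t, ‖g t‖ * (Λ * 2 ^ k) := by
          refine norm_integral_le_of_norm_le (hg.norm.mul_const _)
            (Filter.Eventually.of_forall fun t => ?_)
          rw [← mul_sub, norm_mul, norm_sub_rev]
          gcongr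
          exact norm_dyadicAvg_sub_le hψ hΛ hL k t
      _ = _ := by rw [integral_mul_const]; ring
  -- Telescoping from scale `n` down to scale `-n`; both end terms are of size `2⁻ⁿ`.
  have hmain : ∀ n : ℕ, ‖∫ t, g t * ψ t‖ₑ ≤
      ENNReal.ofReal ((1 / 2) ^ n * (Λ * A)) + (∑' k, G k +
        ENNReal.ofReal ((1 / 2) ^ n * ((∫ u, ‖ψ u‖) * A))) := by
    intro n
    have hpow : (2 : ℝ) ^ (-(n : ℤ)) = (1 / 2) ^ n := by
      rw [zpow_neg, zpow_natCast, one_div, inv_pow]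
    have hpow' : ((2 : ℝ) ^ (n : ℤ))⁻¹ = (1 / 2) ^ n := by
      rw [zpow_natCast, one_div, inv_pow]
    have h1 := htel n (2 * n)
    have h2 : (n : ℤ) - ((2 * n : ℕ) : ℤ) = -n := by push_cast; ring
    rw [h2] at h1
    calc ‖∫ t, g t * ψ t‖ₑ = ‖((∫ t, g t * ψ t) - P (-n)) + P (-n)‖ₑ := by rw [sub_add_cancel]
      _ ≤ ‖(∫ t, g t * ψ t) - P (-n)‖ₑ + ‖P (-n)‖ₑ := enorm_add_le _ _
      _ ≤ _ := by
          refine add_le_add ?_ (h1.trans (add_le_add (hGsum _ _) ?_))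
          · rw [← ofReal_norm]
            refine ENNReal.ofReal_le_ofReal ((hfine _).trans_eq ?_)
            rw [hpow]
          · rw [← ofReal_norm]
            refine ENNReal.ofReal_le_ofReal ((hcoarse _).trans_eq ?_)
            rw [hpow']
  rw [tsum_dyadic]
  have hlim : ∀ c : ℝ, Filter.Tendsto (fun n : ℕ => ENNReal.ofReal ((1 / 2) ^ n * c))
      Filter.atTop (nhds 0) := by
    intro c
    rw [← ENNReal.ofReal_zero]
    refine ENNReal.tendsto_ofReal ?_
    rw [← zero_mul c]
    exact (tendsto_pow_atTop_nhds_zero_of_lt_one (by norm_num) (by norm_num)).mul_const c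
  have hT := (hlim (Λ * A)).add ((tendsto_const_nhds (x := ∑' k, G k)).add
    (hlim ((∫ u, ‖ψ u‖) * A)))
  rw [zero_add, add_zero] at hT
  exact ge_of_tendsto' hT hmain

theorem IsBump.enorm_integral_mul_le {K : ℝ} {I : DyadicInterval} {ψ : ℝ → ℂ} (h : IsBump K I ψ)
    {g : ℝ → ℂ} (hg : Integrable g) :
    ‖∫ t, g t * ψ t‖ₑ ≤ ∑' J, haarSize ψ J * ‖haarDiff g J‖ₑ := by
  have hl : 0 < I.length := zpow_two_pos _
  have hK := h.nonneg
  have htail : ∀ x, ((1 + |x - I.center| / I.length) ^ 6)⁻¹ ≤ 1 := fun x => by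
    refine inv_le_one_of_one_le₀ (one_le_pow₀ ?_)
    have : 0 ≤ |x - I.center| / I.length := by positivity
    linarith
  refine enorm_integral_mul_le_tsum_haarSize h.integrable (Λ := K * (I.length ^ 2)⁻¹)
    (by positivity) ?_ hg ⟨K * I.length⁻¹, fun t => (h.norm_le t).trans
      (mul_le_of_le_one_right (by positivity) (htail t))⟩
  intro x y
  rw [← Real.norm_eq_abs]
  exact Convex.norm_image_sub_le_of_norm_deriv_le (𝕜 := ℝ) (s := Set.univ)
    (fun x _ => h.differentiable x) (fun x _ => (h.norm_deriv_le x).trans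
      (mul_le_of_le_one_right (by positivity) (htail x))) convex_univ trivial trivial

/-! ### Integration over the first coordinate -/

theorem measurePreserving_cons (d : ℕ) :
    MeasurePreserving (fun p : ℝ × (Fin d → ℝ) => (Fin.cons p.1 p.2 : Fin (d + 1) → ℝ)) := by
  have h := (volume_preserving_piFinSuccAbove (fun _ : Fin (d + 1) => ℝ) 0).symm
  convert h using 1
  exact funext fun p => (Fin.insertNth_zero' p.1 p.2).symm

theorem measurableEmbedding_cons (d : ℕ) :
    MeasurableEmbedding (fun p : ℝ × (Fin d → ℝ) => (Fin.cons p.1 p.2 : Fin (d + 1) → ℝ)) := by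
  have h := (MeasurableEquiv.piFinSuccAbove (fun _ : Fin (d + 1) => ℝ) 0).symm.measurableEmbedding
  convert h using 1
  exact funext fun p => (Fin.insertNth_zero' p.1 p.2).symm

theorem measurable_cons (d : ℕ) :
    Measurable (fun p : ℝ × (Fin d → ℝ) => (Fin.cons p.1 p.2 : Fin (d + 1) → ℝ)) :=
  (measurableEmbedding_cons d).measurable

theorem measurable_tail (d : ℕ) : Measurable (fun x : Fin (d + 1) → ℝ => Fin.tail x) :=
  measurable_pi_lambda _ fun j => measurable_pi_apply j.succ

theorem lintegral_cons {d : ℕ} {F : (Fin (d + 1) → ℝ) → ℝ≥0∞} (hF : Measurable F) :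
    ∫⁻ x, F x = ∫⁻ t : ℝ, ∫⁻ x : Fin d → ℝ, F (Fin.cons t x) := by
  rw [← (measurePreserving_cons d).lintegral_comp hF]
  exact lintegral_prod _ (hF.comp (measurable_cons d)).aemeasurable

theorem lintegral_cons_symm {d : ℕ} {F : (Fin (d + 1) → ℝ) → ℝ≥0∞} (hF : Measurable F) :
    ∫⁻ x, F x = ∫⁻ x : Fin d → ℝ, ∫⁻ t : ℝ, F (Fin.cons t x) := by
  rw [← (measurePreserving_cons d).lintegral_comp hF]
  exact lintegral_prod_symm _ (hF.comp (measurable_cons d)).aemeasurable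

theorem integral_cons {d : ℕ} {F : (Fin (d + 1) → ℝ) → ℂ} (hF : Integrable F) :
    ∫ x, F x = ∫ t : ℝ, ∫ x : Fin d → ℝ, F (Fin.cons t x) := by
  rw [← (measurePreserving_cons d).integral_comp (measurableEmbedding_cons d)]
  exact integral_prod _ ((measurePreserving_cons d).integrable_comp_of_integrable hF)

/-! ### Bounded functions of compact support -/

/-- Bounded measurable functions that vanish outside a cube. -/
structure IsNice {d : ℕ} (f : (Fin d → ℝ) → ℂ) : Prop where
  measurable : Measurable f
  bounded : ∃ B : ℝ, 0 ≤ B ∧ ∀ x, ‖f x‖ ≤ B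
  support : ∃ r : ℝ, ∀ x, f x ≠ 0 → ∀ j, |x j| ≤ r

namespace IsNice

variable {d : ℕ}

theorem integrable {f : (Fin d → ℝ) → ℂ} (hf : IsNice f) : Integrable f := by
  obtain ⟨B, hB0, hB⟩ := hf.bounded
  obtain ⟨r, hr⟩ := hf.support
  have hsupp : Function.support f ⊆ Set.Icc (fun _ => -r) fun _ => r := by
    intro x hx
    exact ⟨fun j => (abs_le.1 (hr x hx j)).1, fun j => (abs_le.1 (hr x hx j)).2⟩
  rw [← integrableOn_iff_integrable_of_support_subset hsupp]
  exact Measure.integrableOn_of_bounded (M := B) isCompact_Icc.measure_lt_top.ne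
    hf.measurable.aestronglyMeasurable (Filter.Eventually.of_forall hB)

variable {f : (Fin (d + 1) → ℝ) → ℂ}

theorem slice (hf : IsNice f) (t : ℝ) : IsNice fun x : Fin d → ℝ => f (Fin.cons t x) where
  measurable := hf.measurable.comp ((measurable_cons d).comp measurable_prodMk_left)
  bounded := by
    obtain ⟨B, hB0, hB⟩ := hf.bounded
    exact ⟨B, hB0, fun x => hB _⟩
  support := by
    obtain ⟨r, hr⟩ := hf.support
    exact ⟨r, fun x hx j => by simpa using hr _ hx j.succ⟩

theorem integrable_fiber (hf : IsNice f) (x : Fin d → ℝ) :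
    Integrable fun t : ℝ => f (Fin.cons t x) := by
  obtain ⟨B, hB0, hB⟩ := hf.bounded
  obtain ⟨r, hr⟩ := hf.support
  have hsupp : (Function.support fun t : ℝ => f (Fin.cons t x)) ⊆ Set.Icc (-r) r := by
    intro t ht
    have := hr _ ht 0
    simp only [Fin.cons_zero] at this
    exact abs_le.1 this
  rw [← integrableOn_iff_integrable_of_support_subset hsupp]
  exact Measure.integrableOn_of_bounded (M := B) isCompact_Icc.measure_lt_top.ne
    (hf.measurable.comp ((measurable_cons d).comp measurable_prodMk_right)).aestronglyMeasurable
    (Filter.Eventually.of_forall fun t => hB _)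

end IsNice

theorem measurable_haarDiff_of_uncurry {α : Type*} [MeasurableSpace α] {F : α → ℝ → ℂ}
    (hF : Measurable (Function.uncurry F)) (J : DyadicInterval) :
    Measurable fun a => haarDiff (F a) J := by
  have h : ∀ S : Set ℝ, Measurable fun a => ∫ t in S, F a t := fun S =>
    (hF.stronglyMeasurable.integral_prod_right (ν := volume.restrict S)).measurable
  exact ((h _).sub (h _)).const_smul _

theorem IsNice.haar {d : ℕ} {f : (Fin (d + 1) → ℝ) → ℂ} (hf : IsNice f) (J : DyadicInterval) :
    IsNice fun x : Fin d → ℝ => haarDiff (fun t => f (Fin.cons t x)) J where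
  measurable := by
    refine measurable_haarDiff_of_uncurry (F := fun (x : Fin d → ℝ) t => f (Fin.cons t x)) ?_ J
    exact hf.measurable.comp ((measurable_cons d).comp measurable_swap)
  bounded := by
    obtain ⟨B, hB0, hB⟩ := hf.bounded
    have hl : 0 < J.length := zpow_two_pos _
    refine ⟨J.length⁻¹ * (B * volume.real (DyadicInterval.toSet ⟨J.scale - 1, 2 * J.pos⟩) +
      B * volume.real (DyadicInterval.toSet ⟨J.scale - 1, 2 * J.pos + 1⟩)), by positivity,
      fun x => ?_⟩
    have h : ∀ I : DyadicInterval, ‖∫ t in I.toSet, f (Fin.cons t x)‖ ≤ B * volume.real I.toSet :=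
      fun I => norm_setIntegral_le_of_norm_le_const measure_Ico_lt_top fun t _ => hB _
    rw [haarDiff, norm_smul, Real.norm_eq_abs, abs_of_pos (inv_pos.2 hl)]
    gcongr
    exact (norm_sub_le _ _).trans (add_le_add (h _) (h _))
  support := by
    obtain ⟨r, hr⟩ := hf.support
    refine ⟨r, fun x hx j => ?_⟩
    by_contra hj
    refine hx ?_
    have h0 : ∀ t : ℝ, f (Fin.cons t x) = 0 := fun t => by
      by_contra ht
      exact hj (by simpa using hr _ ht j.succ)
    simp [haarDiff, h0]

/-! ### The majorant of the coefficients -/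

/-- The array that dominates the coefficients `⟨f, φ_R⟩ |R|^{-1/2} 1_R(x)` for all admissible
choices of `φ_R`. -/
noncomputable def majorant : {d : ℕ} → (Fin d → OpKind) → ((Fin d → ℝ) → ℂ) → (Fin d → ℝ) →
    (Fin d → DyadicInterval) → ℝ≥0∞
  | 0, _, f, x, _ => ‖f x‖ₑ
  | d + 1, σ, f, x, R =>
    match σ 0 with
    | .square => (R 0).toSet.indicator (fun _ => almostDiag (fun J =>
        majorant (d := d) (Fin.tail σ) (fun x' => haarDiff (fun t => f (Fin.cons t x')) J)
          (Fin.tail x) (Fin.tail R)) (R 0)) (x 0)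
    | .maximal => maxFn volume (fun t =>
        majorant (d := d) (Fin.tail σ) (fun x' => f (Fin.cons t x')) (Fin.tail x) (Fin.tail R)) (x 0)

theorem majorant_square {d : ℕ} {σ : Fin (d + 1) → OpKind} (h : σ 0 = .square)
    (f : (Fin (d + 1) → ℝ) → ℂ) (x : Fin (d + 1) → ℝ) (R : Fin (d + 1) → DyadicInterval) :
    majorant σ f x R = (R 0).toSet.indicator (fun _ => almostDiag (fun J =>
        majorant (Fin.tail σ) (fun x' => haarDiff (fun t => f (Fin.cons t x')) J)
          (Fin.tail x) (Fin.tail R)) (R 0)) (x 0) := by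
  rw [majorant, h]

theorem majorant_maximal {d : ℕ} {σ : Fin (d + 1) → OpKind} (h : σ 0 = .maximal)
    (f : (Fin (d + 1) → ℝ) → ℂ) (x : Fin (d + 1) → ℝ) (R : Fin (d + 1) → DyadicInterval) :
    majorant σ f x R = maxFn volume (fun t =>
        majorant (Fin.tail σ) (fun x' => f (Fin.cons t x')) (Fin.tail x) (Fin.tail R)) (x 0) := by
  rw [majorant, h]

theorem measurable_almostDiag {α : Type*} [MeasurableSpace α] {u : α → DyadicInterval → ℝ≥0∞}
    (hu : ∀ J, Measurable fun a => u a J) (I : DyadicInterval) :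
    Measurable fun a => almostDiag (u a) I := by
  unfold almostDiag
  refine Measurable.add ?_ ?_
  · exact Measurable.tsum fun m => Measurable.tsum fun j => (hu _).const_mul _
  · exact Finset.measurable_fun_sum _ fun q _ => Measurable.tsum fun m =>
      Measurable.tsum fun j => (hu _).const_mul _

theorem measurable_maxFn_comp {α : Type*} [MeasurableSpace α] {h : α → ℝ → ℝ≥0∞}
    (hh : Measurable (Function.uncurry h)) {b : α → ℝ} (hb : Measurable b) :
    Measurable fun a => maxFn volume (h a) (b a) := by
  unfold maxFn
  refine Measurable.iSup fun q => ?_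
  have h1 : Measurable fun a => (∫⁻ t in Set.Ico (q.1 : ℝ) q.2, h a t) /
      volume (Set.Ico (q.1 : ℝ) q.2) :=
    (hh.lintegral_prod_right' (ν := volume.restrict (Set.Ico (q.1 : ℝ) q.2))).div_const _
  have h2 : (fun a => (Set.Ico (q.1 : ℝ) q.2).indicator (fun _ =>
      (∫⁻ t in Set.Ico (q.1 : ℝ) q.2, h a t) / volume (Set.Ico (q.1 : ℝ) q.2)) (b a)) =
      (b ⁻¹' Set.Ico (q.1 : ℝ) q.2).indicator fun a =>
        (∫⁻ t in Set.Ico (q.1 : ℝ) q.2, h a t) / volume (Set.Ico (q.1 : ℝ) q.2) := by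
    ext a; simp [Set.indicator]
  rw [h2]
  exact h1.indicator (hb measurableSet_Ico)

/-- The parameter space is there for the induction: in a maximal coordinate the variable of the
slice has to be adjoined to it, since the maximal function integrates over that variable. -/
theorem measurable_majorant_uncurry {d : ℕ} (σ : Fin d → OpKind) (R : Fin d → DyadicInterval) :
    ∀ {α : Type} [MeasurableSpace α] (F : α → (Fin d → ℝ) → ℂ),
      Measurable (fun p : α × (Fin d → ℝ) => F p.1 p.2) →
      Measurable fun p : α × (Fin d → ℝ) => majorant σ (F p.1) p.2 R := by
  induction d with
  | zero => intro α _ F hF; simp only [majorant]; exact hF.enorm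
  | succ d ih =>
    intro α _ F hF
    have htail : Measurable fun p : α × (Fin (d + 1) → ℝ) => (p.1, Fin.tail p.2) :=
      measurable_fst.prodMk ((measurable_tail d).comp measurable_snd)
    have hx0 : Measurable fun p : α × (Fin (d + 1) → ℝ) => p.2 0 :=
      (measurable_pi_apply 0).comp measurable_snd
    cases h : σ 0 with
    | square =>
      simp only [majorant_square h]
      have h1 : ∀ J, Measurable fun p : α × (Fin d → ℝ) =>
          majorant (Fin.tail σ) (fun x' => haarDiff (fun t => F p.1 (Fin.cons t x')) J) p.2
            (Fin.tail R) := by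
        intro J
        refine ih (Fin.tail σ) (Fin.tail R)
          (fun a x' => haarDiff (fun t => F a (Fin.cons t x')) J) ?_
        refine measurable_haarDiff_of_uncurry
          (F := fun (p : α × (Fin d → ℝ)) t => F p.1 (Fin.cons t p.2)) ?_ J
        exact hF.comp ((measurable_fst.comp measurable_fst).prodMk ((measurable_cons d).comp
          (measurable_snd.prodMk (measurable_snd.comp measurable_fst))))
      have h2 := measurable_almostDiag (fun J => (h1 J).comp htail) (R 0)
      have h3 := h2.indicator (hx0 (R 0).measurableSet_toSet)
      exact h3
    | maximal =>
      simp only [majorant_maximal h]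
      have h1 : Measurable fun p : (α × ℝ) × (Fin d → ℝ) =>
          majorant (Fin.tail σ) (fun x' => F p.1.1 (Fin.cons p.1.2 x')) p.2 (Fin.tail R) := by
        refine ih (Fin.tail σ) (Fin.tail R) (fun (a : α × ℝ) x' => F a.1 (Fin.cons a.2 x')) ?_
        exact hF.comp ((measurable_fst.comp measurable_fst).prodMk ((measurable_cons d).comp
          ((measurable_snd.comp measurable_fst).prodMk measurable_snd)))
      refine measurable_maxFn_comp (h := fun (p : α × (Fin (d + 1) → ℝ)) t =>
        majorant (Fin.tail σ) (fun x' => F p.1 (Fin.cons t x')) (Fin.tail p.2) (Fin.tail R)) ?_ hx0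
      exact h1.comp (((measurable_fst.comp measurable_fst).prodMk measurable_snd).prodMk
        ((measurable_tail d).comp (measurable_snd.comp measurable_fst)))

theorem measurable_majorant {d : ℕ} (σ : Fin d → OpKind) (R : Fin d → DyadicInterval)
    {f : (Fin d → ℝ) → ℂ} (hf : Measurable f) : Measurable fun x => majorant σ f x R :=
  (measurable_majorant_uncurry σ R (fun (_ : Unit) => f) (hf.comp measurable_snd)).comp
    (measurable_prodMk_left (x := ()))

/-! ### Pairings with products of bump functions -/

theorem bump_prod_bounded {d : ℕ} {K : ℝ} {R : Fin d → DyadicInterval} {ψ : Fin d → ℝ → ℂ}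
    (hψ : ∀ j, IsBump K (R j) (ψ j)) :
    Continuous (fun y : Fin d → ℝ => ∏ j, ψ j (y j)) ∧
      ∃ B : ℝ, ∀ y : Fin d → ℝ, ‖∏ j, ψ j (y j)‖ ≤ B := by
  refine ⟨continuous_finsetProd _ fun j _ => (hψ j).differentiable.continuous.comp
    (continuous_apply j), ∏ j, K * (R j).length⁻¹, fun y => ?_⟩
  rw [norm_prod]
  refine Finset.prod_le_prod (fun _ _ => norm_nonneg _) fun j _ => ?_
  have hl : 0 < (R j).length := zpow_two_pos _
  have hK := (hψ j).nonneg
  refine ((hψ j).norm_le _).trans (mul_le_of_le_one_right (by positivity) ?_)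
  refine inv_le_one_of_one_le₀ (one_le_pow₀ ?_)
  have : 0 ≤ |y j - (R j).center| / (R j).length := by positivity
  linarith

/-- The pairing is `∫ g ψ₀`, where `g(t)` pairs the slice of `f` at `t` with the remaining factors.
In a maximal coordinate the induction hypothesis bounds `g` pointwise and the integral against the
bump is at most a maximal function. In a square coordinate `∫ g ψ₀` is expanded in Haar functions,
and the induction hypothesis applies to the Haar differences of `f`. -/
theorem enorm_integral_mul_prod_le {d : ℕ} {K : ℝ} (σ : Fin d → OpKind) {f : (Fin d → ℝ) → ℂ}
    (hf : IsNice f) (R : Fin d → DyadicInterval) (ψ : Fin d → ℝ → ℂ)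
    (hψ : ∀ j, IsBump K (R j) (ψ j)) (hz : ∀ j, σ j = .square → ∫ t, ψ j t = 0)
    (x : Fin d → ℝ) (hx : ∀ j, x j ∈ (R j).toSet) :
    ‖∫ y, f y * ∏ j, ψ j (y j)‖ₑ ≤ bumpConst K ^ d * majorant σ f x R := by
  induction d with
  | zero =>
    have h1 : ∀ y : Fin 0 → ℝ, f y * ∏ j, ψ j (y j) = f x := fun y => by
      rw [Subsingleton.elim y x]; simp
    have h2 : ∫ _ : Fin 0 → ℝ, f x = f x := by
      rw [integral_const]; simp [Measure.real, volume_pi]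
    simp only [h1, h2, majorant]; simp
  | succ d ih =>
    obtain ⟨hφc, B, hφB⟩ := bump_prod_bounded (R := Fin.tail R) (ψ := Fin.tail ψ)
      (fun j => hψ j.succ)
    obtain ⟨hφc1, B1, hφB1⟩ := bump_prod_bounded hψ
    set φ : (Fin d → ℝ) → ℂ := fun y => ∏ j, Fin.tail ψ j (y j) with hφ
    have hint : Integrable fun y : Fin (d + 1) → ℝ => f y * ∏ j, ψ j (y j) :=
      hf.integrable.mul_bdd hφc1.aestronglyMeasurable (Filter.Eventually.of_forall hφB1)
    have hfp : Integrable fun p : ℝ × (Fin d → ℝ) => f (Fin.cons p.1 p.2) * φ p.2 :=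
      ((measurePreserving_cons d).integrable_comp_of_integrable hf.integrable).mul_bdd
        (hφc.comp continuous_snd).aestronglyMeasurable (Filter.Eventually.of_forall fun p => hφB _)
    set g : ℝ → ℂ := fun t => ∫ y : Fin d → ℝ, f (Fin.cons t y) * φ y with hg
    have hgi : Integrable g := hfp.integral_prod_left
    have hsplit : ∫ y, f y * ∏ j, ψ j (y j) = ∫ t, g t * ψ 0 t := by
      rw [integral_cons hint]
      refine integral_congr_ae (Filter.Eventually.of_forall fun t => ?_)
      simp only [hg]
      rw [← integral_mul_const]
      refine integral_congr_ae (Filter.Eventually.of_forall fun y => ?_)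
      simp only [Fin.prod_univ_succ, Fin.cons_zero, Fin.cons_succ, hφ, Fin.tail]
      ring
    rw [hsplit]
    set b := bumpConst K with hb
    have hbt : b ≠ ∞ := bumpConst_ne_top K
    have hx' : ∀ j, Fin.tail x j ∈ (Fin.tail R j).toSet := fun j => hx j.succ
    have hz' : ∀ j, Fin.tail σ j = .square → ∫ t, Fin.tail ψ j t = 0 := fun j => hz j.succ
    have hψ' : ∀ j, IsBump K (Fin.tail R j) (Fin.tail ψ j) := fun j => hψ j.succ
    cases h : σ 0 with
    | square =>
      rw [majorant_square h, Set.indicator_of_mem (hx 0)]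
      -- By Fubini, Haar differences in the first variable commute with the pairing in the others.
      have hhaar : ∀ J, haarDiff g J =
          ∫ y : Fin d → ℝ, haarDiff (fun t => f (Fin.cons t y)) J * φ y := by
        intro J
        have hsw : ∀ S : Set ℝ, ∫ t in S, g t =
            ∫ y : Fin d → ℝ, (∫ t in S, f (Fin.cons t y)) * φ y := by
          intro S
          have hfS : Integrable (fun p : ℝ × (Fin d → ℝ) => f (Fin.cons p.1 p.2) * φ p.2)
              ((volume.restrict S).prod volume) := by
            refine hfp.mono_measure ?_
            exact Measure.prod_mono Measure.restrict_le_self le_rfl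
          rw [hg, integral_integral_swap hfS]
          simp only [integral_mul_const]
        have hi : ∀ S : Set ℝ, Integrable fun y : Fin d → ℝ =>
            (∫ t in S, f (Fin.cons t y)) * φ y := by
          intro S
          have hfS : Integrable (fun p : ℝ × (Fin d → ℝ) => f (Fin.cons p.1 p.2) * φ p.2)
              ((volume.restrict S).prod volume) :=
            hfp.mono_measure (Measure.prod_mono Measure.restrict_le_self le_rfl)
          have := hfS.integral_prod_right
          simpa only [integral_mul_const] using this
        rw [haarDiff, hsw, hsw, ← integral_sub (hi _) (hi _), ← integral_smul]
        refine integral_congr_ae (Filter.Eventually.of_forall fun y => ?_)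
        simp only [haarDiff, ← sub_mul, smul_mul_assoc]
      refine ((hψ 0).enorm_integral_mul_le hgi).trans ?_
      have hIH : ∀ J, ‖haarDiff g J‖ₑ ≤ b ^ d * majorant (Fin.tail σ)
          (fun x' => haarDiff (fun t => f (Fin.cons t x')) J) (Fin.tail x) (Fin.tail R) := by
        intro J
        rw [hhaar]
        exact ih (Fin.tail σ) (hf.haar J) (Fin.tail R) (Fin.tail ψ) hψ' hz' (Fin.tail x) hx'
      calc ∑' J, haarSize (ψ 0) J * ‖haarDiff g J‖ₑ
          ≤ ∑' J, b ^ d * (haarSize (ψ 0) J * majorant (Fin.tail σ)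
              (fun x' => haarDiff (fun t => f (Fin.cons t x')) J) (Fin.tail x) (Fin.tail R)) := by
            refine ENNReal.tsum_le_tsum fun J => ?_
            rw [mul_left_comm]
            gcongr
            exact hIH J
        _ ≤ b ^ d * (b * almostDiag (fun J => majorant (Fin.tail σ)
              (fun x' => haarDiff (fun t => f (Fin.cons t x')) J) (Fin.tail x) (Fin.tail R))
                (R 0)) := by
            rw [ENNReal.tsum_mul_left]
            gcongr
            exact (hψ 0).tsum_haarSize_mul_le (hz 0 h) _
        _ = _ := by rw [pow_succ, mul_assoc]
    | maximal =>
      rw [majorant_maximal h]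
      calc ‖∫ t, g t * ψ 0 t‖ₑ ≤ ∫⁻ t, ‖g t * ψ 0 t‖ₑ := enorm_integral_le_lintegral_enorm _
        _ ≤ ∫⁻ t, b ^ d * (‖ψ 0 t‖ₑ * majorant (Fin.tail σ) (fun x' => f (Fin.cons t x'))
              (Fin.tail x) (Fin.tail R)) := by
            refine lintegral_mono fun t => ?_
            rw [enorm_mul, mul_comm, mul_left_comm]
            gcongr
            exact ih (Fin.tail σ) (hf.slice t) (Fin.tail R) (Fin.tail ψ) hψ' hz' (Fin.tail x) hx'
        _ = b ^ d * ∫⁻ t, ‖ψ 0 t‖ₑ * majorant (Fin.tail σ) (fun x' => f (Fin.cons t x'))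
              (Fin.tail x) (Fin.tail R) := lintegral_const_mul' _ _ (by finiteness)
        _ ≤ b ^ d * (b * maxFn volume (fun t => majorant (Fin.tail σ)
              (fun x' => f (Fin.cons t x')) (Fin.tail x) (Fin.tail R)) (x 0)) := by
            gcongr
            refine ((hψ 0).lintegral_enorm_mul_le _ (hx 0)).trans ?_
            gcongr
            rw [hb, bumpConst]
            gcongr
            rw [two_mul, ← add_assoc]
            exact le_add_self
        _ = _ := by rw [pow_succ, mul_assoc]

/-! ### The weighted estimate for the majorant -/

/-- Weights on `ℝ^d` that are uniformly `A₂` on all lines parallel to the coordinate axes. -/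
structure IsLineA2 {d : ℕ} (Q : ℝ≥0∞) (w : (Fin d → ℝ) → ℝ≥0∞) : Prop where
  measurable : Measurable w
  line : ∀ (j : Fin d) (x : Fin d → ℝ), IsA2 Q fun t => w (Function.update x j t)

namespace IsLineA2

variable {d : ℕ} {Q : ℝ≥0∞} {w : (Fin (d + 1) → ℝ) → ℝ≥0∞}

theorem slice (hw : IsLineA2 Q w) (t : ℝ) : IsLineA2 Q fun x : Fin d → ℝ => w (Fin.cons t x) where
  measurable := hw.measurable.comp ((measurable_cons d).comp measurable_prodMk_left)
  line j x := by
    simp only [Fin.cons_update]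
    exact hw.line j.succ (Fin.cons t x)

theorem fiber (hw : IsLineA2 Q w) (x : Fin d → ℝ) : IsA2 Q fun t => w (Fin.cons t x) := by
  have := hw.line 0 (Fin.cons 0 x)
  simpa only [Fin.update_cons_zero] using this

end IsLineA2

open Classical in
/-- Selects the rectangles whose sides in the coordinates of maximal type are a fixed interval. -/
noncomputable def normalized {d : ℕ} (σ : Fin d → OpKind) (R : Fin d → DyadicInterval) : ℝ≥0∞ :=
  if ∀ j, σ j = .maximal → R j = ⟨0, 0⟩ then 1 else 0

theorem normalized_cons_square {d : ℕ} {σ : Fin (d + 1) → OpKind} (h : σ 0 = .square)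
    (I : DyadicInterval) (R : Fin d → DyadicInterval) :
    normalized σ (Fin.cons I R : Fin (d + 1) → DyadicInterval) = normalized (Fin.tail σ) R := by
  unfold normalized
  congr 1
  rw [Fin.forall_fin_succ]
  simp [h, Fin.tail]

open Classical in
theorem normalized_cons_maximal {d : ℕ} {σ : Fin (d + 1) → OpKind} (h : σ 0 = .maximal)
    (I : DyadicInterval) (R : Fin d → DyadicInterval) :
    normalized σ (Fin.cons I R : Fin (d + 1) → DyadicInterval) =
      (if I = ⟨0, 0⟩ then 1 else 0) * normalized (Fin.tail σ) R := by
  have hiff : (∀ j, σ j = .maximal → (Fin.cons I R : Fin (d + 1) → DyadicInterval) j = ⟨0, 0⟩) ↔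
      I = ⟨0, 0⟩ ∧ ∀ j, Fin.tail σ j = .maximal → R j = ⟨0, 0⟩ := by
    rw [Fin.forall_fin_succ]
    simp [h, Fin.tail]
  simp only [normalized, hiff]
  by_cases h1 : I = ⟨0, 0⟩ <;> simp [h1]

theorem tsum_fin_cons {d : ℕ} (g : (Fin (d + 1) → DyadicInterval) → ℝ≥0∞) :
    ∑' R, g R = ∑' (R' : Fin d → DyadicInterval) (I : DyadicInterval), g (Fin.cons I R') := by
  rw [← (Fin.consEquiv fun _ : Fin (d + 1) => DyadicInterval).tsum_eq, ENNReal.tsum_prod',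
    ENNReal.tsum_comm]
  rfl

/-- The sum of the squares of the majorants over all normalized rectangles. -/
noncomputable def energy {d : ℕ} (σ : Fin d → OpKind) (f : (Fin d → ℝ) → ℂ) (x : Fin d → ℝ) :
    ℝ≥0∞ :=
  ∑' R, normalized σ R * majorant σ f x R ^ 2

theorem measurable_energy_uncurry {d : ℕ} (σ : Fin d → OpKind) {α : Type} [MeasurableSpace α]
    (F : α → (Fin d → ℝ) → ℂ) (hF : Measurable (fun p : α × (Fin d → ℝ) => F p.1 p.2)) :
    Measurable fun p : α × (Fin d → ℝ) => energy σ (F p.1) p.2 :=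
  Measurable.tsum fun R => ((measurable_majorant_uncurry σ R F hF).pow_const 2).const_mul _

theorem measurable_energy {d : ℕ} (σ : Fin d → OpKind) {f : (Fin d → ℝ) → ℂ} (hf : Measurable f) :
    Measurable (energy σ f) :=
  Measurable.tsum fun R => ((measurable_majorant σ R hf).pow_const 2).const_mul _

/-- One coordinate is removed at a time. In a maximal coordinate the weighted maximal theorem is
used on lines, then the induction hypothesis on slices. In a square coordinate integration along
lines turns the indicators into masses, the almost diagonal operator is removed in `ℓ²(w(I))`, the
induction hypothesis is applied to the Haar differences `fJ J`, and the weighted Haar estimate on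
lines reassembles `f`. -/
theorem exists_lintegral_energy_mul_le (d : ℕ) {Q : ℝ≥0∞} (hQ : Q ≠ ∞) :
    ∃ C : ℝ≥0∞, C ≠ ∞ ∧ ∀ (σ : Fin d → OpKind) (w : (Fin d → ℝ) → ℝ≥0∞), IsLineA2 Q w →
      ∀ f : (Fin d → ℝ) → ℂ, IsNice f →
        ∫⁻ x, energy σ f x * w x ≤ C * ∫⁻ x, ‖f x‖ₑ ^ 2 * w x := by
  obtain ⟨CS, hCS, hS⟩ := exists_tsum_mass_mul_sq_almostDiag_le hQ
  obtain ⟨CM, hCM, hM⟩ := exists_lintegral_maxFn_sq_mul_le hQ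
  set CH : ℝ≥0∞ := 2 * (Q + 8 * Q ^ 2) with hCH
  have hCHt : CH ≠ ∞ := by finiteness
  induction d with
  | zero =>
    refine ⟨1, by simp, fun σ w hw f hf => ?_⟩
    rw [one_mul]
    refine lintegral_mono fun x => ?_
    gcongr
    rw [energy, tsum_eq_single (fun j => j.elim0) fun R hR => absurd (Subsingleton.elim _ _) hR]
    simp [normalized, majorant]
  | succ d ih =>
    obtain ⟨C, hC, hI⟩ := ih
    refine ⟨CS * C * CH + CM * C, by finiteness, fun σ w hw f hf => ?_⟩
    have hfm := hf.measurable
    have hcm := measurable_cons d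
    have hwm := hw.measurable
    have hwc : Measurable fun p : ℝ × (Fin d → ℝ) => w (Fin.cons p.1 p.2) := hwm.comp hcm
    have hFm : Measurable fun x => energy σ f x * w x := (measurable_energy σ hfm).mul hwm
    have hRm : Measurable fun x => ‖f x‖ₑ ^ 2 * w x := (hfm.enorm.pow_const 2).mul hwm
    have hRm' : Measurable fun p : ℝ × (Fin d → ℝ) =>
        ‖f (Fin.cons p.1 p.2)‖ₑ ^ 2 * w (Fin.cons p.1 p.2) := hRm.comp hcm
    cases h : σ 0 with
    | square =>
      set fJ : DyadicInterval → (Fin d → ℝ) → ℂ :=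
        fun J x' => haarDiff (fun t => f (Fin.cons t x')) J with hfJ
      set u : (Fin d → ℝ) → (Fin d → DyadicInterval) → DyadicInterval → ℝ≥0∞ :=
        fun x' R' J => majorant (Fin.tail σ) (fJ J) x' R' with hu
      have hum : ∀ R' J, Measurable fun x' => u x' R' J := fun R' J =>
        measurable_majorant _ _ (hf.haar J).measurable
      have hE : ∀ t x', energy σ f (Fin.cons t x') = ∑' R', normalized (Fin.tail σ) R' *
          ∑' I : DyadicInterval, almostDiag (u x' R') I ^ 2 * I.toSet.indicator 1 t := by
        intro t x'
        rw [energy, tsum_fin_cons]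
        refine tsum_congr fun R' => ?_
        rw [← ENNReal.tsum_mul_left]
        refine tsum_congr fun I => ?_
        rw [normalized_cons_square h, majorant_square h]
        simp only [Fin.cons_zero, Fin.tail_cons]
        congr 1
        by_cases ht : t ∈ I.toSet
        · simp only [Set.indicator_of_mem ht, Pi.one_apply, mul_one]; rfl
        · simp only [Set.indicator_of_notMem ht]; simp
      have hAD : ∀ R' I, Measurable fun x' => almostDiag (u x' R') I := fun R' I =>
        measurable_almostDiag (fun J => hum R' J) I
      have hmass : ∀ (x' : Fin d → ℝ) (I : DyadicInterval),
          ∫⁻ t, I.toSet.indicator 1 t * w (Fin.cons t x') = mass (fun t => w (Fin.cons t x')) I := by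
        intro x' I
        rw [mass, ← lintegral_indicator I.measurableSet_toSet]
        refine lintegral_congr fun t => ?_
        by_cases ht : t ∈ I.toSet <;> simp [Set.indicator, ht]
      have hfib : ∀ x' : Fin d → ℝ, Measurable fun t => w (Fin.cons t x') := fun x' =>
        (hw.fiber x').measurable
      have hind : ∀ I : DyadicInterval, Measurable (I.toSet.indicator (1 : ℝ → ℝ≥0∞)) := fun I =>
        measurable_one.indicator I.measurableSet_toSet
      have hmassm : ∀ J : DyadicInterval,
          Measurable fun x' : Fin d → ℝ => mass (fun t => w (Fin.cons t x')) J := fun J =>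
        (hwc.comp measurable_swap).lintegral_prod_right' (ν := volume.restrict J.toSet)
      have h1 : ∀ x' : Fin d → ℝ, ∫⁻ t, energy σ f (Fin.cons t x') * w (Fin.cons t x') =
          ∑' R', normalized (Fin.tail σ) R' * ∑' I : DyadicInterval,
            mass (fun t => w (Fin.cons t x')) I * almostDiag (u x' R') I ^ 2 := by
        intro x'
        simp_rw [hE, ← ENNReal.tsum_mul_right, ← ENNReal.tsum_mul_left, ← ENNReal.tsum_mul_right]
        have hm : ∀ R' (I : DyadicInterval), Measurable fun t => normalized (Fin.tail σ) R' *
            (almostDiag (u x' R') I ^ 2 * I.toSet.indicator 1 t) * w (Fin.cons t x') :=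
          fun R' I => (((hind I).const_mul _).const_mul _).mul (hfib x')
        rw [lintegral_tsum fun R' => (Measurable.tsum fun I => hm R' I).aemeasurable]
        refine tsum_congr fun R' => ?_
        rw [lintegral_tsum fun I => (hm R' I).aemeasurable]
        refine tsum_congr fun I => ?_
        have hiw : Measurable fun t => I.toSet.indicator 1 t * w (Fin.cons t x') :=
          (hind I).mul (hfib x')
        rw [← hmass, ← lintegral_mul_const _ hiw, ← lintegral_const_mul _ (hiw.mul_const _)]
        refine lintegral_congr fun t => ?_
        ring
      have h2 : ∀ x' : Fin d → ℝ, ∫⁻ t, energy σ f (Fin.cons t x') * w (Fin.cons t x') ≤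
          CS * ∑' J, mass (fun t => w (Fin.cons t x')) J * energy (Fin.tail σ) (fJ J) x' := by
        intro x'
        rw [h1]
        calc _ ≤ ∑' R', normalized (Fin.tail σ) R' * (CS * ∑' J : DyadicInterval,
            mass (fun t => w (Fin.cons t x')) J * u x' R' J ^ 2) := by
              refine ENNReal.tsum_le_tsum fun R' => ?_
              gcongr
              exact hS _ (hw.fiber x') _
          _ = _ := by
              simp_rw [energy, ← ENNReal.tsum_mul_left]
              rw [ENNReal.tsum_comm]
              refine tsum_congr fun J => tsum_congr fun R' => ?_
              ring
      have h3 : ∀ J : DyadicInterval, ∫⁻ x' : Fin d → ℝ,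
          mass (fun t => w (Fin.cons t x')) J * energy (Fin.tail σ) (fJ J) x' ≤
          C * ∫⁻ x' : Fin d → ℝ, mass (fun t => w (Fin.cons t x')) J * ‖fJ J x'‖ₑ ^ 2 := by
        intro J
        -- The mass as a function of `x'` is an integral of the slices `w(t, ·)` over `t ∈ J`. The
        -- induction hypothesis is applied to each slice, so nothing needs to be known about the
        -- mass as a weight.
        have hswap : ∀ g : (Fin d → ℝ) → ℝ≥0∞, Measurable g →
            ∫⁻ x' : Fin d → ℝ, mass (fun t => w (Fin.cons t x')) J * g x' =
            ∫⁻ t in J.toSet, ∫⁻ x' : Fin d → ℝ, g x' * w (Fin.cons t x') := by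
          intro g hg
          have hgw : Measurable fun p : ℝ × (Fin d → ℝ) => g p.2 * w (Fin.cons p.1 p.2) :=
            (hg.comp measurable_snd).mul hwc
          rw [lintegral_lintegral_swap hgw.aemeasurable]
          refine lintegral_congr fun x' => ?_
          rw [lintegral_const_mul _ (hfib x'), mass, mul_comm]
        rw [hswap _ (measurable_energy _ (hf.haar J).measurable),
          hswap _ ((hf.haar J).measurable.enorm.pow_const 2), ← lintegral_const_mul' _ _ hC]
        exact lintegral_mono fun t => hI _ _ (hw.slice t) _ (hf.haar J)
      have hme : ∀ J, AEMeasurable (fun x' : Fin d → ℝ => mass (fun t => w (Fin.cons t x')) J *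
          energy (Fin.tail σ) (fJ J) x') volume := fun J =>
        ((hmassm J).mul (measurable_energy _ (hf.haar J).measurable)).aemeasurable
      have hmn : ∀ J, AEMeasurable (fun x' : Fin d → ℝ => mass (fun t => w (Fin.cons t x')) J *
          ‖fJ J x'‖ₑ ^ 2) volume := fun J =>
        ((hmassm J).mul ((hf.haar J).measurable.enorm.pow_const 2)).aemeasurable
      rw [lintegral_cons_symm hFm]
      calc _ ≤ ∫⁻ x' : Fin d → ℝ, CS * ∑' J, mass (fun t => w (Fin.cons t x')) J *
            energy (Fin.tail σ) (fJ J) x' := lintegral_mono h2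
        _ = CS * ∑' J, ∫⁻ x' : Fin d → ℝ, mass (fun t => w (Fin.cons t x')) J *
            energy (Fin.tail σ) (fJ J) x' := by
            rw [lintegral_const_mul' _ _ hCS, lintegral_tsum hme]
        _ ≤ CS * ∑' J, C * ∫⁻ x' : Fin d → ℝ, mass (fun t => w (Fin.cons t x')) J *
            ‖fJ J x'‖ₑ ^ 2 := by
            gcongr with J; exact h3 J
        _ = CS * C * ∫⁻ x' : Fin d → ℝ, ∑' J, mass (fun t => w (Fin.cons t x')) J *
            ‖fJ J x'‖ₑ ^ 2 := by
            rw [ENNReal.tsum_mul_left, ← lintegral_tsum hmn, mul_assoc]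
        _ ≤ CS * C * ∫⁻ x' : Fin d → ℝ, CH * ∫⁻ t, ‖f (Fin.cons t x')‖ₑ ^ 2 *
            w (Fin.cons t x') := by
            refine mul_le_mul_right (lintegral_mono fun x' => ?_) _
            exact tsum_mass_mul_haarDiff_le hQ (hw.fiber x')
              (hfm.comp (hcm.comp measurable_prodMk_right)) (hf.integrable_fiber x')
        _ = CS * C * CH * ∫⁻ x, ‖f x‖ₑ ^ 2 * w x := by
            rw [lintegral_const_mul' _ _ hCHt, lintegral_cons_symm hRm, mul_assoc _ CH]
        _ ≤ _ := by gcongr; exact le_self_add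
    | maximal =>
      have hFu : Measurable fun p : ℝ × (Fin d → ℝ) => f (Fin.cons p.1 p.2) := hfm.comp hcm
      have hEu := measurable_energy_uncurry (Fin.tail σ) (fun (t : ℝ) (x' : Fin d → ℝ) =>
        f (Fin.cons t x')) hFu
      have hmu : ∀ R', Measurable fun p : ℝ × (Fin d → ℝ) =>
          majorant (Fin.tail σ) (fun x' => f (Fin.cons p.1 x')) p.2 R' := fun R' =>
        measurable_majorant_uncurry (Fin.tail σ) R' (fun (t : ℝ) (x' : Fin d → ℝ) =>
          f (Fin.cons t x')) hFu
      set m : (Fin d → ℝ) → (Fin d → DyadicInterval) → ℝ → ℝ≥0∞ :=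
        fun x' R' t => majorant (Fin.tail σ) (fun y => f (Fin.cons t y)) x' R' with hm
      have hmm : ∀ x' R', Measurable (m x' R') := fun x' R' =>
        (hmu R').comp measurable_prodMk_right
      have hE : ∀ t x', energy σ f (Fin.cons t x') = ∑' R', normalized (Fin.tail σ) R' *
          maxFn volume (m x' R') t ^ 2 := by
        intro t x'
        rw [energy, tsum_fin_cons]
        refine tsum_congr fun R' => ?_
        simp_rw [normalized_cons_maximal h, majorant_maximal h]
        rw [tsum_eq_single ⟨0, 0⟩ fun I hI => by simp [hI]]
        simp only [Fin.cons_zero, Fin.tail_cons, if_true, one_mul, hm]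
      have hfib : ∀ x' : Fin d → ℝ, Measurable fun t => w (Fin.cons t x') := fun x' =>
        (hw.fiber x').measurable
      have hline : ∀ x' : Fin d → ℝ, ∫⁻ t, energy σ f (Fin.cons t x') * w (Fin.cons t x') ≤
          CM * ∫⁻ t, energy (Fin.tail σ) (fun y => f (Fin.cons t y)) x' * w (Fin.cons t x') := by
        intro x'
        simp_rw [hE, energy, ← ENNReal.tsum_mul_right]
        simp_rw [mul_assoc]
        have hm1 : ∀ R', Measurable fun t => maxFn volume (m x' R') t ^ 2 * w (Fin.cons t x') :=
          fun R' => ((measurable_maxFn _ _).pow_const 2).mul (hfib x')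
        have hm2 : ∀ R', Measurable fun t =>
            majorant (Fin.tail σ) (fun y => f (Fin.cons t y)) x' R' ^ 2 * w (Fin.cons t x') :=
          fun R' => ((hmm x' R').pow_const 2).mul (hfib x')
        rw [lintegral_tsum fun R' => ((hm1 R').const_mul _).aemeasurable,
          lintegral_tsum fun R' => ((hm2 R').const_mul _).aemeasurable, ← ENNReal.tsum_mul_left]
        refine ENNReal.tsum_le_tsum fun R' => ?_
        rw [lintegral_const_mul _ (hm1 R'), lintegral_const_mul _ (hm2 R'), mul_left_comm]
        gcongr
        exact hM _ (hw.fiber x') _ (hmm x' R')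
      rw [lintegral_cons_symm hFm]
      calc _ ≤ ∫⁻ x' : Fin d → ℝ, CM * ∫⁻ t, energy (Fin.tail σ) (fun y => f (Fin.cons t y)) x' *
            w (Fin.cons t x') := lintegral_mono hline
        _ = CM * ∫⁻ t : ℝ, ∫⁻ x' : Fin d → ℝ, energy (Fin.tail σ) (fun y => f (Fin.cons t y)) x' *
            w (Fin.cons t x') := by
            rw [lintegral_const_mul' _ _ hCM, lintegral_lintegral_swap]
            exact ((hEu.mul hwc).comp measurable_swap).aemeasurable
        _ ≤ CM * ∫⁻ t : ℝ, C * ∫⁻ x' : Fin d → ℝ, ‖f (Fin.cons t x')‖ₑ ^ 2 *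
            w (Fin.cons t x') := by
            refine mul_le_mul_right (lintegral_mono fun t => ?_) _
            exact hI _ _ (hw.slice t) _ (hf.slice t)
        _ = CM * C * ∫⁻ x, ‖f x‖ₑ ^ 2 * w x := by
            rw [lintegral_const_mul' _ _ hC, lintegral_cons hRm, mul_assoc]
        _ ≤ _ := by gcongr; exact le_add_self

/-! ### The iterated norms are dominated by the energy -/

/-- The rectangle with the sides in the coordinates of maximal type replaced by a fixed interval. -/
def normRect {d : ℕ} (σ : Fin d → OpKind) (R : Fin d → DyadicInterval) : Fin d → DyadicInterval :=
  fun j => match σ j with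
    | .square => R j
    | .maximal => ⟨0, 0⟩

section normRect

variable {d : ℕ} {σ : Fin d → OpKind}

theorem normRect_square {j : Fin d} (h : σ j = .square) (R : Fin d → DyadicInterval) :
    normRect σ R j = R j := by
  simp [normRect, h]

theorem normRect_maximal {j : Fin d} (h : σ j = .maximal) (R : Fin d → DyadicInterval) :
    normRect σ R j = ⟨0, 0⟩ := by
  simp [normRect, h]

theorem normRect_update_of_ne {i j : Fin d} (h : j ≠ i) (R : Fin d → DyadicInterval)
    (I : DyadicInterval) : normRect σ (Function.update R i I) j = normRect σ R j := by
  simp [normRect, Function.update_of_ne h]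

theorem normRect_update_maximal {i : Fin d} (h : σ i = .maximal) (R : Fin d → DyadicInterval)
    (I : DyadicInterval) : normRect σ (Function.update R i I) = normRect σ R := by
  funext j
  by_cases hj : j = i
  · subst hj; rw [normRect_maximal h, normRect_maximal h]
  · exact normRect_update_of_ne hj R I

end normRect

/-- In a coordinate of maximal type the maximal function serves all intervals at once, so the
majorant does not depend on that side. Suprema over such sides are therefore free. -/
theorem majorant_normRect {d : ℕ} (σ : Fin d → OpKind) (f : (Fin d → ℝ) → ℂ) (x : Fin d → ℝ)
    (R : Fin d → DyadicInterval) : majorant σ f x (normRect σ R) = majorant σ f x R := by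
  induction d with
  | zero => rfl
  | succ d ih =>
    have ht : Fin.tail (normRect σ R) = normRect (Fin.tail σ) (Fin.tail R) := rfl
    cases h : σ 0 with
    | square => simp only [majorant_square h, ht, ih, normRect_square h]
    | maximal => simp only [majorant_maximal h, ht, ih]

open Classical in
/-- Selects the rectangles that contribute to the norms in the coordinates of `l`, evaluated at the
rectangle `R`. -/
noncomputable def selector {d : ℕ} (σ : Fin d → OpKind) (l : List (Fin d))
    (R R' : Fin d → DyadicInterval) : ℝ≥0∞ :=
  if ∀ j, (j ∉ l ∨ σ j = .maximal) → R' j = normRect σ R j then 1 else 0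

/-- Only `I = R' i` can contribute to the sum, so no rectangle is counted twice. -/
theorem tsum_selector_update_le {d : ℕ} {σ : Fin d → OpKind} {i : Fin d} {l : List (Fin d)}
    (hi : i ∉ l) (h : σ i = .square) (R R' : Fin d → DyadicInterval) :
    ∑' I, selector σ l (Function.update R i I) R' ≤ selector σ (i :: l) R R' := by
  rw [tsum_eq_single (R' i)]
  · unfold selector
    split_ifs with h1 h2
    · exact le_rfl
    · refine absurd (fun j hj => ?_) h2
      have hji : j ≠ i := by
        rintro rfl
        rcases hj with hj | hj
        · simp at hj
        · simp [h] at hj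
      rw [h1 j (hj.imp_left fun hj hjl => hj (List.mem_cons_of_mem _ hjl)),
        normRect_update_of_ne hji]
    · exact zero_le
    · exact le_rfl
  · intro I hI
    unfold selector
    rw [if_neg]
    intro h1
    have := h1 i (Or.inl hi)
    rw [normRect_square h, Function.update_self] at this
    exact hI this.symm

theorem selector_cons_maximal {d : ℕ} {σ : Fin d → OpKind} {i : Fin d} {l : List (Fin d)}
    (h : σ i = .maximal) (R R' : Fin d → DyadicInterval) (I : DyadicInterval) :
    selector σ l (Function.update R i I) R' = selector σ (i :: l) R R' := by
  unfold selector
  rw [normRect_update_maximal h]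
  congr 1
  refine propext (forall_congr' fun j => ?_)
  by_cases hj : j = i
  · subst hj; simp [h]
  · simp [hj]

/-- Induction from the innermost norm outwards: an `ℓ²` norm releases one more side for summation,
and a supremum changes nothing because the selected rectangles do not depend on that side. Every
order of the norms thus ends in the same sum of squares. -/
theorem sq_foldr_coordNorm_le {d : ℕ} {σ : Fin d → OpKind} {a v : DyadicRectangle d → ℝ≥0∞}
    (hav : ∀ R, a R ≤ v (normRect σ R)) {l : List (Fin d)} (hl : l.Nodup)
    (R : DyadicRectangle d) :
    l.foldr (fun j a => coordNorm (σ j) j a) a R ^ 2 ≤ ∑' R', selector σ l R R' * v R' ^ 2 := by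
  induction l generalizing R with
  | nil =>
    refine le_trans ?_ (ENNReal.le_tsum (normRect σ R))
    simp only [List.foldr_nil, selector]
    rw [if_pos fun _ _ => rfl, one_mul]
    gcongr
    exact hav R
  | cons i l ih =>
    rw [List.nodup_cons] at hl
    replace ih := ih hl.2
    rw [List.foldr_cons, coordNorm]
    cases h : σ i with
    | square =>
      rw [OpKind.seqNorm, ← ENNReal.rpow_natCast, ← ENNReal.rpow_mul]
      norm_num
      calc _ ≤ ∑' I, ∑' R', selector σ l (Function.update R i I) R' * v R' ^ 2 :=
            ENNReal.tsum_le_tsum fun I => ih _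
        _ = ∑' R', (∑' I, selector σ l (Function.update R i I) R') * v R' ^ 2 := by
            rw [ENNReal.tsum_comm]
            simp_rw [ENNReal.tsum_mul_right]
        _ ≤ _ := by
            gcongr
            exact tsum_selector_update_le hl.1 h _ _
    | maximal =>
      have : Nonempty DyadicInterval := ⟨⟨0, 0⟩⟩
      rw [OpKind.seqNorm, ENNReal.iSup_pow]
      refine iSup_le fun I => (ih _).trans ?_
      simp_rw [selector_cons_maximal h]
      exact le_rfl

theorem sq_governingOp_le {d : ℕ} (σ : Fin d → OpKind) (π : Equiv.Perm (Fin d))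
    {φ : DyadicRectangle d → (Fin d → ℝ) → ℂ} {f g : (Fin d → ℝ) → ℂ} {x : Fin d → ℝ} {c : ℝ≥0∞}
    (h : ∀ R, coeff φ f x R ≤ c * majorant σ g x R) :
    governingOp σ π φ f x ^ 2 ≤ c ^ 2 * energy σ g x := by
  have hmem : ∀ j, j ∈ List.ofFn π := fun j =>
    List.mem_ofFn.2 ⟨π.symm j, π.apply_symm_apply j⟩
  refine (sq_foldr_coordNorm_le (σ := σ) (v := fun R => c * majorant σ g x R)
    (fun R => ?_) (List.nodup_ofFn.2 π.injective) _).trans ?_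
  · simp only [majorant_normRect]
    exact h R
  · rw [energy, ← ENNReal.tsum_mul_left]
    refine ENNReal.tsum_le_tsum fun R => ?_
    have hs : selector σ (List.ofFn π) (fun _ => ⟨0, 0⟩) R = normalized σ R := by
      unfold selector normalized
      congr 1
      refine propext (forall_congr' fun j => ?_)
      simp only [hmem, not_true_eq_false, false_or]
      exact imp_congr_right fun hj => by rw [normRect_maximal hj]
    rw [hs]
    exact le_of_eq (by ring)

/-! ### Measurability of the governing operators -/

theorem DyadicRectangle.measurableSet_toSet {d : ℕ} (R : DyadicRectangle d) :
    MeasurableSet R.toSet := by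
  have : R.toSet = ⋂ j, (fun x : Fin d → ℝ => x j) ⁻¹' (R j).toSet := by
    ext x; simp [DyadicRectangle.toSet]
  rw [this]
  exact MeasurableSet.iInter fun j => measurable_pi_apply j (R j).measurableSet_toSet

theorem measurable_coordNorm {α : Type*} [MeasurableSpace α] {d : ℕ} (κ : OpKind) (j : Fin d)
    {a : α → DyadicRectangle d → ℝ≥0∞} (ha : ∀ R, Measurable fun x => a x R)
    (R : DyadicRectangle d) : Measurable fun x => coordNorm κ j (a x) R := by
  cases κ with
  | square => exact (Measurable.tsum fun I => (ha _).pow_const 2).pow_const _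
  | maximal => exact Measurable.iSup fun I => ha _

theorem measurable_governingOp {d : ℕ} (σ : Fin d → OpKind) (π : Equiv.Perm (Fin d))
    (φ : DyadicRectangle d → (Fin d → ℝ) → ℂ) (f : (Fin d → ℝ) → ℂ) :
    Measurable (governingOp σ π φ f) := by
  have key : ∀ (l : List (Fin d)) (R : DyadicRectangle d), Measurable fun x =>
      l.foldr (fun j a => coordNorm (σ j) j a) (coeff φ f x) R := by
    intro l
    induction l with
    | nil => intro R; exact measurable_const.indicator R.measurableSet_toSet
    | cons i l ih => intro R; exact measurable_coordNorm _ _ ih R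
  exact key _ _

/-! ### The coefficients are dominated by the majorant -/

theorem DyadicInterval.length_pos (I : DyadicInterval) : 0 < I.length := by
  unfold DyadicInterval.length; positivity

/-- Division by `|I|^{1/2}` turns the `L²` normalization into the `L¹` normalization; over all sides
this uses up the factor `|R|^{-1/2}` of the coefficients. -/
theorem IsAdapted.isBump {K : ℝ} {N : ℕ} {I : DyadicInterval} {ψ : ℝ → ℂ} (h : IsAdapted K N I ψ)
    (hN : 6 ≤ N) : IsBump K I fun x => ψ x / (Real.sqrt I.length : ℂ) := by
  have hl := I.length_pos
  have hs : 0 < Real.sqrt I.length := Real.sqrt_pos.2 hl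
  have hK : 0 ≤ K := by
    have h0 := (norm_nonneg _).trans (h.norm_iteratedDeriv_le 0 (by norm_num) I.center)
    simp only [sub_self, abs_zero, zero_div, add_zero, one_zpow, mul_one] at h0
    exact nonneg_of_mul_nonneg_left h0 (by positivity)
  have hdec : ∀ x, (1 + |x - I.center| / I.length) ^ (-(N : ℤ)) ≤
      ((1 + |x - I.center| / I.length) ^ 6)⁻¹ := by
    intro x
    have h1 : 1 ≤ 1 + |x - I.center| / I.length := le_add_of_nonneg_right (by positivity)
    rw [zpow_neg, zpow_natCast]
    gcongr
  have hp0 : I.length ^ (-((0 : ℕ) : ℝ) - 1 / 2) / Real.sqrt I.length = I.length⁻¹ := by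
    rw [Real.sqrt_eq_rpow, ← Real.rpow_sub hl, ← Real.rpow_neg_one]; norm_num
  have hp1 : I.length ^ (-((1 : ℕ) : ℝ) - 1 / 2) / Real.sqrt I.length = (I.length ^ 2)⁻¹ := by
    rw [Real.sqrt_eq_rpow, ← Real.rpow_sub hl, ← Real.rpow_natCast, ← Real.rpow_neg hl.le]; norm_num
  have hns : ∀ z : ℂ, ‖z / (Real.sqrt I.length : ℂ)‖ = ‖z‖ / Real.sqrt I.length := by
    intro z
    rw [norm_div, Complex.norm_real, Real.norm_of_nonneg hs.le]
  refine ⟨hK, h.differentiable.div_const _, fun x => ?_, fun x => ?_⟩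
  · rw [hns, ← hp0]
    have := h.norm_iteratedDeriv_le 0 (by norm_num) x
    rw [iteratedDeriv_zero] at this
    calc _ ≤ (K * I.length ^ (-((0 : ℕ) : ℝ) - 1 / 2) *
          (1 + |x - I.center| / I.length) ^ (-(N : ℤ))) / Real.sqrt I.length := by gcongr
      _ ≤ (K * I.length ^ (-((0 : ℕ) : ℝ) - 1 / 2) *
          ((1 + |x - I.center| / I.length) ^ 6)⁻¹) / Real.sqrt I.length := by
          gcongr; exact hdec x
      _ = _ := by ring
  · rw [deriv_div_const, hns, ← hp1]
    have := h.norm_iteratedDeriv_le 1 le_rfl x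
    rw [iteratedDeriv_one] at this
    calc _ ≤ (K * I.length ^ (-((1 : ℕ) : ℝ) - 1 / 2) *
          (1 + |x - I.center| / I.length) ^ (-(N : ℤ))) / Real.sqrt I.length := by gcongr
      _ ≤ (K * I.length ^ (-((1 : ℕ) : ℝ) - 1 / 2) *
          ((1 + |x - I.center| / I.length) ^ 6)⁻¹) / Real.sqrt I.length := by
          gcongr; exact hdec x
      _ = _ := by ring

theorem IsNice.conj {d : ℕ} {f : (Fin d → ℝ) → ℂ} (hf : IsNice f) : IsNice fun x => conj (f x) where
  measurable := Complex.continuous_conj.measurable.comp hf.measurable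
  bounded := by simpa using hf.bounded
  support := by simpa using hf.support

theorem coeff_le_mul_majorant {d : ℕ} {σ : Fin d → OpKind} {K : ℝ} {N : ℕ} (hN : 6 ≤ N)
    {φ : DyadicRectangle d → (Fin d → ℝ) → ℂ} (hφ : ∀ R, IsAdaptedRect K N R (φ R))
    (hz : ∀ j, σ j = .square → ∀ R, HasZeros j (φ R)) {f : (Fin d → ℝ) → ℂ} (hf : IsNice f)
    (x : Fin d → ℝ) (R : DyadicRectangle d) :
    coeff φ f x R ≤ bumpConst K ^ d * majorant σ (fun y => conj (f y)) x R := by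
  by_cases hx : x ∈ R.toSet
  swap
  · rw [coeff, Set.indicator_of_notMem hx]; exact zero_le
  rw [coeff, Set.indicator_of_mem hx]
  obtain ⟨ψ, hψ, hprod⟩ := hφ R
  -- Zeros of the product only say that `∫ ψ j` times the other factors vanishes. Either the
  -- integral is zero, or the other factors are zero everywhere and so is `φ R`.
  by_cases h0 : ∀ j, σ j = .square → ∫ t, ψ j t = 0
  · refine le_trans (le_of_eq ?_) (enorm_integral_mul_prod_le σ hf.conj R
      (fun j t => ψ j t / (Real.sqrt (R j).length : ℂ)) (fun j => (hψ j).isBump hN)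
      (fun j hj => ?_) x hx)
    · rw [← ofReal_norm]
      congr 1
      have h1 : ∀ y, conj (f y) * ∏ j, ψ j (y j) / (Real.sqrt (R j).length : ℂ) =
          conj (f y * conj (φ R y)) / (∏ j, (Real.sqrt (R j).length : ℂ)) := by
        intro y
        rw [Finset.prod_div_distrib, ← hprod, map_mul, Complex.conj_conj, mul_div_assoc]
      simp_rw [h1]
      rw [integral_div, integral_conj, norm_div, RCLike.norm_conj, norm_prod,
        DyadicRectangle.vol, Real.sqrt_eq_rpow, ← Real.finsetProd_rpow _ _ fun j _ => (R j).length_pos.le]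
      congr 1
      refine Finset.prod_congr rfl fun j _ => ?_
      rw [Complex.norm_real, Real.norm_of_nonneg (Real.sqrt_nonneg _), Real.sqrt_eq_rpow]
    · rw [integral_div, h0 j hj, zero_div]
  · push Not at h0
    obtain ⟨j, hj, hne⟩ := h0
    have hzero : ∀ y, φ R y = 0 := by
      intro y
      have h1 := hz j hj R y
      have h2 : ∀ t, φ R (Function.update y j t) =
          (∏ i ∈ Finset.univ.erase j, ψ i (y i)) * ψ j t := by
        intro t
        rw [hprod, ← Finset.prod_erase_mul _ _ (Finset.mem_univ j), Function.update_self]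
        congr 1
        refine Finset.prod_congr rfl fun i hi => ?_
        rw [Function.update_of_ne (Finset.ne_of_mem_erase hi)]
      simp_rw [h2] at h1
      rw [integral_const_mul] at h1
      have h3 := (mul_eq_zero.1 h1).resolve_right hne
      rw [hprod, ← Finset.prod_erase_mul _ _ (Finset.mem_univ j), h3, zero_mul]
    simp [hzero]

/-- The weighted `L²` bound for the governing operators. -/
theorem exists_lintegral_sq_governingOp_mul_le (d : ℕ) (K : ℝ) {Q : ℝ≥0∞} (hQ : Q ≠ ∞) :
    ∃ C : ℝ≥0∞, C ≠ ∞ ∧ ∀ (N : ℕ), 6 ≤ N → ∀ (σ : Fin d → OpKind) (π : Equiv.Perm (Fin d))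
      (φ : DyadicRectangle d → (Fin d → ℝ) → ℂ), (∀ R, IsAdaptedRect K N R (φ R)) →
      (∀ j, σ j = .square → ∀ R, HasZeros j (φ R)) → ∀ f, IsNice f → ∀ w, IsLineA2 Q w →
        ∫⁻ x, governingOp σ π φ f x ^ 2 * w x ≤ C * ∫⁻ x, ‖f x‖ₑ ^ 2 * w x := by
  obtain ⟨C, hC, h⟩ := exists_lintegral_energy_mul_le d hQ
  have hb := bumpConst_ne_top K
  refine ⟨(bumpConst K ^ d) ^ 2 * C, by finiteness, fun N hN σ π φ hφ hz f hf w hw => ?_⟩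
  calc ∫⁻ x, governingOp σ π φ f x ^ 2 * w x
      ≤ ∫⁻ x, (bumpConst K ^ d) ^ 2 * (energy σ (fun y => conj (f y)) x * w x) := by
        refine lintegral_mono fun x => ?_
        simp only
        rw [← mul_assoc]
        exact mul_le_mul_left (sq_governingOp_le σ π (coeff_le_mul_majorant hN hφ hz hf x)) _
    _ = (bumpConst K ^ d) ^ 2 * ∫⁻ x, energy σ (fun y => conj (f y)) x * w x :=
        lintegral_const_mul' _ _ (by finiteness)
    _ ≤ (bumpConst K ^ d) ^ 2 * (C * ∫⁻ x, ‖conj (f x)‖ₑ ^ 2 * w x) := by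
        gcongr; exact h σ w hw _ hf.conj
    _ = _ := by simp_rw [RCLike.enorm_conj]; rw [mul_assoc]

/-! ### Maximal functions in the coordinate directions -/

/-- An interval of at most twice the length with rational endpoints contains `[a, b)`; this accounts
for the factor 2. -/
theorem setLIntegral_le_mul_of_maxFn_le {H : ℝ → ℝ≥0∞} {c : ℝ≥0∞}
    (hc : ∀ t, maxFn volume H t ≤ c * H t) {a b y : ℝ} (hy : y ∈ Set.Ico a b) :
    ∫⁻ t in Set.Ico a b, H t ≤ 2 * c * ENNReal.ofReal (b - a) * H y := by
  have hab : a < b := hy.1.trans_lt hy.2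
  obtain ⟨a', ha1, ha2⟩ := exists_rat_btwn (show a - (b - a) / 2 < a by linarith)
  obtain ⟨b', hb1, hb2⟩ := exists_rat_btwn (show b < b + (b - a) / 2 by linarith)
  have h1 := average_le_maxFn volume H (a := a') (b := b') (x := y)
    ⟨ha2.le.trans hy.1, hy.2.trans hb1⟩
  have h0 : ENNReal.ofReal ((b' : ℝ) - a') ≠ 0 := by
    simp only [ne_eq, ENNReal.ofReal_eq_zero, not_le]; linarith
  rw [Real.volume_Ico, ENNReal.div_le_iff h0 ENNReal.ofReal_ne_top] at h1
  calc ∫⁻ t in Set.Ico a b, H t ≤ ∫⁻ t in Set.Ico (a' : ℝ) b', H t :=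
        lintegral_mono_set (Set.Ico_subset_Ico ha2.le hb1.le)
    _ ≤ maxFn volume H y * ENNReal.ofReal (b' - a') := h1
    _ ≤ (c * H y) * ENNReal.ofReal (2 * (b - a)) :=
        mul_le_mul' (hc y) (ENNReal.ofReal_le_ofReal (by linarith))
    _ = _ := by
        rw [ENNReal.ofReal_mul (by norm_num), ENNReal.ofReal_ofNat]; ring

/-- A quotient of two `A₁` weights is `A₂`. On an interval `J`, `H⁻¹` is pointwise at most `2c |J| /
∫_J H`, so the integral of `H₂ / H₁` is at most `2c |J| ∫_J H₂ / ∫_J H₁`. The inverse weight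
satisfies the same bound with the roles exchanged, and in the product the quotients cancel. -/
theorem isA2_mul_inv {H₁ H₂ : ℝ → ℝ≥0∞} {c : ℝ≥0∞} (hc : c ≠ ∞) (hm₁ : Measurable H₁)
    (hm₂ : Measurable H₂) (h0₁ : ∀ t, H₁ t ≠ 0) (h0₂ : ∀ t, H₂ t ≠ 0) (ht₁ : ∀ t, H₁ t ≠ ∞)
    (ht₂ : ∀ t, H₂ t ≠ ∞) (hc₁ : ∀ t, maxFn volume H₁ t ≤ c * H₁ t)
    (hc₂ : ∀ t, maxFn volume H₂ t ≤ c * H₂ t) : IsA2 ((2 * c) ^ 2) fun t => H₂ t * (H₁ t)⁻¹ := by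
  have hne : ∀ {H : ℝ → ℝ≥0∞}, (∀ t, H t ≠ ∞) → (∀ t, maxFn volume H t ≤ c * H t) → ∀ a b : ℝ,
      a < b → ∫⁻ t in Set.Ico a b, H t ≠ ∞ := by
    intro H hH hcH a b hab
    have := hH a
    exact ne_top_of_le_ne_top (by finiteness)
      (setLIntegral_le_mul_of_maxFn_le hcH (Set.left_mem_Ico.2 hab))
  have key : ∀ {H H' : ℝ → ℝ≥0∞}, Measurable H' → (∀ t, H t ≠ 0) → (∀ t, H t ≠ ∞) →
      Measurable H →
      (∀ t, maxFn volume H t ≤ c * H t) → ∀ a b : ℝ, a < b →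
      ∫⁻ t in Set.Ico a b, H' t * (H t)⁻¹ ≤ 2 * c * ENNReal.ofReal (b - a) *
        (∫⁻ t in Set.Ico a b, H t)⁻¹ * ∫⁻ t in Set.Ico a b, H' t := by
    intro H H' hH' h0 ht hH hcH a b hab
    rw [← lintegral_const_mul _ hH']
    refine setLIntegral_mono (hH'.const_mul _) fun t ht' => ?_
    rw [mul_comm]
    refine mul_le_mul_left ?_ _
    have h1 := setLIntegral_le_mul_of_maxFn_le hcH ht'
    have h2 := setLIntegral_Ico_ne_zero hH h0 hab
    rw [← div_eq_mul_inv, ENNReal.le_div_iff_mul_le (Or.inl h2) (Or.inl (hne ht hcH a b hab))]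
    calc (H t)⁻¹ * ∫⁻ t in Set.Ico a b, H t
        ≤ (H t)⁻¹ * (2 * c * ENNReal.ofReal (b - a) * H t) := by gcongr
      _ = 2 * c * ENNReal.ofReal (b - a) * (H t * (H t)⁻¹) := by ring
      _ = _ := by rw [ENNReal.mul_inv_cancel (h0 t) (ht t), mul_one]
  have hinv : ∀ t, (H₂ t * (H₁ t)⁻¹)⁻¹ = H₁ t * (H₂ t)⁻¹ := by
    intro t
    rw [ENNReal.mul_inv (Or.inl (h0₂ t)) (Or.inl (ht₂ t)), inv_inv, mul_comm]
  have hemp : ∀ {a b : ℝ}, ¬ a < b → ∀ H : ℝ → ℝ≥0∞, ∫⁻ t in Set.Ico a b, H t = 0 := by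
    intro a b hab H
    rw [Set.Ico_eq_empty hab, setLIntegral_empty]
  refine ⟨hm₂.mul hm₁.inv, fun t => mul_ne_zero (h0₂ t) (ENNReal.inv_ne_zero.2 (ht₁ t)),
    fun t => ENNReal.mul_ne_top (ht₂ t) (ENNReal.inv_ne_top.2 (h0₁ t)), fun a b => ?_, fun a b => ?_,
    fun a b => ?_⟩
  · by_cases hab : a < b
    · have h1 := setLIntegral_Ico_ne_zero hm₁ h0₁ hab
      have h2 := hne ht₂ hc₂ a b hab
      exact ne_top_of_le_ne_top (by finiteness) (key hm₂ h0₁ ht₁ hm₁ hc₁ a b hab)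
    · rw [hemp hab]; simp
  · simp_rw [hinv]
    by_cases hab : a < b
    · have h1 := setLIntegral_Ico_ne_zero hm₂ h0₂ hab
      have h2 := hne ht₁ hc₁ a b hab
      exact ne_top_of_le_ne_top (by finiteness) (key hm₁ h0₂ ht₂ hm₂ hc₂ a b hab)
    · rw [hemp hab]; simp
  · simp_rw [hinv]
    by_cases hab : a < b
    · have h1 := setLIntegral_Ico_ne_zero hm₁ h0₁ hab
      have h2 := hne ht₂ hc₂ a b hab
      have h3 := setLIntegral_Ico_ne_zero hm₂ h0₂ hab
      have h4 := hne ht₁ hc₁ a b hab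
      refine (mul_le_mul' (key hm₂ h0₁ ht₁ hm₁ hc₁ a b hab)
        (key hm₁ h0₂ ht₂ hm₂ hc₂ a b hab)).trans (le_of_eq ?_)
      set A := ∫⁻ t in Set.Ico a b, H₁ t
      set B := ∫⁻ t in Set.Ico a b, H₂ t
      calc _ = (2 * c) ^ 2 * ENNReal.ofReal (b - a) ^ 2 * (A * A⁻¹) * (B * B⁻¹) := by ring
        _ = _ := by rw [ENNReal.mul_inv_cancel h1 h4, ENNReal.mul_inv_cancel h3 h2]; ring
    · rw [hemp hab]; simp

theorem maxFn_le_of_le {μ : Measure ℝ} {f : ℝ → ℝ≥0∞} {c : ℝ≥0∞} (h : ∀ t, f t ≤ c) (x : ℝ) :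
    maxFn μ f x ≤ c := by
  refine maxFn_le fun a b _ => ENNReal.div_le_of_le_mul ?_
  calc _ ≤ ∫⁻ _ in Set.Ico (a : ℝ) b, c ∂μ := lintegral_mono fun t => h t
    _ = _ := setLIntegral_const _ _

/-- The maximal function in the `j`-th coordinate. -/
noncomputable def coordMax {d : ℕ} (j : Fin d) (h : (Fin d → ℝ) → ℝ≥0∞) (x : Fin d → ℝ) : ℝ≥0∞ :=
  maxFn volume (fun t => h (Function.update x j t)) (x j)

section coordMax

variable {d : ℕ} (j : Fin d)

theorem measurable_update_uncurry :
    Measurable fun p : (Fin d → ℝ) × ℝ => Function.update p.1 j p.2 := by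
  refine measurable_pi_lambda _ fun i => ?_
  by_cases hi : i = j
  · subst hi; simpa using measurable_snd
  · simp only [Function.update_of_ne hi]
    exact (measurable_pi_apply i).comp measurable_fst

theorem measurable_coordMax {h : (Fin d → ℝ) → ℝ≥0∞} (hh : Measurable h) :
    Measurable (coordMax j h) :=
  measurable_maxFn_comp (h := fun (x : Fin d → ℝ) t => h (Function.update x j t))
    (hh.comp (measurable_update_uncurry j)) (measurable_pi_apply j)

theorem coordMax_update (h : (Fin d → ℝ) → ℝ≥0∞) (x : Fin d → ℝ) (t : ℝ) :
    coordMax j h (Function.update x j t) = maxFn volume (fun s => h (Function.update x j s)) t := by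
  simp [coordMax]

theorem coordMax_mono {g h : (Fin d → ℝ) → ℝ≥0∞} (hgh : ∀ x, g x ≤ h x) (x : Fin d → ℝ) :
    coordMax j g x ≤ coordMax j h x :=
  maxFn_mono (fun _ => hgh _) _

theorem coordMax_tsum_le {g : ℕ → (Fin d → ℝ) → ℝ≥0∞} (hg : ∀ k, Measurable (g k)) (a : ℕ → ℝ≥0∞)
    (x : Fin d → ℝ) :
    coordMax j (fun y => ∑' k, a k * g k y) x ≤ ∑' k, a k * coordMax j (g k) x := by
  refine maxFn_le fun q r hx => ?_
  have hm : ∀ k, Measurable fun t => g k (Function.update x j t) := fun k =>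
    (hg k).comp ((measurable_update_uncurry j).comp measurable_prodMk_left)
  rw [lintegral_tsum fun k => ((hm k).const_mul _).aemeasurable, div_eq_mul_inv,
    ← ENNReal.tsum_mul_right]
  refine ENNReal.tsum_le_tsum fun k => ?_
  rw [lintegral_const_mul _ (hm k), mul_assoc, ← div_eq_mul_inv]
  gcongr
  exact average_le_maxFn volume (fun t => g k (Function.update x j t)) hx

theorem exists_lintegral_coordMax_rpow_le (d : ℕ) {p : ℝ} (hp : 1 < p) :
    ∃ C : ℝ≥0∞, C ≠ ∞ ∧ ∀ (j : Fin d) (h : (Fin d → ℝ) → ℝ≥0∞), Measurable h →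
      ∫⁻ x, coordMax j h x ^ p ≤ C * ∫⁻ x, h x ^ p := by
  obtain ⟨C, hC, hM⟩ := exists_lintegral_maxFn_rpow_le hp
  refine ⟨C, hC, fun j h hh => ?_⟩
  have hhp : Measurable fun x => h x ^ p := hh.pow_const p
  rw [← lintegral_const_mul _ hhp]
  refine lintegral_le_of_lmarginal_le {j} ((measurable_coordMax j hh).pow_const p)
    (hhp.const_mul C) fun x => ?_
  rw [lmarginal_singleton, lmarginal_singleton]
  have hm : Measurable fun t => h (Function.update x j t) :=
    hh.comp ((measurable_update_uncurry j).comp measurable_prodMk_left)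
  simp_rw [coordMax_update]
  rw [lintegral_const_mul _ (hm.pow_const p)]
  exact hM volume _ hm

end coordMax

/-! ### The algorithm of Rubio de Francia -/

/-- The sum of the maximal functions in all coordinate directions. -/
noncomputable def sumMax {d : ℕ} (h : (Fin d → ℝ) → ℝ≥0∞) (x : Fin d → ℝ) : ℝ≥0∞ :=
  ∑ j, coordMax j h x

theorem measurable_sumMax {d : ℕ} {h : (Fin d → ℝ) → ℝ≥0∞} (hh : Measurable h) :
    Measurable (sumMax h) :=
  Finset.measurable_fun_sum _ fun j _ => measurable_coordMax j hh

theorem exists_lintegral_sumMax_rpow_le (d : ℕ) {p : ℝ} (hp : 1 < p) :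
    ∃ C : ℝ≥0∞, C ≠ ∞ ∧ ∀ (h : (Fin d → ℝ) → ℝ≥0∞), Measurable h →
      ∫⁻ x, sumMax h x ^ p ≤ C * ∫⁻ x, h x ^ p := by
  obtain ⟨C, hC, hM⟩ := exists_lintegral_coordMax_rpow_le d hp
  have hd : ((d : ℝ≥0∞)) ^ (p - 1) ≠ ∞ :=
    ENNReal.rpow_ne_top_of_nonneg (by linarith) (ENNReal.natCast_ne_top d)
  refine ⟨(d : ℝ≥0∞) ^ (p - 1) * (d * C), by finiteness, fun h hh => ?_⟩
  calc ∫⁻ x, sumMax h x ^ p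
      ≤ ∫⁻ x, (d : ℝ≥0∞) ^ (p - 1) * ∑ j, coordMax j h x ^ p := by
        refine lintegral_mono fun x => ?_
        simpa [sumMax] using ENNReal.rpow_sum_le_const_mul_sum_rpow Finset.univ
          (fun j => coordMax j h x) hp.le
    _ = (d : ℝ≥0∞) ^ (p - 1) * ∑ j : Fin d, ∫⁻ x, coordMax j h x ^ p := by
        rw [lintegral_const_mul' _ _ hd, lintegral_finsetSum]
        exact fun j _ => (measurable_coordMax j hh).pow_const p
    _ ≤ (d : ℝ≥0∞) ^ (p - 1) * ∑ j : Fin d, C * ∫⁻ x, h x ^ p := by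
        gcongr with j; exact hM j h hh
    _ = _ := by simp; ring

/-- Every function is dominated by one that is essentially no smaller than its maximal functions
in the coordinate directions and has comparable `L^p` norm. -/
theorem exists_le_coordMax_le (d : ℕ) {p : ℝ} (hp : 1 < p) :
    ∃ C c : ℝ≥0∞, C ≠ ∞ ∧ c ≠ ∞ ∧ ∀ (h : (Fin d → ℝ) → ℝ≥0∞), Measurable h →
      ∃ H : (Fin d → ℝ) → ℝ≥0∞, Measurable H ∧ (∀ x, h x ≤ H x) ∧
        ∫⁻ x, H x ^ p ≤ C * ∫⁻ x, h x ^ p ∧ ∀ j x, coordMax j H x ≤ c * H x := by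
  obtain ⟨B₀, hB₀, hM⟩ := exists_lintegral_sumMax_rpow_le d hp
  -- The majorant will be `∑ εᵏ Sᵏ h` with `S = sumMax` and `ε = δ / 2`. The factor `2⁻ᵏ` pays for
  -- bounding the sum by twice a supremum, whose `p`-th power is at most the sum of the `p`-th
  -- powers. The factor `δ = (2B)⁻¹` makes these summable; `B ≥ 1` ensures `δ ≤ 1`, hence `δ ^ p B ≤
  -- δ B = 1/2`.
  set B := B₀ + 1 with hB
  have hBt : B ≠ ∞ := by finiteness
  have hB0 : B ≠ 0 := by simp [hB]
  have hB1 : 1 ≤ B := le_add_self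
  set δ : ℝ≥0∞ := (2 * B)⁻¹ with hδ
  have h2B0 : 2 * B ≠ 0 := by simp [hB0]
  have h2Bt : 2 * B ≠ ∞ := by finiteness
  have hδ1 : δ ≤ 1 := ENNReal.inv_le_one.2 (hB1.trans (le_mul_of_one_le_left' (by norm_num)))
  have hδt : δ ≠ ∞ := ENNReal.inv_ne_top.2 h2B0
  have hδ0 : δ ≠ 0 := ENNReal.inv_ne_zero.2 h2Bt
  set ε : ℝ≥0∞ := 2⁻¹ * δ with hε
  have hε0 : ε ≠ 0 := by simp [hε, hδ0]
  have hεt : ε ≠ ∞ := by finiteness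
  have hp0 : 0 < p := by linarith
  have hpt : (2 : ℝ≥0∞) ^ p ≠ ∞ := ENNReal.rpow_ne_top_of_nonneg hp0.le (by simp)
  refine ⟨2 ^ p * 2, ε⁻¹, by finiteness, ENNReal.inv_ne_top.2 hε0, fun h hh => ?_⟩
  set g : ℕ → (Fin d → ℝ) → ℝ≥0∞ := fun k => sumMax^[k] h with hg
  have hgs : ∀ k, g (k + 1) = sumMax (g k) := fun k => Function.iterate_succ_apply' _ _ _
  have hgm : ∀ k, Measurable (g k) := by
    intro k
    induction k with
    | zero => exact hh
    | succ k ih => rw [hgs]; exact measurable_sumMax ih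
  have hgB : ∀ k, ∫⁻ x, g k x ^ p ≤ B ^ k * ∫⁻ x, h x ^ p := by
    intro k
    induction k with
    | zero => simp [hg]
    | succ k ih =>
      rw [hgs]
      refine (hM _ (hgm k)).trans ?_
      calc B₀ * ∫⁻ x, g k x ^ p ≤ B * (B ^ k * ∫⁻ x, h x ^ p) :=
            mul_le_mul' le_self_add ih
        _ = _ := by ring
  refine ⟨fun x => ∑' k, ε ^ k * g k x, Measurable.tsum fun k => (hgm k).const_mul _, fun x => ?_,
    ?_, fun j x => ?_⟩
  · refine le_trans (le_of_eq ?_) (ENNReal.le_tsum 0)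
    simp [hg]
  · have hpt : ∀ x, (∑' k, ε ^ k * g k x) ^ p ≤ 2 ^ p * ∑' k, (δ ^ p) ^ k * g k x ^ p := by
      intro x
      have h1 : ∑' k, ε ^ k * g k x ≤ 2 * ⨆ k, δ ^ k * g k x := by
        calc ∑' k, ε ^ k * g k x ≤ ∑' k : ℕ, 2⁻¹ ^ k * ⨆ k, δ ^ k * g k x := by
              refine ENNReal.tsum_le_tsum fun k => ?_
              rw [hε, mul_pow, mul_assoc]
              gcongr
              exact le_iSup (fun k => δ ^ k * g k x) k
          _ = _ := by rw [ENNReal.tsum_mul_right, ENNReal.tsum_geometric, ENNReal.one_sub_inv_two,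
                  inv_inv]
      calc _ ≤ (2 * ⨆ k, δ ^ k * g k x) ^ p := ENNReal.rpow_le_rpow h1 hp0.le
        _ = 2 ^ p * (⨆ k, δ ^ k * g k x) ^ p := ENNReal.mul_rpow_of_nonneg _ _ hp0.le
        _ ≤ _ := by
            gcongr
            refine (ENNReal.le_rpow_inv_iff hp0).1 (iSup_le fun k => ?_)
            rw [ENNReal.le_rpow_inv_iff hp0, ENNReal.mul_rpow_of_nonneg _ _ hp0.le]
            refine le_trans (le_of_eq ?_) (ENNReal.le_tsum k)
            rw [← ENNReal.rpow_natCast, ← ENNReal.rpow_natCast, ← ENNReal.rpow_mul,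
              ← ENNReal.rpow_mul, mul_comm p]
    have hδB : δ ^ p * B ≤ 2⁻¹ := by
      calc δ ^ p * B ≤ δ * B := by
            gcongr; exact ENNReal.rpow_le_self_of_le_one hδ1 hp.le
        _ = 2⁻¹ := by
            rw [hδ, ENNReal.mul_inv (by simp) (by simp), mul_assoc, ENNReal.inv_mul_cancel hB0 hBt,
              mul_one]
    have hm : ∀ k, Measurable fun x => (δ ^ p) ^ k * g k x ^ p := fun k =>
      ((hgm k).pow_const p).const_mul _
    calc ∫⁻ x, (∑' k, ε ^ k * g k x) ^ p ≤ ∫⁻ x, 2 ^ p * ∑' k, (δ ^ p) ^ k * g k x ^ p :=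
          lintegral_mono hpt
      _ = 2 ^ p * ∑' k, (δ ^ p) ^ k * ∫⁻ x, g k x ^ p := by
          rw [lintegral_const_mul' _ _ ‹_›, lintegral_tsum fun k => (hm k).aemeasurable]
          congr 1
          exact tsum_congr fun k => lintegral_const_mul _ ((hgm k).pow_const p)
      _ ≤ 2 ^ p * ∑' k : ℕ, 2⁻¹ ^ k * ∫⁻ x, h x ^ p := by
          refine mul_le_mul_right (ENNReal.tsum_le_tsum fun k => ?_) _
          calc (δ ^ p) ^ k * ∫⁻ x, g k x ^ p ≤ (δ ^ p) ^ k * (B ^ k * ∫⁻ x, h x ^ p) := by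
                gcongr; exact hgB k
            _ = (δ ^ p * B) ^ k * ∫⁻ x, h x ^ p := by rw [mul_pow, mul_assoc]
            _ ≤ _ := by gcongr
      _ = _ := by
          rw [ENNReal.tsum_mul_right, ENNReal.tsum_geometric, ENNReal.one_sub_inv_two, inv_inv,
            mul_assoc]
  · refine (coordMax_tsum_le j hgm _ x).trans ?_
    rw [mul_comm, ← div_eq_mul_inv, ENNReal.le_div_iff_mul_le (Or.inl hε0) (Or.inl hεt),
      ← ENNReal.tsum_mul_right]
    -- The maximal function of the `k`-th iterate is at most the next iterate, so the series is
    -- shifted by one term at the cost of `ε⁻¹`.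
    refine (ENNReal.tsum_le_tsum fun k => ?_).trans
      (ENNReal.tsum_comp_le_tsum_of_injective (add_left_injective 1) fun k => ε ^ k * g k x)
    simp only [hgs]
    rw [mul_right_comm, ← pow_succ]
    gcongr
    exact Finset.single_le_sum (f := fun j => coordMax j (g k) x) (fun _ _ => zero_le)
      (Finset.mem_univ j)

/-! ### Extrapolation -/

/-- Bounded functions are dominated by positive and finite functions that are essentially no smaller
than their maximal functions in the coordinate directions. -/
theorem exists_pos_finite_coordMax_le (d : ℕ) {p : ℝ} (hp : 1 < p) :
    ∃ C c : ℝ≥0∞, C ≠ ∞ ∧ c ≠ ∞ ∧ ∀ (h : (Fin d → ℝ) → ℝ≥0∞), Measurable h →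
      ∀ B : ℝ≥0∞, B ≠ ∞ → (∀ x, h x ≤ B) → ∀ δ : ℝ≥0∞, δ ≠ 0 →
      ∃ H : (Fin d → ℝ) → ℝ≥0∞, Measurable H ∧ (∀ x, h x ≤ H x) ∧ (∀ x, H x ≠ 0) ∧
        (∀ x, H x ≠ ∞) ∧ ∫⁻ x, H x ^ p ≤ C * ((∫⁻ x, h x ^ p) + δ) ∧
        ∀ j x, coordMax j H x ≤ c * H x := by
  obtain ⟨C, c, hC, hc, hR⟩ := exists_le_coordMax_le d hp
  have hp0 : 0 < p := by linarith
  have h2 : (2 : ℝ≥0∞) ^ (p - 1) ≠ ∞ := ENNReal.rpow_ne_top_of_nonneg (by linarith) (by simp)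
  refine ⟨C * 2 ^ (p - 1), c + 1, by finiteness, by finiteness, fun h hh B hB hhB δ hδ => ?_⟩
  obtain ⟨G, hG0, hGm, hGδ⟩ :=
    exists_pos_lintegral_lt_of_sigmaFinite (volume : Measure (Fin d → ℝ)) hδ
  -- A positive function whose `p`-th power has integral below `δ` is added, so that the majorant
  -- vanishes nowhere.
  set u : (Fin d → ℝ) → ℝ≥0∞ := fun x => h x + (G x : ℝ≥0∞) ^ (1 / p) with hu
  have hGm' : Measurable fun x => (G x : ℝ≥0∞) := hGm.coe_nnreal_ennreal
  have hum : Measurable u := hh.add (hGm'.pow_const _)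
  obtain ⟨H, hHm, huH, hHp, hHc⟩ := hR u hum
  have hu0 : ∀ x, u x ≠ 0 := by
    intro x h0
    have h1 : (G x : ℝ≥0∞) ^ (1 / p) = 0 := by
      rw [hu] at h0
      exact (add_eq_zero.1 h0).2
    rw [ENNReal.rpow_eq_zero_iff_of_pos (by positivity)] at h1
    exact (hG0 x).ne' (by simpa using h1)
  have hH0 : ∀ x, H x ≠ 0 := fun x h0 => hu0 x (le_zero_iff.1 (h0 ▸ huH x))
  -- The cap `B + 1` makes the majorant finite, still above `h`. A constant bounds its own maximal
  -- function, so the bound for the maximal functions survives with `c + 1`.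
  refine ⟨fun x => min (H x) (B + 1), hHm.min measurable_const,
    fun x => le_min (le_self_add.trans (huH x)) ((hhB x).trans le_self_add), fun x => ?_, fun x => ?_,
    ?_, fun j x => ?_⟩
  · exact (lt_min (pos_iff_ne_zero.2 (hH0 x)) (by simp)).ne'
  · exact ne_top_of_le_ne_top (by finiteness) (min_le_right _ _)
  · calc ∫⁻ x, min (H x) (B + 1) ^ p ≤ ∫⁻ x, H x ^ p :=
          lintegral_mono fun x => ENNReal.rpow_le_rpow (min_le_left _ _) hp0.le
      _ ≤ C * ∫⁻ x, u x ^ p := hHp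
      _ ≤ C * ∫⁻ x, 2 ^ (p - 1) * (h x ^ p + G x) := by
          gcongr with x
          refine (ENNReal.rpow_add_le_mul_rpow_add_rpow _ _ hp.le).trans (le_of_eq ?_)
          rw [← ENNReal.rpow_mul, one_div_mul_cancel hp0.ne', ENNReal.rpow_one]
      _ = C * 2 ^ (p - 1) * ((∫⁻ x, h x ^ p) + ∫⁻ x, (G x : ℝ≥0∞)) := by
          rw [lintegral_const_mul' _ _ h2, lintegral_add_right _ hGm', mul_assoc]
      _ ≤ _ := by gcongr
  · simp only [mul_min]
    refine le_min ?_ ?_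
    · exact (coordMax_mono j (fun y => min_le_left _ _) x).trans ((hHc j x).trans
        (mul_le_mul_left le_self_add _))
    · refine (maxFn_le_of_le (fun _ => min_le_right _ _) _).trans ?_
      exact le_mul_of_one_le_left' le_add_self

theorem isLineA2_mul_inv {d : ℕ} {H₁ H₂ : (Fin d → ℝ) → ℝ≥0∞} {c : ℝ≥0∞} (hc : c ≠ ∞)
    (hm₁ : Measurable H₁) (hm₂ : Measurable H₂) (h0₁ : ∀ x, H₁ x ≠ 0) (h0₂ : ∀ x, H₂ x ≠ 0)
    (ht₁ : ∀ x, H₁ x ≠ ∞) (ht₂ : ∀ x, H₂ x ≠ ∞) (hc₁ : ∀ j x, coordMax j H₁ x ≤ c * H₁ x)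
    (hc₂ : ∀ j x, coordMax j H₂ x ≤ c * H₂ x) :
    IsLineA2 ((2 * c) ^ 2) fun x => H₂ x * (H₁ x)⁻¹ where
  measurable := hm₂.mul hm₁.inv
  line j x := by
    have hu := (measurable_update_uncurry j).comp (measurable_prodMk_left (x := x))
    refine isA2_mul_inv hc (hm₁.comp hu) (hm₂.comp hu) (fun _ => h0₁ _) (fun _ => h0₂ _)
      (fun _ => ht₁ _) (fun _ => ht₂ _) (fun t => ?_) fun t => ?_
    · have := hc₁ j (Function.update x j t)
      rwa [coordMax_update] at this
    · have := hc₂ j (Function.update x j t)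
      rwa [coordMax_update] at this

/-- The duality step of the extrapolation: a pairing is controlled by one suitable weight. -/
theorem sq_lintegral_mul_le_of_weight {α : Type*} [MeasurableSpace α] {μ : Measure α} {A : ℝ≥0∞}
    {F g h H₁ H₂ : α → ℝ≥0∞} (hF : Measurable F) (hm₁ : Measurable H₁) (hm₂ : Measurable H₂)
    (h0₁ : ∀ x, H₁ x ≠ 0) (h0₂ : ∀ x, H₂ x ≠ 0) (ht₁ : ∀ x, H₁ x ≠ ∞) (ht₂ : ∀ x, H₂ x ≠ ∞)
    (hg : ∀ x, g x ≤ H₁ x) (hh : ∀ x, h x ≤ H₂ x)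
    (hA : ∫⁻ x, F x ^ 2 * (H₂ x * (H₁ x)⁻¹) ∂μ ≤ A * ∫⁻ x, g x ^ 2 * (H₂ x * (H₁ x)⁻¹) ∂μ) :
    (∫⁻ x, F x * h x ∂μ) ^ 2 ≤ A * (∫⁻ x, H₁ x * H₂ x ∂μ) ^ 2 := by
  set w : α → ℝ≥0∞ := fun x => H₂ x * (H₁ x)⁻¹ with hw
  have hw0 : ∀ x, w x ≠ 0 := fun x => mul_ne_zero (h0₂ x) (ENNReal.inv_ne_zero.2 (ht₁ x))
  have hwt : ∀ x, w x ≠ ∞ := fun x => ENNReal.mul_ne_top (ht₂ x) (ENNReal.inv_ne_top.2 (h0₁ x))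
  have hwm : Measurable w := hm₂.mul hm₁.inv
  have hsq : ∀ (z : ℝ≥0∞) (s : ℝ), (z ^ s) ^ 2 = z ^ (s * 2) := fun z s => by
    rw [← ENNReal.rpow_natCast, ← ENNReal.rpow_mul]; norm_num
  have hmF : Measurable fun x => F x * w x ^ (1 / 2 : ℝ) := hF.mul (hwm.pow_const _)
  have hmH : Measurable fun x => w x ^ (-(1 / 2) : ℝ) * H₂ x := (hwm.pow_const _).mul hm₂
  have h1 : ∀ x, F x * h x ≤ (F x * w x ^ (1 / 2 : ℝ)) * (w x ^ (-(1 / 2) : ℝ) * H₂ x) := by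
    intro x
    have : w x ^ (1 / 2 : ℝ) * w x ^ (-(1 / 2) : ℝ) = 1 := by
      rw [← ENNReal.rpow_add _ _ (hw0 x) (hwt x)]; norm_num
    calc F x * h x ≤ F x * H₂ x := by gcongr; exact hh x
      _ = F x * (w x ^ (1 / 2 : ℝ) * w x ^ (-(1 / 2) : ℝ)) * H₂ x := by rw [this, mul_one]
      _ = _ := by ring
  have h2 : ∀ x, (F x * w x ^ (1 / 2 : ℝ)) ^ 2 = F x ^ 2 * w x := by
    intro x
    rw [mul_pow, hsq]; norm_num
  -- For `w = H₂ / H₁` both `w⁻¹ H₂²` and `w H₁²` equal `H₁ H₂`, so the two factors of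
  -- Cauchy–Schwarz lead to the same integral.
  have h3 : ∀ x, (w x ^ (-(1 / 2) : ℝ) * H₂ x) ^ 2 = H₁ x * H₂ x := by
    intro x
    rw [mul_pow, hsq]
    norm_num
    rw [ENNReal.rpow_neg_one, hw]
    simp only
    rw [ENNReal.mul_inv (Or.inl (h0₂ x)) (Or.inl (ht₂ x)), inv_inv]
    calc _ = (H₂ x)⁻¹ * H₂ x * (H₁ x * H₂ x) := by ring
      _ = _ := by rw [ENNReal.inv_mul_cancel (h0₂ x) (ht₂ x), one_mul]
  have h4 : ∀ x, g x ^ 2 * w x ≤ H₁ x * H₂ x := by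
    intro x
    calc g x ^ 2 * w x ≤ H₁ x ^ 2 * w x := by gcongr; exact hg x
      _ = (H₁ x * (H₁ x)⁻¹) * (H₁ x * H₂ x) := by rw [hw]; ring
      _ = _ := by rw [ENNReal.mul_inv_cancel (h0₁ x) (ht₁ x), one_mul]
  calc (∫⁻ x, F x * h x ∂μ) ^ 2
      ≤ (∫⁻ x, (F x * w x ^ (1 / 2 : ℝ)) * (w x ^ (-(1 / 2) : ℝ) * H₂ x) ∂μ) ^ 2 := by
        exact pow_le_pow_left' (lintegral_mono h1) 2
    _ ≤ (∫⁻ x, (F x * w x ^ (1 / 2 : ℝ)) ^ 2 ∂μ) * ∫⁻ x, (w x ^ (-(1 / 2) : ℝ) * H₂ x) ^ 2 ∂μ :=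
        sq_lintegral_mul_le μ hmF.aemeasurable hmH.aemeasurable
    _ = (∫⁻ x, F x ^ 2 * w x ∂μ) * ∫⁻ x, H₁ x * H₂ x ∂μ := by simp_rw [h2, h3]
    _ ≤ (A * ∫⁻ x, H₁ x * H₂ x ∂μ) * ∫⁻ x, H₁ x * H₂ x ∂μ := by
        exact mul_le_mul_left (hA.trans (mul_le_mul_right (lintegral_mono h4) _)) _
    _ = _ := by ring

/-- It suffices to bound the integrals of the truncations. -/
theorem lintegral_rpow_le_of_truncation {α : Type*} [MeasurableSpace α] {μ : Measure α}
    [SigmaFinite μ] {F : α → ℝ≥0∞} (hF : Measurable F) {p : ℝ} (hp : 0 < p) {M : ℝ≥0∞}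
    (h : ∀ G : α → ℝ≥0∞, Measurable G → (∀ x, G x ≤ F x) → (∃ n : ℕ, ∀ x, G x ≤ n) →
      ∫⁻ x, G x ^ p ∂μ ≠ ∞ → ∫⁻ x, G x ^ p ∂μ ≤ M) :
    ∫⁻ x, F x ^ p ∂μ ≤ M := by
  set G : ℕ → α → ℝ≥0∞ := fun n => (spanningSets μ n).indicator fun x => min (F x) n with hG
  have hGm : ∀ n, Measurable (G n) := fun n =>
    (hF.min measurable_const).indicator (measurableSet_spanningSets μ n)
  have hGn : ∀ n x, G n x ≤ n := fun n x => by
    rw [hG]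
    exact Set.indicator_le_self' (fun _ _ => zero_le) x |>.trans (min_le_right _ _)
  have hGF : ∀ n x, G n x ≤ F x := fun n x => by
    rw [hG]
    exact Set.indicator_le_self' (fun _ _ => zero_le) x |>.trans (min_le_left _ _)
  have hfin : ∀ n, ∫⁻ x, G n x ^ p ∂μ ≠ ∞ := by
    intro n
    have hnp : ((n : ℝ≥0∞)) ^ p ≠ ∞ := ENNReal.rpow_ne_top_of_nonneg hp.le (by simp)
    have hle : ∫⁻ x, G n x ^ p ∂μ ≤ ∫⁻ x in spanningSets μ n, (n : ℝ≥0∞) ^ p ∂μ := by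
      rw [← lintegral_indicator (measurableSet_spanningSets μ n)]
      refine lintegral_mono fun x => ?_
      by_cases hx : x ∈ spanningSets μ n
      · rw [Set.indicator_of_mem hx]
        exact ENNReal.rpow_le_rpow (hGn n x) hp.le
      · simp [hG, hx, hp]
    refine ne_top_of_le_ne_top ?_ hle
    rw [setLIntegral_const]
    have := (measure_spanningSets_lt_top μ n).ne
    finiteness
  have hlim : ∀ x, Filter.Tendsto (fun n => G n x ^ p) Filter.atTop (nhds (F x ^ p)) := by
    intro x
    refine Filter.Tendsto.ennrpow_const p ?_
    have h1 : Filter.Tendsto (fun n : ℕ => min (F x) (n : ℝ≥0∞)) Filter.atTop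
        (nhds (min (F x) ∞)) := tendsto_const_nhds.min ENNReal.tendsto_nat_nhds_top
    rw [min_top_right] at h1
    refine h1.congr' ?_
    filter_upwards [Filter.eventually_ge_atTop (spanningSetsIndex μ x)] with n hn
    have hx : x ∈ spanningSets μ n :=
      monotone_spanningSets μ hn (mem_spanningSetsIndex μ x)
    rw [hG]
    simp only [Set.indicator_of_mem hx]
  calc ∫⁻ x, F x ^ p ∂μ = ∫⁻ x, Filter.liminf (fun n => G n x ^ p) Filter.atTop ∂μ :=
        lintegral_congr fun x => (hlim x).liminf_eq.symm
    _ ≤ Filter.liminf (fun n => ∫⁻ x, G n x ^ p ∂μ) Filter.atTop :=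
        lintegral_liminf_le fun n => (hGm n).pow_const p
    _ ≤ M := by
        refine Filter.liminf_le_of_le (by isBoundedDefault) fun b hb => ?_
        obtain ⟨n, hn⟩ := hb.exists
        exact hn.trans (h (G n) (hGm n) (hGF n) ⟨n, hGn n⟩ (hfin n))

/-- Weighted `L²` bounds with weights that are `A₂` on the lines in the coordinate directions imply
unweighted `L^p` bounds. -/
theorem exists_lintegral_rpow_le_of_weighted (d : ℕ) {p : ℝ} (hp : 1 < p) :
    ∃ Q : ℝ≥0∞, Q ≠ ∞ ∧ ∀ A : ℝ≥0∞, A ≠ ∞ → ∃ C : ℝ≥0∞, C ≠ ∞ ∧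
      ∀ F g : (Fin d → ℝ) → ℝ≥0∞, Measurable F → Measurable g → (∃ B : ℝ≥0∞, B ≠ ∞ ∧ ∀ x, g x ≤ B) →
        (∀ w, IsLineA2 Q w → ∫⁻ x, F x ^ 2 * w x ≤ A * ∫⁻ x, g x ^ 2 * w x) →
        ∫⁻ x, F x ^ p ≤ C * ∫⁻ x, g x ^ p := by
  set q := Real.conjExponent p with hq
  have hpq : p.HolderConjugate q := Real.HolderConjugate.conjExponent hp
  have hp0 : 0 < p := hpq.pos
  have hq0 : 0 < q := hpq.symm.pos
  obtain ⟨C₁, c₁, hC₁, hc₁, hR₁⟩ := exists_pos_finite_coordMax_le d hp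
  obtain ⟨C₂, c₂, hC₂, hc₂, hR₂⟩ := exists_pos_finite_coordMax_le d hpq.symm.lt
  refine ⟨(2 * (c₁ + c₂)) ^ 2, by finiteness, fun A hA => ?_⟩
  set D : ℝ≥0∞ := (A ^ (1 / 2 : ℝ) * (C₂ * 2) ^ (1 / q)) ^ p * C₁ with hD
  have hDt : D ≠ ∞ := by
    have h1 : A ^ (1 / 2 : ℝ) ≠ ∞ := ENNReal.rpow_ne_top_of_nonneg (by norm_num) hA
    have h2 : (C₂ * 2) ^ (1 / q) ≠ ∞ :=
      ENNReal.rpow_ne_top_of_nonneg (by positivity) (by finiteness)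
    have h3 : (A ^ (1 / 2 : ℝ) * (C₂ * 2) ^ (1 / q)) ^ p ≠ ∞ :=
      ENNReal.rpow_ne_top_of_nonneg hp0.le (by finiteness)
    finiteness
  refine ⟨D, hDt, fun F g hF hg ⟨B, hB, hgB⟩ hw => ?_⟩
  -- The truncation makes `X` finite, so that a power of `X` can be cancelled at the end, and makes
  -- the dual function `G ^ (p - 1)` bounded, as the construction of `H₂` requires.
  refine lintegral_rpow_le_of_truncation hF hp0 fun G hG hGF ⟨n, hGn⟩ hGt => ?_
  set X := ∫⁻ x, G x ^ p with hX
  by_cases hX0 : X = 0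
  · rw [hX0]; exact zero_le
  have key : ∀ δ : ℝ≥0∞, δ ≠ 0 → X ≤ D * ((∫⁻ x, g x ^ p) + δ) := by
    intro δ hδ
    obtain ⟨H₁, hm₁, hg₁, h0₁, ht₁, hH₁, hM₁⟩ := hR₁ g hg B hB hgB δ hδ
    have hhB : ∀ x, G x ^ (p - 1) ≤ (n : ℝ≥0∞) ^ (p - 1) := fun x =>
      ENNReal.rpow_le_rpow (hGn x) (by linarith)
    -- The error allowed here is `X` itself: since `(p - 1) q = p`, the `q`-th power of the dual
    -- function integrates to `X`, and the total is `2X`.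
    obtain ⟨H₂, hm₂, hg₂, h0₂, ht₂, hH₂, hM₂⟩ := hR₂ (fun x => G x ^ (p - 1)) (hG.pow_const _)
      ((n : ℝ≥0∞) ^ (p - 1)) (ENNReal.rpow_ne_top_of_nonneg (by linarith) (by simp)) hhB X hX0
    have hGq : ∀ x, (G x ^ (p - 1)) ^ q = G x ^ p := fun x => by
      rw [← ENNReal.rpow_mul, hpq.sub_one_mul_conj]
    simp_rw [hGq] at hH₂
    rw [← hX, ← two_mul, ← mul_assoc] at hH₂
    have hA2 := isLineA2_mul_inv (c := c₁ + c₂) (by finiteness) hm₁ hm₂ h0₁ h0₂ ht₁ ht₂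
      (fun j x => (hM₁ j x).trans (mul_le_mul_left le_self_add _))
      (fun j x => (hM₂ j x).trans (mul_le_mul_left le_add_self _))
    have h1 := sq_lintegral_mul_le_of_weight hF hm₁ hm₂ h0₁ h0₂ ht₁ ht₂ hg₁ hg₂ (hw _ hA2)
    have h2 : X ≤ ∫⁻ x, F x * G x ^ (p - 1) := by
      refine lintegral_mono fun x => ?_
      calc G x ^ p = G x * G x ^ (p - 1) := by
            nth_rw 2 [← ENNReal.rpow_one (G x)]
            rw [← ENNReal.rpow_add_of_nonneg _ _ (by norm_num) (by linarith)]
            congr 1; ring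
        _ ≤ _ := by gcongr; exact hGF x
    set Y := ∫⁻ x, H₁ x * H₂ x with hY
    have h3 : X ≤ A ^ (1 / 2 : ℝ) * Y := by
      have h4 : X ^ 2 ≤ A * Y ^ 2 := (pow_le_pow_left' h2 2).trans h1
      have h5 := ENNReal.rpow_le_rpow h4 (show (0 : ℝ) ≤ 1 / 2 by norm_num)
      rw [ENNReal.mul_rpow_of_nonneg _ _ (by norm_num), ← ENNReal.rpow_natCast,
        ← ENNReal.rpow_natCast, ← ENNReal.rpow_mul, ← ENNReal.rpow_mul] at h5
      norm_num at h5
      simpa using h5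
    have h4 : Y ≤ (C₁ * ((∫⁻ x, g x ^ p) + δ)) ^ (1 / p) * (C₂ * 2 * X) ^ (1 / q) :=
      (ENNReal.lintegral_mul_le_Lp_mul_Lq volume hpq hm₁.aemeasurable hm₂.aemeasurable).trans
        (mul_le_mul' (ENNReal.rpow_le_rpow hH₁ (by positivity))
          (ENNReal.rpow_le_rpow hH₂ (by positivity)))
    have h5 : X ^ (1 / p) * X ^ (1 / q) ≤ (A ^ (1 / 2 : ℝ) * (C₂ * 2) ^ (1 / q) *
        (C₁ * ((∫⁻ x, g x ^ p) + δ)) ^ (1 / p)) * X ^ (1 / q) := by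
      rw [← ENNReal.rpow_add_of_nonneg _ _ (by positivity) (by positivity), one_div, one_div,
        hpq.inv_add_inv_eq_one, ENNReal.rpow_one, ← one_div, ← one_div]
      refine (h3.trans (mul_le_mul_right h4 _)).trans (le_of_eq ?_)
      rw [ENNReal.mul_rpow_of_nonneg (C₂ * 2) X (by positivity)]
      ring
    have hXq0 : X ^ (1 / q) ≠ 0 := by
      rw [ne_eq, ENNReal.rpow_eq_zero_iff_of_pos (by positivity)]; exact hX0
    have hXqt : X ^ (1 / q) ≠ ∞ := ENNReal.rpow_ne_top_of_nonneg (by positivity) hGt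
    have h6 := ENNReal.rpow_le_rpow ((ENNReal.mul_le_mul_iff_left hXq0 hXqt).1 h5) hp0.le
    rwa [ENNReal.mul_rpow_of_nonneg _ _ hp0.le, ← ENNReal.rpow_mul, ← ENNReal.rpow_mul,
      one_div_mul_cancel hp0.ne', ENNReal.rpow_one, ENNReal.rpow_one, ← mul_assoc] at h6
  -- The error for `H₁` must be sent to zero, because `∫ g ^ p` may vanish.
  have hlim : Filter.Tendsto (fun δ : ℝ≥0∞ => D * ((∫⁻ x, g x ^ p) + δ)) (nhdsWithin 0 (Set.Ioi 0))
      (nhds (D * ((∫⁻ x, g x ^ p) + 0))) := by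
    refine ENNReal.Tendsto.const_mul ?_ (Or.inr hDt)
    exact tendsto_const_nhds.add (tendsto_nhdsWithin_of_tendsto_nhds Filter.tendsto_id)
  rw [add_zero] at hlim
  exact ge_of_tendsto hlim (eventually_nhdsWithin_of_forall fun δ hδ => key δ (ne_of_gt hδ))

/-- The `L^p` bound for the governing operators on bounded functions of compact support. -/
theorem exists_lintegral_rpow_governingOp_le (d : ℕ) (K : ℝ) {p : ℝ} (hp : 1 < p) :
    ∃ C : ℝ≥0∞, C ≠ ∞ ∧ ∀ (N : ℕ), 6 ≤ N → ∀ (σ : Fin d → OpKind) (π : Equiv.Perm (Fin d))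
      (φ : DyadicRectangle d → (Fin d → ℝ) → ℂ), (∀ R, IsAdaptedRect K N R (φ R)) →
      (∀ j, σ j = .square → ∀ R, HasZeros j (φ R)) → ∀ f, IsNice f →
        ∫⁻ x, governingOp σ π φ f x ^ p ≤ C * ∫⁻ x, ‖f x‖ₑ ^ p := by
  obtain ⟨Q, hQ, hext⟩ := exists_lintegral_rpow_le_of_weighted d hp
  obtain ⟨A, hA, hW⟩ := exists_lintegral_sq_governingOp_mul_le d K hQ
  obtain ⟨C, hC, hext⟩ := hext A hA
  refine ⟨C, hC, fun N hN σ π φ hφ hz f hf => ?_⟩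
  obtain ⟨B, hB0, hB⟩ := hf.bounded
  refine hext _ _ (measurable_governingOp σ π φ f) hf.measurable.enorm
    ⟨ENNReal.ofReal B, ENNReal.ofReal_ne_top, fun x => ?_⟩ (hW N hN σ π φ hφ hz f hf)
  rw [← ofReal_norm]
  exact ENNReal.ofReal_le_ofReal (hB x)

/-! ### Passage to general functions -/

theorem rpow_liminf_le {a : ℕ → ℝ≥0∞} {b : ℝ≥0∞} (h : b ≤ Filter.liminf a Filter.atTop) {s : ℝ}
    (hs : 0 ≤ s) : b ^ s ≤ Filter.liminf (fun n => a n ^ s) Filter.atTop := by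
  refine (ENNReal.rpow_le_rpow h hs).trans (le_of_eq ?_)
  exact (ENNReal.monotone_rpow_of_nonneg hs).map_liminf_of_continuousAt a
    ENNReal.continuous_rpow_const.continuousAt

theorem tsum_le_liminf_tsum {ι : Type*} {a : ℕ → ι → ℝ≥0∞} {b : ι → ℝ≥0∞}
    (h : ∀ i, b i ≤ Filter.liminf (fun n => a n i) Filter.atTop) :
    ∑' i, b i ≤ Filter.liminf (fun n => ∑' i, a n i) Filter.atTop := by
  let _ : MeasurableSpace ι := ⊤
  simp_rw [← lintegral_count]
  exact (lintegral_mono h).trans (lintegral_liminf_le fun n => measurable_from_top)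

theorem coordNorm_le_liminf {d : ℕ} (κ : OpKind) (j : Fin d) {a : ℕ → DyadicRectangle d → ℝ≥0∞}
    {b : DyadicRectangle d → ℝ≥0∞}
    (h : ∀ R, b R ≤ Filter.liminf (fun n => a n R) Filter.atTop) (R : DyadicRectangle d) :
    coordNorm κ j b R ≤ Filter.liminf (fun n => coordNorm κ j (a n) R) Filter.atTop := by
  cases κ with
  | square =>
    simp only [coordNorm, OpKind.seqNorm]
    refine rpow_liminf_le (tsum_le_liminf_tsum fun I => ?_) (by norm_num)
    have h2 := rpow_liminf_le (h (Function.update R j I)) (s := (2 : ℕ)) (by norm_num)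
    simpa only [ENNReal.rpow_natCast] using h2
  | maximal =>
    simp only [coordNorm, OpKind.seqNorm]
    refine iSup_le fun I => (h _).trans (Filter.liminf_le_liminf (Filter.Eventually.of_forall ?_))
    exact fun n => le_iSup (fun I => a n (Function.update R j I)) I

/-- Fatou's lemma for each `ℓ²` norm, and the trivial inequality for each supremum, one norm at a
time. -/
theorem governingOp_le_liminf {d : ℕ} (σ : Fin d → OpKind) (π : Equiv.Perm (Fin d))
    (φ : DyadicRectangle d → (Fin d → ℝ) → ℂ) {f : (Fin d → ℝ) → ℂ} {g : ℕ → (Fin d → ℝ) → ℂ}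
    {x : Fin d → ℝ}
    (h : ∀ R, coeff φ f x R ≤ Filter.liminf (fun n => coeff φ (g n) x R) Filter.atTop) :
    governingOp σ π φ f x ≤ Filter.liminf (fun n => governingOp σ π φ (g n) x) Filter.atTop := by
  have key : ∀ (l : List (Fin d)) (R : DyadicRectangle d),
      l.foldr (fun j a => coordNorm (σ j) j a) (coeff φ f x) R ≤ Filter.liminf (fun n =>
        l.foldr (fun j a => coordNorm (σ j) j a) (coeff φ (g n) x) R) Filter.atTop := by
    intro l
    induction l with
    | nil => exact h
    | cons i l ih => exact coordNorm_le_liminf _ _ ih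
  exact key _ _

/-- The set on which a function is truncated. -/
def truncSet {d : ℕ} (f : (Fin d → ℝ) → ℂ) (n : ℕ) : Set (Fin d → ℝ) :=
  {x | ‖f x‖ ≤ n ∧ ∀ j, |x j| ≤ n}

section truncSet

variable {d : ℕ} {f : (Fin d → ℝ) → ℂ}

theorem measurableSet_truncSet (hf : Measurable f) (n : ℕ) : MeasurableSet (truncSet f n) := by
  have h : truncSet f n = {x | ‖f x‖ ≤ n} ∩ ⋂ j, {x | |x j| ≤ n} := by
    ext x; simp [truncSet]
  rw [h]
  refine (measurableSet_le hf.norm measurable_const).inter (MeasurableSet.iInter fun j => ?_)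
  exact measurableSet_le (continuous_abs.measurable.comp (measurable_pi_apply j)) measurable_const

theorem monotone_truncSet : Monotone (truncSet f) := by
  intro m n hmn x hx
  have h : (m : ℝ) ≤ n := by exact_mod_cast hmn
  exact ⟨hx.1.trans h, fun j => (hx.2 j).trans h⟩

theorem iUnion_truncSet : ⋃ n, truncSet f n = Set.univ := by
  refine Set.eq_univ_of_forall fun x => Set.mem_iUnion.2 ?_
  obtain ⟨n, hn⟩ := exists_nat_ge (max ‖f x‖ (∑ j, |x j|))
  refine ⟨n, (le_max_left _ _).trans hn, fun j => ?_⟩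
  exact (Finset.single_le_sum (f := fun j => |x j|) (fun _ _ => abs_nonneg _)
    (Finset.mem_univ j)).trans ((le_max_right _ _).trans hn)

theorem isNice_indicator_truncSet (hf : Measurable f) (n : ℕ) :
    IsNice ((truncSet f n).indicator f) where
  measurable := hf.indicator (measurableSet_truncSet hf n)
  bounded := by
    refine ⟨n, by positivity, fun x => ?_⟩
    by_cases hx : x ∈ truncSet f n
    · rw [Set.indicator_of_mem hx]; exact hx.1
    · simp [hx]
  support := ⟨n, fun x hx => (Set.mem_of_indicator_ne_zero hx).2⟩

theorem coeff_le_liminf_truncSet (φ : DyadicRectangle d → (Fin d → ℝ) → ℂ) (hf : Measurable f)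
    (x : Fin d → ℝ) (R : DyadicRectangle d) :
    coeff φ f x R ≤
      Filter.liminf (fun n => coeff φ ((truncSet f n).indicator f) x R) Filter.atTop := by
  by_cases hx : x ∈ R.toSet
  swap
  · rw [coeff, Set.indicator_of_notMem hx]; exact zero_le
  -- If the product is not integrable, the pairing is zero by convention and there is nothing to
  -- prove.
  by_cases hint : Integrable fun y => f y * conj (φ R y)
  swap
  · rw [coeff, Set.indicator_of_mem hx, integral_undef hint]; simp
  refine le_of_eq (Filter.Tendsto.liminf_eq ?_).symm
  simp only [coeff, Set.indicator_of_mem hx]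
  have h1 : ∀ n, ∫ y, (truncSet f n).indicator f y * conj (φ R y) =
      ∫ y in truncSet f n, f y * conj (φ R y) := by
    intro n
    rw [← integral_indicator (measurableSet_truncSet hf n)]
    refine integral_congr_ae (Filter.Eventually.of_forall fun y => ?_)
    by_cases hy : y ∈ truncSet f n <;> simp [hy]
  have h2 := tendsto_setIntegral_of_monotone (measurableSet_truncSet hf)
    monotone_truncSet (hint.integrableOn (s := ⋃ n, truncSet f n))
  rw [iUnion_truncSet, setIntegral_univ] at h2
  simp_rw [h1]
  exact (ENNReal.continuous_ofReal.tendsto _).comp (h2.norm.div_const _)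

end truncSet

theorem governingOp_congr_ae {d : ℕ} (σ : Fin d → OpKind) (π : Equiv.Perm (Fin d))
    (φ : DyadicRectangle d → (Fin d → ℝ) → ℂ) {f g : (Fin d → ℝ) → ℂ} (h : f =ᵐ[volume] g) :
    governingOp σ π φ f = governingOp σ π φ g := by
  have hc : coeff φ f = coeff φ g := by
    funext x R
    have : ∫ y, f y * conj (φ R y) = ∫ y, g y * conj (φ R y) :=
      integral_congr_ae (h.mono fun y hy => by simp only [hy])
    simp only [coeff, this]
  funext x
  rw [governingOp, governingOp, hc]

/-- The `L^p` bound for the governing operators. -/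
theorem exists_lintegral_rpow_governingOp_le_of_aestronglyMeasurable (d : ℕ) (K : ℝ) {p : ℝ}
    (hp : 1 < p) :
    ∃ C : ℝ≥0∞, C ≠ ∞ ∧ ∀ (N : ℕ), 6 ≤ N → ∀ (σ : Fin d → OpKind) (π : Equiv.Perm (Fin d))
      (φ : DyadicRectangle d → (Fin d → ℝ) → ℂ), (∀ R, IsAdaptedRect K N R (φ R)) →
      (∀ j, σ j = .square → ∀ R, HasZeros j (φ R)) →
      ∀ f : (Fin d → ℝ) → ℂ, AEStronglyMeasurable f volume →
        ∫⁻ x, governingOp σ π φ f x ^ p ≤ C * ∫⁻ x, ‖f x‖ₑ ^ p := by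
  obtain ⟨C, hC, h⟩ := exists_lintegral_rpow_governingOp_le d K hp
  refine ⟨C, hC, fun N hN σ π φ hφ hz f hf => ?_⟩
  have hp0 : 0 ≤ p := by linarith
  set g := hf.mk f with hg
  have hgm : Measurable g := hf.stronglyMeasurable_mk.measurable
  have hfg : f =ᵐ[volume] g := hf.ae_eq_mk
  rw [governingOp_congr_ae σ π φ hfg,
    lintegral_congr_ae (hfg.mono fun x hx => show ‖f x‖ₑ ^ p = ‖g x‖ₑ ^ p by rw [hx])]
  calc ∫⁻ x, governingOp σ π φ g x ^ p
      ≤ ∫⁻ x, Filter.liminf (fun n => governingOp σ π φ ((truncSet g n).indicator g) x ^ p)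
          Filter.atTop := lintegral_mono fun x => rpow_liminf_le
        (governingOp_le_liminf σ π φ (coeff_le_liminf_truncSet φ hgm x)) hp0
    _ ≤ Filter.liminf (fun n => ∫⁻ x, governingOp σ π φ ((truncSet g n).indicator g) x ^ p)
          Filter.atTop :=
        lintegral_liminf_le fun n => (measurable_governingOp σ π φ _).pow_const p
    _ ≤ C * ∫⁻ x, ‖g x‖ₑ ^ p := by
        refine Filter.liminf_le_of_le (by isBoundedDefault) fun b hb => ?_
        obtain ⟨n, hn⟩ := hb.exists
        refine hn.trans ((h N hN σ π φ hφ hz _ (isNice_indicator_truncSet hgm n)).trans ?_)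
        gcongr with x
        exact enorm_indicator_le_enorm_self _ _

end MultiParaproduct

/-- For `N` large and `1 < p < ∞`, every governing operator, formed over functions that are adapted
to the dyadic rectangles with constants `K, N` and that have zeros in each coordinate in which a
square function acts, maps `L^p(ℝ^d)` into itself, with norm at most `C = C(d, N, K, p)`. -/
theorem proposition4p3 (d : ℕ) :
    ∃ N₀ : ℕ, ∀ N : ℕ, N₀ ≤ N → ∀ (K : ℝ) (p : ℝ≥0∞), 1 < p → p < ∞ →
      ∃ C : ℝ≥0, ∀ (σ : Fin d → MultiParaproduct.OpKind) (π : Equiv.Perm (Fin d))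
        (φ : MultiParaproduct.DyadicRectangle d → (Fin d → ℝ) → ℂ),
        (∀ R, MultiParaproduct.IsAdaptedRect K N R (φ R)) →
        (∀ j, σ j = MultiParaproduct.OpKind.square →
          ∀ R, MultiParaproduct.HasZeros j (φ R)) →
        ∀ f : (Fin d → ℝ) → ℂ, MemLp f p volume →
          MemLp (MultiParaproduct.governingOp σ π φ f) p volume ∧
          eLpNorm (MultiParaproduct.governingOp σ π φ f) p volume ≤ C * eLpNorm f p volume := by
  -- Six powers of decay: two to sum the tails in the primitive of a bump, two to absorb the growth
  -- of `A₂` masses under translation, and two to sum over the translates.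
  refine ⟨6, fun N hN K p hp hpt => ?_⟩
  have hp0 : p ≠ 0 := (zero_lt_one.trans hp).ne'
  have hp1 : 1 < p.toReal := by
    have := (ENNReal.toReal_lt_toReal ENNReal.one_ne_top hpt.ne).2 hp
    rwa [ENNReal.toReal_one] at this
  have hpos : 0 ≤ 1 / p.toReal := by positivity
  obtain ⟨C, hC, h⟩ :=
    MultiParaproduct.exists_lintegral_rpow_governingOp_le_of_aestronglyMeasurable d K hp1
  have hCp : C ^ (1 / p.toReal) ≠ ∞ := ENNReal.rpow_ne_top_of_nonneg hpos hC
  refine ⟨(C ^ (1 / p.toReal)).toNNReal, fun σ π φ hφ hz f hf => ?_⟩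
  have hle : eLpNorm (MultiParaproduct.governingOp σ π φ f) p volume ≤
      (C ^ (1 / p.toReal)).toNNReal * eLpNorm f p volume := by
    rw [ENNReal.coe_toNNReal hCp, eLpNorm_eq_lintegral_rpow_enorm_toReal hp0 hpt.ne,
      eLpNorm_eq_lintegral_rpow_enorm_toReal hp0 hpt.ne, ← ENNReal.mul_rpow_of_nonneg _ _ hpos]
    simp only [enorm_eq_self]
    exact ENNReal.rpow_le_rpow (h N hN σ π φ hφ hz f hf.1) hpos
  refine ⟨⟨(MultiParaproduct.measurable_governingOp σ π φ f).aestronglyMeasurable, ?_⟩, hle⟩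
  exact hle.trans_lt (ENNReal.mul_lt_top ENNReal.coe_lt_top hf.2)
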